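/- **Setting.** Let $d\ge 1$, let $W\subset\mathbb R^d$ be compact with $o\in W$. For a space $V$, $\mathcal M(V)$ denotes the finite nonnegative Borel measures on $V$ with the weak topology. Let $\mu\in\mathcal M(W)$ be absolutely continuous with respect to Lebesgue measure with $\mu(W)>0$. On a probability space let $(N(\lambda))_{\lambda\ge0}$ be a homogeneous Poisson process with intensity $\mu(W)$ and $(X_i)_{i\ge1}$ an i.i.d. sequence with law $\mu/\mu(W)$, independent of $N$; put $I^\lambda=\{1,\dots,N(\lambda)\}$ and $X^\lambda=\{X_i:i\in I^\lambda\}$ (a Poisson point process with intensity measure $\lambda\mu$), and $L_\lambda=\frac1\lambda\sum_{i\in I^\lambda}\delta_{X_i}$. Fix $k_{\max}\in\mathbb N=\{1,2,\dots\}$, continuous functions $f_k\colon\mathcal M(W)\times W^k\to\mathbb R$ bounded from below ($1\le k\le k_{\max}$), a function $\eta\colon\mathbb N_0\to\mathbb R$ bounded from below with $\eta(m)/m\to\infty$, and $\gamma,\beta>0$. A configuration $s=(s^i)_{i\in I^\lambda}$ assigns to every user $i$ a number of hops $k_i\in\{1,\dots,k_{\max}\}$ and a trajectory $s^i_0=X_i$,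 $s^i_1,\dots,s^i_{k_i-1}\in X^\lambda$, $s^i_{k_i}=o$; $\mathcal S$ is the set of all configurations. Put $m_i(s)=\sum_{j\in I^\lambda}\sum_{l=1}^{k_j-1}\mathbf 1\{s^j_l=X_i\}$ and $$Z^{\gamma,\beta}_\lambda(X^\lambda)=\sum_{s\in\mathcal S}\Big(\prod_{i\in I^\lambda}N(\lambda)^{-(k_i-1)}\Big)\exp\Big\{-\gamma\sum_{i\in I^\lambda}f_{k_i}(L_\lambda,s^i_0,\dots,s^i_{k_i-1})-\beta\sum_{i\in I^\lambda}\eta(m_i(s))\Big\}.$$ An *admissible trajectory setting* is a family $\Psi=((\nu_k)_{k=1}^{k_{\max}},(\mu_m)_{m=0}^\infty)$ with $\nu_k\in\mathcal M(W^k)$, $\mu_m\in\mathcal M(W)$ and $$\sum_{k=1}^{k_{\max}}\pi_0\nu_k=\mu,\qquad \sum_{m=0}^\infty\mu_m=\mu,\qquad M:=\sum_{m=0}^\infty m\mu_m=\sum_{k=1}^{k_{\max}}\sum_{l=1}^{k-1}\pi_l\nu_k,$$ where $\pi_l\nu_k$ is the $l$-th marginal of $\nu_k$ (coordinates of $W^k$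 numbered $0,\dots,k-1$). For finite measures let $\mathcal H(\nu\mid\rho)=\int\log\frac{d\nu}{d\rho}\,d\nu-\nu(V)+\rho(V)$ if $\nu\ll\rho$, and $+\infty$ otherwise. With $c_m=e^{-1/(e\mu(W))}(e\mu(W))^{-m}/m!$ put $$\mathrm I(\Psi)=\sum_{k=1}^{k_{\max}}\mathcal H(\nu_k\mid\mu\otimes M^{\otimes(k-1)})+\sum_{m=0}^\infty\mathcal H(\mu_m\mid c_m\mu)+\mu(W)\Big(1-\sum_{k=1}^{k_{\max}}M(W)^{k-1}\Big)-\frac1e\in(-\infty,\infty]$$ (with $0^0=1$), $$\mathrm S(\Psi)=\sum_{k=1}^{k_{\max}}\int_{W^k}f_k(\mu,x)\,\nu_k(dx),\qquad \mathrm M(\Psi)=\sum_{m=0}^\infty\eta(m)\mu_m(W)\in(-\infty,\infty].$$ **Theorem.** For almost every $\omega$, $$\lim_{\lambda\to\infty}\frac1\lambda\log Z^{\gamma,\beta}_\lambda(X^\lambda(\omega))=-\inf_{\Psi}\big(\mathrm I(\Psi)+\gamma\,\mathrm S(\Psi)+\beta\,\mathrm M(\Psi)\big),$$ where the infimum is over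 all admissible trajectory settings $\Psi$. -/

import Mathlib

open MeasureTheory ProbabilityTheory Filter Topology
open scoped ENNReal NNReal Nat

noncomputable section

namespace MessageRouteing

/-- `N` is a homogeneous Poisson process on `[0, ∞)` with intensity `r` under `P`: it starts at `0`,
has independent increments, `N t - N s` is Poisson distributed with parameter `r (t - s)`, and its
paths are almost surely nondecreasing and right-continuous. -/
structure IsPoissonProcess {Ω : Type*} [MeasurableSpace Ω] (N : ℝ≥0 → Ω → ℕ) (r : ℝ≥0)
    (P : Measure Ω) : Prop where
  measurable : ∀ t, Measurable (N t)
  zero : ∀ᵐ ω ∂P, N 0 ω = 0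
  indep_increments : HasIndepIncrements N P
  law_increments : ∀ s t, s ≤ t →
    Measure.map (fun ω => N t ω - N s ω) P = poissonMeasure (r * (t - s))
  paths : ∀ᵐ ω ∂P, Monotone (fun t => N t ω) ∧
    ∀ t, ContinuousWithinAt (fun u => N u ω) (Set.Ici t) t

section Model

variable {d : ℕ} {W : Set (EuclideanSpace ℝ (Fin d))}

/-- The users: for every `t`, the points `X 0, …, X (N t - 1)` form a Poisson point process with
intensity measure `t μ`. The number of points is a homogeneous Poisson process with intensity
`μ(W)`, and the locations are i.i.d. with law `μ / μ(W)` and independent of `N`. -/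
structure IsUserProcess {Ω : Type*} [MeasurableSpace Ω] (P : Measure Ω) (μ : FiniteMeasure W)
    (N : ℝ≥0 → Ω → ℕ) (X : ℕ → Ω → W) : Prop where
  poisson : IsPoissonProcess N μ.mass P
  measurable : ∀ i, Measurable (X i)
  law : ∀ i, Measure.map (X i) P = ((μ : Measure W) Set.univ)⁻¹ • (μ : Measure W)
  iIndep : iIndepFun X P
  indep : IndepFun (fun ω t => N t ω) (fun ω i => X i ω) P

/-! ### The finite system

Below, `n` is the number of users and `X 0, …, X (n - 1)` are their locations.
An index `κ : Fin kmax` is the number of relays of a trajectory, so that `k = κ + 1` ranges over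
`1, …, kmax` and is the number of hops. -/

open scoped Classical in
/-- The set of the user locations. -/
def userSet (n : ℕ) (X : ℕ → W) : Finset W := (Finset.range n).image X

/-- The unit mass at `x`, as an element of `M(W)`. -/
def unitMass (x : W) : FiniteMeasure W := ⟨Measure.dirac x, inferInstance⟩

/-- The empirical measure `L = (1/t) ∑ δ_{X i}` of the users. -/
def empiricalMeasure (t : ℝ≥0) (n : ℕ) (X : ℕ → W) : FiniteMeasure W :=
  t⁻¹ • ∑ i ∈ Finset.range n, unitMass (X i)

/-- A message trajectory with at most `kmax` hops, given its starting point: the number `κ` of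
relays and the relays `s₁, …, s_κ`, each of which is the location of a user. The last hop goes from
`s_κ` to the origin. -/
abbrev Trajectory (kmax n : ℕ) (X : ℕ → W) : Type :=
  Σ κ : Fin kmax, (Fin (κ : ℕ) → userSet n X)

/-- A configuration: one trajectory for each user. -/
abbrev Configuration (kmax n : ℕ) (X : ℕ → W) : Type := Fin n → Trajectory kmax n X

variable {kmax n : ℕ} {X : ℕ → W}

/-- The vector `(s₀, s₁, …, s_κ) ∈ W ^ k` for the trajectory of user `i`, where `s₀ = X i`. -/
def Configuration.path (s : Configuration kmax n X) (i : Fin n) :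
    Fin ((s i).1 + 1 : ℕ) → W :=
  Fin.cons (X i) (fun l => ((s i).2 l : W))

/-- The total interference `∑ i, f_k(L, s₀, …, s_{k-1})`. -/
def Configuration.interference (f : (κ : Fin kmax) → FiniteMeasure W × (Fin (κ + 1 : ℕ) → W) → ℝ)
    (t : ℝ≥0) (s : Configuration kmax n X) : ℝ :=
  ∑ i : Fin n, f (s i).1 (empiricalMeasure t n X, s.path i)

open scoped Classical in
/-- The number of incoming hops at user `i`. -/
def Configuration.incoming (s : Configuration kmax n X) (i : Fin n) : ℕ :=
  ∑ j : Fin n, ∑ l : Fin ((s j).1 : ℕ), if ((s j).2 l : W) = X i then 1 else 0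

/-- The total congestion. -/
def Configuration.congestion (η : ℕ → ℝ) (s : Configuration kmax n X) : ℝ :=
  ∑ i : Fin n, η (s.incoming i)

/-- The a priori weight `∏ i, n ^ (-(kᵢ - 1))` of a configuration. -/
def Configuration.weight (s : Configuration kmax n X) : ℝ :=
  ∏ i : Fin n, 1 / (n : ℝ) ^ ((s i).1 : ℕ)

/-- The partition function for the users `X 0, …, X (n - 1)`, at density parameter `t`. -/
def partitionFunction (kmax : ℕ)
    (f : (κ : Fin kmax) → FiniteMeasure W × (Fin (κ + 1 : ℕ) → W) → ℝ)
    (η : ℕ → ℝ) (γ β : ℝ) (t : ℝ≥0) (n : ℕ) (X : ℕ → W) : ℝ :=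
  ∑ s : Configuration kmax n X,
    s.weight * Real.exp (-γ * s.interference f t - β * s.congestion η)

/-! ### The variational problem -/

/-- An admissible trajectory setting: finite measures `ν κ` on `W ^ (κ + 1)` (the measure of the
trajectories with `κ` relays) and finite measures `rel m` on `W` (the measure `μ_m` of the users
with `m` incoming hops) satisfying the three constraints. -/
structure AdmissibleSetting (μ : FiniteMeasure W) (kmax : ℕ) where
  ν : (κ : Fin kmax) → FiniteMeasure (Fin (κ + 1 : ℕ) → W)
  rel : ℕ → FiniteMeasure W
  start_eq : ∑ κ : Fin kmax, Measure.map (fun x => x 0) (ν κ : Measure (Fin (κ + 1 : ℕ) → W)) =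
    (μ : Measure W)
  rel_eq : Measure.sum (fun m => (rel m : Measure W)) = (μ : Measure W)
  hops_eq : Measure.sum (fun m : ℕ => (m : ℝ≥0∞) • (rel m : Measure W)) =
    ∑ κ : Fin kmax, ∑ l : Fin (κ : ℕ),
      Measure.map (fun x => x l.succ) (ν κ : Measure (Fin (κ + 1 : ℕ) → W))

namespace AdmissibleSetting

variable {μ : FiniteMeasure W}

/-- The measure `M = ∑ m, m μ_m`. -/
def hopMeasure (Ψ : AdmissibleSetting μ kmax) : Measure W :=
  Measure.sum (fun m : ℕ => (m : ℝ≥0∞) • (Ψ.rel m : Measure W))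

/-- The limiting interference term `∑ k, ∫ f_k(μ, ·) dν_k`. -/
def interference (f : (κ : Fin kmax) → FiniteMeasure W × (Fin (κ + 1 : ℕ) → W) → ℝ)
    (Ψ : AdmissibleSetting μ kmax) : ℝ :=
  ∑ κ : Fin kmax, ∫ x, f κ (μ, x) ∂(Ψ.ν κ : Measure (Fin (κ + 1 : ℕ) → W))

/-- The limiting congestion term `∑ m, η(m) μ_m(W)`, as the difference of the sums of the positive
and of the negative parts; the latter sum is finite when `η` is bounded from below. -/
def congestion (η : ℕ → ℝ) (Ψ : AdmissibleSetting μ kmax) : EReal :=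
  ((∑' m, ENNReal.ofReal (η m) * (Ψ.rel m : Measure W) Set.univ : ℝ≥0∞) : EReal) -
    ((∑' m, ENNReal.ofReal (-η m) * (Ψ.rel m : Measure W) Set.univ : ℝ≥0∞) : EReal)

/-- The weights `c_m` of the Poisson distribution with parameter `1 / (e μ(W))`. -/
def poissonWeight (μ : FiniteMeasure W) (m : ℕ) : ℝ :=
  Real.exp (-(1 / (Real.exp 1 * (μ.mass : ℝ)))) * (1 / (Real.exp 1 * (μ.mass : ℝ))) ^ m / (m ! : ℝ)

/-- The entropy term. The relative entropy of finite measures is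
`klDiv ν ρ = ∫ log (dν/dρ) dν - ν(V) + ρ(V) ∈ [0, ∞]`, and `Measure.pi (Fin.cons μ fun _ => M)` is
the product measure `μ ⊗ M^{⊗ κ}`. -/
def entropy (Ψ : AdmissibleSetting μ kmax) : EReal :=
  ((∑ κ : Fin kmax,
      InformationTheory.klDiv (Ψ.ν κ : Measure (Fin (κ + 1 : ℕ) → W))
        (Measure.pi (Fin.cons (μ : Measure W) fun _ : Fin (κ : ℕ) => Ψ.hopMeasure)) : ℝ≥0∞) :
      EReal) +
    ((∑' m : ℕ, InformationTheory.klDiv (Ψ.rel m : Measure W)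
        (ENNReal.ofReal (poissonWeight μ m) • (μ : Measure W)) : ℝ≥0∞) : EReal) +
    (((μ.mass : ℝ) * (1 - ∑ κ : Fin kmax, Ψ.hopMeasure.real Set.univ ^ (κ : ℕ)) -
      1 / Real.exp 1 : ℝ) : EReal)

/-- The functional `I + γ S + β M` of the variational problem. -/
def freeEnergy (f : (κ : Fin kmax) → FiniteMeasure W × (Fin (κ + 1 : ℕ) → W) → ℝ)
    (η : ℕ → ℝ) (γ β : ℝ) (Ψ : AdmissibleSetting μ kmax) : EReal :=
  Ψ.entropy + ((γ * Ψ.interference f : ℝ) : EReal) + (β : EReal) * Ψ.congestion η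

end AdmissibleSetting

end Model

end MessageRouteing

end

/-! The limit is a deterministic statement about every sequence of distinct points whose number at
time t is asymptotic to t μ(W) and whose frequencies converge in the cells of arbitrarily fine
finite partitions (`tendsto_log_partitionFunction`). The strong law of large numbers provides such
sequences almost surely. By compactness of W, f_k(L, ·) converges uniformly to the uniformly
continuous function f_k(μ, ·). So, at a cost of order ε per user, γ f_k is replaced by a function Φ
of the cells visited by a trajectory (`abs_log_partitionFunction_sub_le`). The weight of a
configuration then depends only on the cell sequence of each trajectory and on the load (number of
incoming hops) of each user.

For such weights the counting is explicit. If all cell sequences and all loads m_i are given, the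
h_j relay positions lying in cell j have to be distributed among the users of that cell with
multiplicities m_i. This leaves ∏ h_j! / ∏ m_i! configurations, or none. Keeping a single type, that
is, prescribed numbers of users for each cell sequence and each load, gives the lower bound
(`le_log_partition`). For the upper bound, the Gibbs variational inequality compares the Gibbs
measure with a subprobability built from its own mean type, which yields the same expression without
a sum over types (`exists_log_sum_configWeight_le`); only the polynomially many vectors h are
summed. Stirling bounds turn both expressions into -t times `discreteEnergy`. The factorials of the
h_j cancel the weights N^{-(k-1)} to leading order, and the Poisson parameter θ = 1/(e μ(W)) is
chosen to absorb what remains linear in the number of hops.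

As t → ∞, rescaled mean types have limit points by compactness. Superlinear growth of η makes the
loads uniformly integrable, so no hops are lost and the constraints survive in the limit
(`eventually_log_partition_div_le`). Conversely, a discrete setting is made positive, truncated and
rounded to integers that satisfy the constraints exactly (`eventually_le_log_partition_div_of_lt`).

Finally, `discreteEnergy` is a sum of relative entropies over cells
(`IsDiscreteSetting.discreteEnergy_eq`). Coarse graining an admissible setting does not increase
relative entropy (`AdmissibleSetting.discreteEnergy_cellMass_le`), while a discrete setting lifts,
with densities constant on cells, to an admissible setting with the same entropies
(`AdmissibleSetting.freeEnergy_lift_le`). Hence the discrete and the continuous infimum differ by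
O(ε), and ε is arbitrary. -/

set_option linter.unusedSectionVars false

noncomputable section

namespace MessageRouteing

/-! ### Counting functions with prescribed fibre sizes -/

section Counting

open Finset

variable {A B J : Type*} [Fintype A] [Fintype B] [Fintype J]
  [DecidableEq A] [DecidableEq B] [DecidableEq J]

/-- A permutation carrying one function to another one with the same fibre sizes. -/
theorem exists_perm_comp_eq (g₀ g : A → B)
    (h : ∀ y, #{x | g x = y} = #{x | g₀ x = y}) : ∃ τ : Equiv.Perm A, g₀ ∘ τ = g := by
  have e : ∀ y, {x // g x = y} ≃ {x // g₀ x = y} := fun y =>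
    Fintype.equivOfCardEq (by rw [Fintype.card_subtype, Fintype.card_subtype, h y])
  refine ⟨(Equiv.sigmaFiberEquiv g).symm.trans
    ((Equiv.sigmaCongrRight e).trans (Equiv.sigmaFiberEquiv g₀)), ?_⟩
  funext x
  exact (e (g x) ⟨x, rfl⟩).2

/-- The solutions σ form a coset of the stabilizer of g₀, translated by the permutation τ of
`exists_perm_comp_eq`, and the order of that stabilizer is the product of the factorials of the
fibre sizes. -/
theorem card_perm_comp_eq (g₀ g : A → B)
    (h : ∀ y, #{x | g x = y} = #{x | g₀ x = y}) :
    #{σ : Equiv.Perm A | g₀ ∘ σ = g} = ∏ y, (#{x | g₀ x = y})! := by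
  obtain ⟨τ, hτ⟩ := exists_perm_comp_eq g₀ g h
  have h1 := DomMulAct.stabilizer_card g₀
  simp only [Fintype.card_subtype] at h1
  rw [← h1]
  refine Finset.card_bij (fun σ _ => τ.symm.trans σ) ?_ ?_ ?_
  · intro σ hσ
    simp only [mem_filter, mem_univ, true_and] at hσ ⊢
    funext x
    have h2 := congrFun hσ (τ.symm x)
    have h3 := congrFun hτ (τ.symm x)
    simp only [Function.comp_apply, Equiv.apply_symm_apply] at h2 h3
    simp [h2, h3]
  · intro σ _ σ' _ hh
    ext x
    have := DFunLike.congr_fun hh (τ x)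
    simpa using this
  · intro σ hσ
    simp only [mem_filter, mem_univ, true_and] at hσ
    refine ⟨τ.trans σ, ?_, ?_⟩
    · simp only [mem_filter, mem_univ, true_and]
      funext x
      have h2 := congrFun hσ (τ x)
      have h3 := congrFun hτ x
      simp only [Function.comp_apply] at h2 h3
      simp [h2, h3]
    · ext x; simp

/-- Over each j, the fibre of `a` and the disjoint union of `m y` slots for the y above j have equal
cardinality by `hm`; bijections chosen for each j are glued. -/
theorem exists_fiber_card_eq (a : A → J) (b : B → J) (m : B → ℕ)
    (hm : ∀ j, ∑ y with b y = j, m y = #{x | a x = j}) :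
    ∃ g : A → B, (∀ x, b (g x) = a x) ∧ ∀ y, #{x | g x = y} = m y := by
  have e : ∀ j, {x // a x = j} ≃ Σ y : {y // b y = j}, Fin (m y) := fun j =>
    Fintype.equivOfCardEq (by
      rw [Fintype.card_subtype, ← hm j, Fintype.card_sigma]
      simp only [Fintype.card_fin]
      exact (Finset.sum_subtype _ (by simp) _))
  refine ⟨fun x => (e (a x) ⟨x, rfl⟩).1, fun x => (e (a x) ⟨x, rfl⟩).1.2, fun y => ?_⟩
  -- The glued function uses the bijection indexed by `a x`; quantifying over j allows the equation
  -- `a x = j` to be eliminated.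
  have key : ∀ j (x : {x // a x = j}), (e (a x.1) ⟨x.1, rfl⟩).1.1 = (e j x).1.1 := by
    rintro j ⟨x, rfl⟩; rfl
  rw [← Fintype.card_fin (m y), ← Finset.card_univ]
  symm
  refine Finset.card_bij (fun i _ => ((e (b y)).symm ⟨⟨y, rfl⟩, i⟩).1) ?_ ?_ ?_
  · intro i _
    simp [key (b y) ((e (b y)).symm ⟨⟨y, rfl⟩, i⟩)]
  · intro i _ i' _ h
    have := (e (b y)).symm.injective (Subtype.ext h)
    simpa using this
  · intro x hx
    simp only [mem_filter, mem_univ, true_and] at hx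
    have hax : a x = b y := by rw [← hx]; exact (e (a x) ⟨x, rfl⟩).1.2.symm
    have h2 := key (b y) ⟨x, hax⟩
    rw [hx] at h2
    rcases hz : e (b y) ⟨x, hax⟩ with ⟨⟨y', hy'⟩, i⟩
    rw [hz] at h2
    simp only at h2
    subst h2
    exact ⟨i, mem_univ _, by rw [← hz]; simp⟩

/-- The number of functions over `J` with prescribed fibre sizes is a product of multinomial
coefficients. -/
theorem card_fiber_mul_prod_factorial (a : A → J) (b : B → J) (m : B → ℕ)
    (hm : ∀ j, ∑ y with b y = j, m y = #{x | a x = j}) :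
    #{g : A → B | (∀ x, b (g x) = a x) ∧ ∀ y, #{x | g x = y} = m y} * ∏ y, (m y)! =
      ∏ j, (#{x | a x = j})! := by
  obtain ⟨g₀, hg₀, hm₀⟩ := exists_fiber_card_eq a b m hm
  have h1 := DomMulAct.stabilizer_card a
  simp only [Fintype.card_subtype] at h1
  -- Orbit counting: the permutations preserving `a` are sorted by the function `g₀ ∘ σ` they
  -- produce, and each admissible g arises from exactly `∏ (m y)!` of them.
  rw [← h1, Finset.card_eq_sum_card_fiberwise (f := fun σ : Equiv.Perm A => g₀ ∘ σ)
    (t := {g : A → B | (∀ x, b (g x) = a x) ∧ ∀ y, #{x | g x = y} = m y}), ← smul_eq_mul,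
    ← Finset.sum_const]
  · refine Finset.sum_congr rfl fun g hg => ?_
    simp only [mem_filter, mem_univ, true_and] at hg
    have h3 := card_perm_comp_eq g₀ g (fun y => by rw [hg.2 y, hm₀ y])
    simp only [hm₀] at h3
    rw [← h3, Finset.filter_filter]
    congr 1
    ext σ
    simp only [mem_filter, mem_univ, true_and]
    refine ⟨fun h => ⟨?_, h⟩, fun h => h.2⟩
    funext x
    simp only [Function.comp_apply]
    rw [← hg.1 x, ← h, Function.comp_apply, hg₀]
  · intro σ hσ
    simp only [coe_filter, mem_univ, true_and, Set.mem_ofPred_eq] at hσ ⊢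
    refine ⟨fun x => ?_, fun y => ?_⟩
    · rw [Function.comp_apply, hg₀]; exact congrFun hσ x
    · rw [← hm₀ y]
      refine Finset.card_bij (fun x _ => σ x) (by simp) (by simp) ?_
      intro x hx
      exact ⟨σ.symm x, by simpa using hx, by simp⟩

/-- Either no function qualifies and the left side vanishes, or one does, and its existence forces
the compatibility of m with the fibres of `a` that the equality needs. -/
theorem card_fiber_mul_prod_factorial_le (a : A → J) (b : B → J) (m : B → ℕ) :
    #{g : A → B | (∀ x, b (g x) = a x) ∧ ∀ y, #{x | g x = y} = m y} * ∏ y, (m y)! ≤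
      ∏ j, (#{x | a x = j})! := by
  by_cases h : ∃ g : A → B, (∀ x, b (g x) = a x) ∧ ∀ y, #{x | g x = y} = m y
  · obtain ⟨g, hg, hm⟩ := h
    refine (card_fiber_mul_prod_factorial a b m fun j => ?_).le
    rw [Finset.card_eq_sum_card_fiberwise (f := g) (t := {y | b y = j})]
    · refine Finset.sum_congr rfl fun y hy => ?_
      rw [← hm y, Finset.filter_filter]
      congr 1
      ext x
      simp only [mem_filter, mem_univ, true_and] at hy ⊢
      exact ⟨fun h => ⟨by rw [← hg x, h, hy], h⟩, fun h => h.2⟩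
    · intro x hx
      simp only [coe_filter, mem_univ, true_and, Set.mem_ofPred_eq] at hx ⊢
      rw [hg x, hx]
  · rw [Finset.filter_false_of_mem (fun g _ hg => h ⟨g, hg⟩)]
    simp

end Counting

/-! ### Trajectories through cells, and loads of users -/

/-- A sequence of fewer than `kmax` relays in `α`. -/
abbrev RoutePath (kmax : ℕ) (α : Type*) : Type _ := Σ κ : Fin kmax, (Fin (κ : ℕ) → α)

namespace RoutePath

open Finset

variable {kmax : ℕ} {α β : Type*}

/-- The image of a sequence of relays. -/
def map (c : α → β) (p : RoutePath kmax α) : RoutePath kmax β := ⟨p.1, c ∘ p.2⟩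

/-- The number of occurrences of `a` among the relays. -/
def count [DecidableEq α] (p : RoutePath kmax α) (a : α) : ℕ := #{l | p.2 l = a}

theorem sum_count [Fintype α] [DecidableEq α] (p : RoutePath kmax α) :
    ∑ a, p.count a = (p.1 : ℕ) := by
  unfold count
  rw [← Finset.card_eq_sum_card_fiberwise (f := p.2) (s := univ) (t := univ) (by simp)]
  simp

theorem sum_count_of_map [Fintype α] [DecidableEq α] [DecidableEq β] (c : α → β)
    (p : RoutePath kmax α) (b : β) : ∑ a with c a = b, p.count a = (p.map c).count b := by
  unfold count map
  rw [Finset.card_eq_sum_card_fiberwise (f := p.2) (t := {a | c a = b})]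
  · refine Finset.sum_congr rfl fun a ha => ?_
    rw [Finset.filter_filter]
    congr 1
    ext l
    simp only [mem_filter, mem_univ, true_and, Function.comp_apply] at ha ⊢
    exact ⟨fun h => ⟨by rw [h, ha], h⟩, fun h => h.2⟩
  · intro x hx
    simpa using hx

theorem count_le [Fintype α] [DecidableEq α] (p : RoutePath kmax α) (a : α) :
    p.count a ≤ kmax :=
  (Finset.card_le_univ _).trans (by simp)

end RoutePath

section Loads

open Finset

variable {kmax : ℕ} {U J : Type*} [Fintype U] [DecidableEq U] [Fintype J] [DecidableEq J]

/-- The number of visits at `a` of a family of sequences of relays. -/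
def load {ι : Type*} [Fintype ι] (s : ι → RoutePath kmax U) (a : U) : ℕ := ∑ i, (s i).count a

theorem load_le {ι : Type*} [Fintype ι] (s : ι → RoutePath kmax U) (a : U) :
    load s a ≤ kmax * Fintype.card ι := by
  refine (Finset.sum_le_sum fun i _ => (s i).count_le a).trans ?_
  simp [mul_comm]

theorem sum_load_of_map {ι : Type*} [Fintype ι] (c : U → J) (s : ι → RoutePath kmax U) (j : J) :
    ∑ a with c a = j, load s a = load (fun i => (s i).map c) j := by
  unfold load
  rw [Finset.sum_comm]
  exact Finset.sum_congr rfl fun i _ => (s i).sum_count_of_map c j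

theorem card_slots_eq_load {ι α : Type*} [Fintype ι] [DecidableEq α]
    (P : ι → RoutePath kmax α) (a : α) :
    #{x : Σ i, Fin (P i).1 | (P x.1).2 x.2 = a} = ∑ i, (P i).count a := by
  rw [← Fintype.card_subtype]
  have e : {x : Σ i, Fin (P i).1 // (P x.1).2 x.2 = a} ≃ Σ i, {l // (P i).2 l = a} :=
    { toFun := fun x => ⟨x.1.1, x.1.2, x.2⟩
      invFun := fun x => ⟨⟨x.1, x.2.1⟩, x.2.2⟩
      left_inv := fun _ => rfl
      right_inv := fun _ => rfl }
  rw [Fintype.card_congr e, Fintype.card_sigma]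
  exact Finset.sum_congr rfl fun i _ => by rw [Fintype.card_subtype]; rfl

/-- Once P fixes the number of relays and their cells, a configuration is a function from the slots
(user, relay position) to the users over J, and its loads are the sizes of the fibres of that
function. -/
theorem card_configurations (c : U → J) (P : U → RoutePath kmax J) (m : U → ℕ) :
    #{s : U → RoutePath kmax U | (∀ i, (s i).map c = P i) ∧ ∀ a, load s a = m a} =
      #{g : (Σ i, Fin (P i).1) → U | (∀ x, c (g x) = (P x.1).2 x.2) ∧
        ∀ y, #{x | g x = y} = m y} := by
  symm
  have key : ∀ g : (Σ i, Fin (P i).1) → U, ∀ y,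
      #{x | g x = y} = load (fun i => (⟨(P i).1, fun l => g ⟨i, l⟩⟩ : RoutePath kmax U)) y := by
    intro g y
    exact card_slots_eq_load (fun i => (⟨(P i).1, fun l => g ⟨i, l⟩⟩ : RoutePath kmax U)) y
  refine Finset.card_bij
    (fun g _ i => (⟨(P i).1, fun l => g ⟨i, l⟩⟩ : RoutePath kmax U)) ?_ ?_ ?_
  · intro g hg
    simp only [mem_filter, mem_univ, true_and] at hg ⊢
    refine ⟨fun i => ?_, fun a => by rw [← hg.2 a, key]⟩
    exact Sigma.ext rfl (heq_of_eq (funext fun l => hg.1 ⟨i, l⟩))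
  · intro g _ g' _ h
    funext ⟨i, l⟩
    have := congrFun h i
    simp only [Sigma.mk.injEq, heq_eq_eq, true_and] at this
    exact congrFun this l
  · intro s hs
    simp only [mem_filter, mem_univ, true_and] at hs
    obtain ⟨h1, h2⟩ := hs
    obtain rfl : (fun i => (s i).map c) = P := funext h1
    refine ⟨fun x => (s x.1).2 x.2, ?_, rfl⟩
    simp only [mem_filter, mem_univ, true_and]
    exact ⟨fun x => rfl, fun y => by rw [← h2 y]; exact key _ y⟩

theorem card_configurations_mul_le (c : U → J) (P : U → RoutePath kmax J) (m : U → ℕ) :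
    #{s : U → RoutePath kmax U | (∀ i, (s i).map c = P i) ∧ ∀ a, load s a = m a} *
      ∏ a, (m a)! ≤ ∏ j, (load P j)! := by
  rw [card_configurations]
  refine (card_fiber_mul_prod_factorial_le (fun x : Σ i, Fin (P i).1 => (P x.1).2 x.2) c m).trans
    (le_of_eq ?_)
  exact Finset.prod_congr rfl fun j _ => by rw [card_slots_eq_load]; rfl

theorem card_configurations_mul_eq (c : U → J) (P : U → RoutePath kmax J) (m : U → ℕ)
    (hm : ∀ j, ∑ a with c a = j, m a = load P j) :
    #{s : U → RoutePath kmax U | (∀ i, (s i).map c = P i) ∧ ∀ a, load s a = m a} *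
      ∏ a, (m a)! = ∏ j, (load P j)! := by
  rw [card_configurations, card_fiber_mul_prod_factorial (fun x : Σ i, Fin (P i).1 =>
    (P x.1).2 x.2) c m fun j => by rw [hm, card_slots_eq_load]; rfl]
  exact Finset.prod_congr rfl fun j _ => by rw [card_slots_eq_load]; rfl

end Loads

/-! ### The Gibbs variational inequality and mean types -/

section Gibbs

open Finset

/-- The Gibbs variational inequality. -/
theorem log_sum_le_of_sum_le_one {σ : Type*} (S : Finset σ) (hS : S.Nonempty) (w R : σ → ℝ)
    (hw : ∀ s ∈ S, 0 < w s) (hR : ∀ s ∈ S, 0 < R s) (hsum : ∑ s ∈ S, R s ≤ 1) :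
    Real.log (∑ s ∈ S, w s) ≤
      ∑ s ∈ S, w s / (∑ s ∈ S, w s) * (Real.log (w s) - Real.log (R s)) := by
  set Z := ∑ s ∈ S, w s with hZ
  have hZ0 : 0 < Z := Finset.sum_pos hw hS
  have h1 : ∑ s ∈ S, w s / Z = 1 := by
    rw [← Finset.sum_div, ← hZ, div_self hZ0.ne']
  have h2 : ∑ s ∈ S, w s / Z * (Real.log (w s) - Real.log (R s)) - Real.log Z =
      ∑ s ∈ S, w s / Z * (Real.log (w s) - Real.log (R s) - Real.log Z) := by
    simp only [mul_sub, Finset.sum_sub_distrib]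
    rw [← Finset.sum_mul, h1, one_mul]
  -- Nonnegativity of the relative entropy of the Gibbs weights w/Z with respect to the
  -- subprobability R, termwise from log x ≤ x - 1.
  have h3 : ∀ s ∈ S, w s / Z - R s ≤
      w s / Z * (Real.log (w s) - Real.log (R s) - Real.log Z) := by
    intro s hs
    have hq : 0 < w s / Z := div_pos (hw s hs) hZ0
    have h4 := Real.log_le_sub_one_of_pos (div_pos (hR s hs) hq)
    rw [Real.log_div (hR s hs).ne' hq.ne', Real.log_div (hw s hs).ne' hZ0.ne'] at h4
    have h5 : w s / Z * (Real.log (R s) - (Real.log (w s) - Real.log Z)) ≤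
        w s / Z * (R s / (w s / Z) - 1) := mul_le_mul_of_nonneg_left h4 hq.le
    have h6 : w s / Z * (R s / (w s / Z) - 1) = R s - w s / Z := by
      rw [mul_sub, mul_one, mul_div_cancel₀ _ hq.ne']
    linarith
  have h4 := Finset.sum_le_sum h3
  rw [Finset.sum_sub_distrib, h1, ← h2] at h4
  linarith

variable {σ U J τ : Type*} [Fintype U] [Fintype J] [DecidableEq J] [DecidableEq τ]

/-- The expected number of users in cell `j` with the value `y` of a statistic `Y`. -/
def meanCount (S : Finset σ) (Q : σ → ℝ) (c : U → J) (Y : σ → U → τ) (j : J) (y : τ) : ℝ :=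
  ∑ s ∈ S, Q s * #{i | c i = j ∧ Y s i = y}

variable (S : Finset σ) (Q : σ → ℝ) (c : U → J) (Y : σ → U → τ) (T : Finset τ)

theorem meanCount_nonneg (hQ : ∀ s ∈ S, 0 ≤ Q s) (j : J) (y : τ) :
    0 ≤ meanCount S Q c Y j y :=
  Finset.sum_nonneg fun s hs => mul_nonneg (hQ s hs) (Nat.cast_nonneg _)

/-- Linearity of expectation: the mean of a functional that is additive over users depends on Q only
through the mean counts. -/
theorem sum_meanCount_mul (hT : ∀ s ∈ S, ∀ i, Y s i ∈ T) (G : J → τ → ℝ) :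
    ∑ s ∈ S, Q s * ∑ i, G (c i) (Y s i) = ∑ j, ∑ y ∈ T, meanCount S Q c Y j y * G j y := by
  unfold meanCount
  simp only [Finset.sum_mul]
  rw [Finset.sum_congr rfl fun j _ => Finset.sum_comm, Finset.sum_comm]
  refine Finset.sum_congr rfl fun s hs => ?_
  simp only [mul_assoc, ← Finset.mul_sum]
  congr 1
  rw [← Finset.sum_product' (f := fun j y => (#{i | c i = j ∧ Y s i = y} : ℝ) * G j y),
    ← Finset.sum_fiberwise_of_maps_to (g := fun i => (c i, Y s i))
    (t := (univ : Finset J) ×ˢ T) (fun i _ => by simp [hT s hs i])]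
  refine Finset.sum_congr rfl fun x _ => ?_
  rw [Finset.sum_congr rfl (g := fun _ => G x.1 x.2), Finset.sum_const, nsmul_eq_mul]
  · simp only [Prod.ext_iff]
  · intro i hi
    simp only [mem_filter, mem_univ, true_and] at hi
    rw [← hi]

theorem sum_meanCount (hT : ∀ s ∈ S, ∀ i, Y s i ∈ T) (hQ : ∑ s ∈ S, Q s = 1) (j : J) :
    ∑ y ∈ T, meanCount S Q c Y j y = #{i | c i = j} := by
  have h := sum_meanCount_mul S Q c Y T hT (fun j' _ => if j' = j then 1 else 0)
  simp only [mul_ite, mul_one, mul_zero] at h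
  rw [← Finset.sum_mul, hQ, one_mul, Finset.sum_comm] at h
  simp only [Finset.sum_ite_eq', Finset.mem_univ, if_true] at h
  rw [← h]
  simp

theorem meanCount_pos (hQ : ∀ s ∈ S, 0 < Q s) {s : σ} (hs : s ∈ S) (i : U) :
    0 < meanCount S Q c Y (c i) (Y s i) := by
  refine Finset.sum_pos' (fun s hs => mul_nonneg (hQ s hs).le (Nat.cast_nonneg _)) ⟨s, hs, ?_⟩
  refine mul_pos (hQ s hs) (Nat.cast_pos.2 (Finset.card_pos.2 ⟨i, by simp⟩))

/-- Total mass of the law under which the users choose their values independently, each with the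
mean frequencies of its own cell. -/
theorem sum_piFinset_prod_meanCount [DecidableEq U] (hT : ∀ s ∈ S, ∀ i, Y s i ∈ T)
    (hQ : ∑ s ∈ S, Q s = 1) :
    ∑ P ∈ Fintype.piFinset (fun _ : U => T),
      ∏ i, meanCount S Q c Y (c i) (P i) / #{i' | c i' = c i} = 1 := by
  have h := Finset.prod_univ_sum (fun _ : U => T)
    (fun i y => meanCount S Q c Y (c i) y / #{i' | c i' = c i})
  rw [← h]
  refine Finset.prod_eq_one fun i _ => ?_
  rw [← Finset.sum_div, sum_meanCount S Q c Y T hT hQ, div_self]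
  exact Nat.cast_ne_zero.2 (Finset.card_pos.2 ⟨i, by simp⟩).ne'

end Gibbs

/-! ### Upper bound of the finite system at fixed hop numbers -/

section FiniteSystem

open Finset

variable {kmax : ℕ} {U J : Type*} [Fintype U] [DecidableEq U] [Fintype J] [DecidableEq J]

/-- The weight of a configuration: a factor for the cells along each trajectory, and a factor
for the number of incoming hops at each user. -/
def configWeight (c : U → J) (A : J → RoutePath kmax J → ℝ) (B : ℕ → ℝ)
    (s : U → RoutePath kmax U) : ℝ :=
  (∏ i, A (c i) ((s i).map c)) * ∏ i, B (load s i)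

variable (c : U → J) (A : J → RoutePath kmax J → ℝ) (B : ℕ → ℝ)

/-- The upper bound of the sum of the weights of the configurations with prescribed numbers of
hops into each cell, in terms of the mean type. -/
theorem exists_log_sum_configWeight_le (hA : ∀ j p, 0 < A j p) (hB : ∀ m, 0 < B m) (h : J → ℕ)
    (hne : ({s : U → RoutePath kmax U | load (fun i => (s i).map c) = h} :
      Finset _).Nonempty) :
    ∃ (ν : J → RoutePath kmax J → ℝ) (u : J → ℕ → ℝ),
      (∀ j p, 0 ≤ ν j p) ∧ (∀ j m, 0 ≤ u j m) ∧
      (∀ j, ∑ p, ν j p = #{i | c i = j}) ∧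
      (∀ j, ∑ m ∈ range (kmax * Fintype.card U + 1), u j m = #{i | c i = j}) ∧
      (∀ j m, kmax * Fintype.card U + 1 ≤ m → u j m = 0) ∧
      (∀ j, ∑ m ∈ range (kmax * Fintype.card U + 1), u j m * m = h j) ∧
      (∀ j, ∑ j', ∑ p, ν j' p * (p.count j : ℝ) = h j) ∧
      Real.log (∑ s : U → RoutePath kmax U with load (fun i => (s i).map c) = h,
        configWeight c A B s) ≤
        (∑ j, ∑ p, ν j p * (Real.log (A j p) - Real.log (ν j p / #{i | c i = j}))) +
        (∑ j, ∑ m ∈ range (kmax * Fintype.card U + 1),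
          u j m * (Real.log (B m) - Real.log (u j m / #{i | c i = j}) - Real.log (m ! : ℝ))) +
        ∑ j, Real.log ((h j)! : ℝ) := by
  set K := kmax * Fintype.card U + 1 with hK
  set S : Finset (U → RoutePath kmax U) := {s | load (fun i => (s i).map c) = h} with hS
  have hw : ∀ s ∈ S, 0 < configWeight c A B s := fun s _ =>
    mul_pos (Finset.prod_pos fun i _ => hA _ _) (Finset.prod_pos fun i _ => hB _)
  set Z := ∑ s ∈ S, configWeight c A B s with hZ
  have hZ0 : 0 < Z := Finset.sum_pos hw hne
  -- The Gibbs measure itself; `ν` and `u` below are its mean numbers of users with given cell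
  -- sequence and with given load.
  set Q : (U → RoutePath kmax U) → ℝ := fun s => configWeight c A B s / Z with hQdef
  have hQ : ∀ s ∈ S, 0 < Q s := fun s hs => div_pos (hw s hs) hZ0
  have hQ1 : ∑ s ∈ S, Q s = 1 := by
    simp only [hQdef]
    rw [← Finset.sum_div, div_self hZ0.ne']
  have hSl : ∀ s ∈ S, load (fun i => (s i).map c) = h := fun s hs => by
    simpa [hS] using hs
  set Yp : (U → RoutePath kmax U) → U → RoutePath kmax J := fun s i => (s i).map c with hYp
  set Ym : (U → RoutePath kmax U) → U → ℕ := fun s i => load s i with hYm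
  have hTp : ∀ s ∈ S, ∀ i, Yp s i ∈ (univ : Finset (RoutePath kmax J)) := fun _ _ _ => mem_univ _
  have hTm : ∀ s ∈ S, ∀ i, Ym s i ∈ range K := fun s _ i =>
    Finset.mem_range.2 (Nat.lt_succ_of_le (load_le s i))
  set ν := meanCount S Q c Yp with hν
  set u := meanCount S Q c Ym with hu
  have hnc : ∀ i, (0 : ℝ) < #{i' | c i' = c i} := fun i =>
    Nat.cast_pos.2 (Finset.card_pos.2 ⟨i, by simp⟩)
  have hνpos : ∀ s ∈ S, ∀ i, 0 < ν (c i) (Yp s i) / #{i' | c i' = c i} := fun s hs i =>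
    div_pos (meanCount_pos S Q c Yp hQ hs i) (hnc i)
  have hupos : ∀ s ∈ S, ∀ i, 0 < u (c i) (Ym s i) / #{i' | c i' = c i} := fun s hs i =>
    div_pos (meanCount_pos S Q c Ym hQ hs i) (hnc i)
  refine ⟨ν, u, meanCount_nonneg S Q c Yp fun s hs => (hQ s hs).le,
    meanCount_nonneg S Q c Ym fun s hs => (hQ s hs).le,
    sum_meanCount S Q c Yp univ hTp hQ1, sum_meanCount S Q c Ym _ hTm hQ1, ?_, ?_, ?_, ?_⟩
  · intro j m hm
    refine Finset.sum_eq_zero fun s hs => ?_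
    rw [Finset.filter_false_of_mem]
    · simp
    · rintro i - ⟨-, hi⟩
      have := Finset.mem_range.1 (hTm s hs i)
      omega
  · intro j
    have h1 := sum_meanCount_mul S Q c Ym (range K) hTm (fun j' m => if j' = j then (m : ℝ) else 0)
    simp only [mul_ite, mul_zero] at h1
    rw [Finset.sum_comm] at h1
    simp only [Finset.sum_ite_eq', Finset.mem_univ, if_true] at h1
    rw [← h1, ← one_mul (h j : ℝ), ← hQ1, Finset.sum_mul]
    refine Finset.sum_congr rfl fun s hs => ?_
    rw [← Finset.sum_filter, ← Nat.cast_sum, sum_load_of_map, hSl s hs]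
  · intro j
    rw [← sum_meanCount_mul S Q c Yp univ hTp (fun _ p => (p.count j : ℝ)),
      ← one_mul (h j : ℝ), ← hQ1, Finset.sum_mul]
    refine Finset.sum_congr rfl fun s hs => ?_
    rw [← hSl s hs, ← Nat.cast_sum]; rfl
  -- The comparison subprobability: cell sequences and loads are drawn independently with the mean
  -- frequencies, and the result is shared among the compatible configurations, of which there are
  -- at most `∏ (h j)! / ∏ (m i)!`.
  · set R : (U → RoutePath kmax U) → ℝ := fun s =>
      (∏ i, ν (c i) (Yp s i) / #{i' | c i' = c i}) *
        ((∏ i, u (c i) (Ym s i) / #{i' | c i' = c i}) * (∏ i, ((Ym s i)! : ℝ))) /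
        (∏ j, ((h j)! : ℝ)) with hR
    have hh : (0 : ℝ) < ∏ j, ((h j)! : ℝ) :=
      Finset.prod_pos fun j _ => Nat.cast_pos.2 (Nat.factorial_pos _)
    have hRpos : ∀ s ∈ S, 0 < R s := fun s hs => by
      refine div_pos (mul_pos (Finset.prod_pos fun i _ => hνpos s hs i)
        (mul_pos (Finset.prod_pos fun i _ => hupos s hs i)
        (Finset.prod_pos fun i _ => Nat.cast_pos.2 (Nat.factorial_pos _)))) hh
    -- After grouping by the pair (cell sequences, loads), the counting bound cancels the factorials
    -- and two product laws of total mass one remain.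
    have hRsum : ∑ s ∈ S, R s ≤ 1 := by
      have e1 := sum_piFinset_prod_meanCount S Q c Yp univ hTp hQ1
      have e2 := sum_piFinset_prod_meanCount S Q c Ym (range K) hTm hQ1
      rw [← Finset.sum_fiberwise_of_maps_to (g := fun s => (Yp s, Ym s))
        (t := Fintype.piFinset (fun _ : U => (univ : Finset (RoutePath kmax J))) ×ˢ
          Fintype.piFinset (fun _ : U => range K))
        (fun s hs => by simpa [Fintype.mem_piFinset] using fun i => hTm s hs i)]
      refine (Finset.sum_le_sum (g := fun x =>
        (∏ i, ν (c i) (x.1 i) / #{i' | c i' = c i}) *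
          ∏ i, u (c i) (x.2 i) / #{i' | c i' = c i}) fun x _ => ?_).trans (le_of_eq ?_)
      · obtain ⟨P, m⟩ := x
        have hpm : 0 ≤ (∏ i, ν (c i) (P i) / #{i' | c i' = c i}) *
            ∏ i, u (c i) (m i) / #{i' | c i' = c i} := by
          refine mul_nonneg (Finset.prod_nonneg fun i _ => div_nonneg ?_ (Nat.cast_nonneg _))
            (Finset.prod_nonneg fun i _ => div_nonneg ?_ (Nat.cast_nonneg _))
          · exact meanCount_nonneg S Q c Yp (fun s hs => (hQ s hs).le) _ _
          · exact meanCount_nonneg S Q c Ym (fun s hs => (hQ s hs).le) _ _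
        have hfib : ∀ s ∈ S.filter (fun s => (Yp s, Ym s) = (P, m)), R s =
            ((∏ i, ν (c i) (P i) / #{i' | c i' = c i}) *
              ∏ i, u (c i) (m i) / #{i' | c i' = c i}) * (∏ i, ((m i)! : ℝ)) /
              (∏ j, ((h j)! : ℝ)) := by
          intro s hs
          have := (Finset.mem_filter.1 hs).2
          simp only [Prod.mk.injEq] at this
          simp only [hR, this.1, this.2, mul_assoc]
        rw [Finset.sum_congr rfl hfib, Finset.sum_const, nsmul_eq_mul]
        have hcard : (#(S.filter (fun s => (Yp s, Ym s) = (P, m))) : ℝ) * (∏ i, ((m i)! : ℝ)) ≤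
            ∏ j, ((h j)! : ℝ) := by
          rcases (S.filter (fun s => (Yp s, Ym s) = (P, m))).eq_empty_or_nonempty with h0 | ⟨s, hs⟩
          · rw [h0]; simpa using hh.le
          · have hP : load P = h := by
              have h1 := Finset.mem_filter.1 hs
              have h2 := h1.2
              simp only [Prod.mk.injEq] at h2
              rw [← h2.1]; exact hSl s h1.1
            have h3 := card_configurations_mul_le c P m
            rw [hP] at h3
            have h4 : #(S.filter (fun s => (Yp s, Ym s) = (P, m))) ≤
                #{s : U → RoutePath kmax U | (∀ i, (s i).map c = P i) ∧ ∀ a, load s a = m a} := by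
              refine Finset.card_le_card fun s hs => ?_
              have := (Finset.mem_filter.1 hs).2
              simp only [Prod.mk.injEq] at this
              simp only [mem_filter, mem_univ, true_and]
              exact ⟨fun i => congrFun this.1 i, fun i => congrFun this.2 i⟩
            exact_mod_cast (Nat.mul_le_mul_right _ h4).trans h3
        rw [mul_div_assoc, mul_left_comm, ← mul_div_assoc]
        refine mul_le_of_le_one_right hpm ((div_le_one hh).2 hcard)
      · rw [Finset.sum_product]
        simp only [← Finset.mul_sum]
        rw [e2, ← Finset.sum_mul, e1, one_mul]
    refine (log_sum_le_of_sum_le_one S hne _ R hw hRpos hRsum).trans (le_of_eq ?_)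
    -- Both logarithms are additive over the users, up to the constant from h, so their Gibbs mean
    -- is a function of the mean counts alone.
    have hlog : ∀ s ∈ S, Real.log (configWeight c A B s) - Real.log (R s) =
        (∑ i, (Real.log (A (c i) (Yp s i)) - Real.log (ν (c i) (Yp s i) / #{i' | c i' = c i}))) +
        (∑ i, (Real.log (B (Ym s i)) - Real.log (u (c i) (Ym s i) / #{i' | c i' = c i}) -
          Real.log ((Ym s i)! : ℝ))) + ∑ j, Real.log ((h j)! : ℝ) := by
      intro s hs
      have f1 : ∀ i ∈ (univ : Finset U), ν (c i) (Yp s i) / #{i' | c i' = c i} ≠ 0 :=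
        fun i _ => (hνpos s hs i).ne'
      have f2 : ∀ i ∈ (univ : Finset U), u (c i) (Ym s i) / #{i' | c i' = c i} ≠ 0 :=
        fun i _ => (hupos s hs i).ne'
      have f3 : ∀ i ∈ (univ : Finset U), ((Ym s i)! : ℝ) ≠ 0 :=
        fun i _ => Nat.cast_ne_zero.2 (Nat.factorial_ne_zero _)
      have f4 : ∀ j ∈ (univ : Finset J), ((h j)! : ℝ) ≠ 0 :=
        fun i _ => Nat.cast_ne_zero.2 (Nat.factorial_ne_zero _)
      simp only [configWeight, hR]
      rw [Real.log_mul (Finset.prod_ne_zero_iff.2 fun i _ => (hA _ _).ne')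
        (Finset.prod_ne_zero_iff.2 fun i _ => (hB _).ne'),
        Real.log_div (mul_ne_zero (Finset.prod_ne_zero_iff.2 f1) (mul_ne_zero
          (Finset.prod_ne_zero_iff.2 f2) (Finset.prod_ne_zero_iff.2 f3)))
          (Finset.prod_ne_zero_iff.2 f4),
        Real.log_mul (Finset.prod_ne_zero_iff.2 f1) (mul_ne_zero
          (Finset.prod_ne_zero_iff.2 f2) (Finset.prod_ne_zero_iff.2 f3)),
        Real.log_mul (Finset.prod_ne_zero_iff.2 f2) (Finset.prod_ne_zero_iff.2 f3),
        Real.log_prod f1, Real.log_prod f2, Real.log_prod f3, Real.log_prod f4,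
        Real.log_prod fun i _ => (hA _ _).ne', Real.log_prod fun i _ => (hB _).ne']
      simp only [Finset.sum_sub_distrib]
      simp only [hYp, hYm]
      ring
    rw [Finset.sum_congr rfl fun s hs => by rw [hlog s hs]]
    simp only [mul_add, Finset.sum_add_distrib]
    congr 1
    · congr 1
      · exact sum_meanCount_mul S Q c Yp univ hTp
          (fun j p => Real.log (A j p) - Real.log (ν j p / #{i | c i = j}))
      · exact sum_meanCount_mul S Q c Ym (range K) hTm
          (fun j m => Real.log (B m) - Real.log (u j m / #{i | c i = j}) - Real.log (m ! : ℝ))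
    · rw [← Finset.sum_mul, hQ1, one_mul]

end FiniteSystem

/-! ### Two-sided bounds of the finite partition function -/

section FiniteSystemBounds

open Finset

variable {kmax : ℕ} {U J : Type*} [Fintype U] [DecidableEq U] [Fintype J] [DecidableEq J]

variable (c : U → J) (A : J → RoutePath kmax J → ℝ) (B : ℕ → ℝ)

/-- A load is at most kmax times the number of users, so there are only polynomially many vectors h;
keeping the one with the largest contribution costs the logarithm of their number. -/
theorem exists_log_partition_le (hk : 0 < kmax) (hA : ∀ j p, 0 < A j p) (hB : ∀ m, 0 < B m) :
    ∃ (ν : J → RoutePath kmax J → ℝ) (u : J → ℕ → ℝ) (h : J → ℕ),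
      (∀ j p, 0 ≤ ν j p) ∧ (∀ j m, 0 ≤ u j m) ∧
      (∀ j, ∑ p, ν j p = #{i | c i = j}) ∧
      (∀ j, ∑ m ∈ range (kmax * Fintype.card U + 1), u j m = #{i | c i = j}) ∧
      (∀ j m, kmax * Fintype.card U + 1 ≤ m → u j m = 0) ∧
      (∀ j, ∑ m ∈ range (kmax * Fintype.card U + 1), u j m * m = h j) ∧
      (∀ j, ∑ j', ∑ p, ν j' p * (p.count j : ℝ) = h j) ∧
      Real.log (∑ s : U → RoutePath kmax U, configWeight c A B s) ≤
        Fintype.card J * Real.log (kmax * Fintype.card U + 1) +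
        ((∑ j, ∑ p, ν j p * (Real.log (A j p) - Real.log (ν j p / #{i | c i = j}))) +
        (∑ j, ∑ m ∈ range (kmax * Fintype.card U + 1),
          u j m * (Real.log (B m) - Real.log (u j m / #{i | c i = j}) - Real.log (m ! : ℝ))) +
        ∑ j, Real.log ((h j)! : ℝ)) := by
  set K := kmax * Fintype.card U + 1 with hK
  have hpos : ∀ s : U → RoutePath kmax U, 0 < configWeight c A B s := fun s =>
    mul_pos (Finset.prod_pos fun i _ => hA _ _) (Finset.prod_pos fun i _ => hB _)
  let H : Finset (J → ℕ) := Fintype.piFinset fun _ => range K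
  have hH : ∀ s ∈ (univ : Finset (U → RoutePath kmax U)),
      load (fun i => (s i).map c) ∈ H := fun s _ =>
    Fintype.mem_piFinset.2 fun j => Finset.mem_range.2 (Nat.lt_succ_of_le (load_le _ j))
  have s₀ : U → RoutePath kmax U := fun _ => ⟨⟨0, hk⟩, Fin.elim0⟩
  obtain ⟨h, hhH, hmax⟩ := Finset.exists_max_image H
    (fun h => ∑ s : U → RoutePath kmax U with load (fun i => (s i).map c) = h,
      configWeight c A B s) ⟨_, hH s₀ (mem_univ _)⟩
  have hsum : ∑ s : U → RoutePath kmax U, configWeight c A B s ≤ (K : ℝ) ^ Fintype.card J *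
      ∑ s : U → RoutePath kmax U with load (fun i => (s i).map c) = h, configWeight c A B s := by
    rw [← Finset.sum_fiberwise_of_maps_to hH]
    refine (Finset.sum_le_sum fun h' hh' => hmax h' hh').trans (le_of_eq ?_)
    rw [Finset.sum_const, nsmul_eq_mul, Fintype.card_piFinset]
    simp
  have hZ : 0 < ∑ s : U → RoutePath kmax U, configWeight c A B s :=
    Finset.sum_pos (fun s _ => hpos s) ⟨s₀, mem_univ _⟩
  have hKpos : (0 : ℝ) < (K : ℝ) ^ Fintype.card J := by rw [hK]; positivity
  have hZh : 0 < ∑ s : U → RoutePath kmax U with load (fun i => (s i).map c) = h,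
      configWeight c A B s := pos_of_mul_pos_right (hZ.trans_le hsum) hKpos.le
  have hne : ({s : U → RoutePath kmax U | load (fun i => (s i).map c) = h} :
      Finset _).Nonempty := by
    by_contra h0
    rw [Finset.not_nonempty_iff_eq_empty] at h0
    rw [h0, Finset.sum_empty] at hZh
    exact lt_irrefl _ hZh
  obtain ⟨ν, u, h1, h2, h3, h4, h5, h6, h7, h8⟩ :=
    exists_log_sum_configWeight_le c A B hA hB h hne
  refine ⟨ν, u, h, h1, h2, h3, h4, h5, h6, h7, ?_⟩
  have h9 := Real.log_le_log hZ hsum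
  rw [Real.log_mul hKpos.ne' hZh.ne', Real.log_pow] at h9
  have : (K : ℝ) = kmax * Fintype.card U + 1 := by rw [hK]; push_cast; ring
  rw [this] at h9
  linarith

theorem prod_comp_of_card_fiber {ι τ : Type*} [Fintype ι] [Fintype τ] [DecidableEq τ]
    (g : ι → τ) (r : τ → ℕ) (hg : ∀ y, #{i | g i = y} = r y) (f : τ → ℝ) :
    ∏ i, f (g i) = ∏ y, f y ^ r y := by
  rw [Finset.prod_comp f g]
  simp only [← hg]
  refine Finset.prod_subset (Finset.subset_univ _) fun y _ hy => ?_
  rw [Finset.card_eq_zero.2, pow_zero]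
  refine Finset.filter_false_of_mem fun i _ hi => hy ?_
  rw [← hi]; exact Finset.mem_image_of_mem g (mem_univ i)

theorem sum_comp_of_card_fiber {ι τ : Type*} [Fintype ι] [Fintype τ] [DecidableEq τ]
    (g : ι → τ) (r : τ → ℕ) (hg : ∀ y, #{i | g i = y} = r y) (f : τ → ℕ) :
    ∑ i, f (g i) = ∑ y, r y * f y := by
  rw [← Finset.sum_fiberwise (g := g)]
  refine Finset.sum_congr rfl fun y _ => ?_
  rw [← hg y, ← smul_eq_mul, ← Finset.sum_const]
  exact Finset.sum_congr rfl fun i hi => by rw [(Finset.mem_filter.1 hi).2]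

/-- The lower bound of the partition function by the contribution of a given type. -/
theorem le_log_partition {K : ℕ} (hA : ∀ j p, 0 < A j p) (hB : ∀ m, 0 < B m)
    (r : J → RoutePath kmax J → ℕ) (u : J → Fin K → ℕ)
    (hr : ∀ j, ∑ p, r j p = #{i | c i = j}) (hu : ∀ j, ∑ m, u j m = #{i | c i = j})
    (h : J → ℕ) (hrh : ∀ j, ∑ j', ∑ p, r j' p * p.count j = h j)
    (huh : ∀ j, ∑ m, u j m * (m : ℕ) = h j) :
    (∑ j, ∑ p, (r j p * Real.log (A j p) - Real.log ((r j p)! : ℝ))) +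
      (∑ j, ∑ m, (u j m * (Real.log (B m) - Real.log ((m : ℕ)! : ℝ)) -
        Real.log ((u j m)! : ℝ))) +
      ∑ j, (2 * Real.log ((#{i | c i = j})! : ℝ) + Real.log ((h j)! : ℝ)) ≤
    Real.log (∑ s : U → RoutePath kmax U, configWeight c A B s) := by
  -- `TP` and `TM` are the assignments of cell sequences and of loads with the prescribed counts.
  -- Each has multinomial cardinality, which is why `log (n_j !)` enters twice.
  set TP : Finset (U → J × RoutePath kmax J) :=
    {g | (∀ i, (g i).1 = c i) ∧ ∀ y, #{i | g i = y} = r y.1 y.2} with hTP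
  set TM : Finset (U → J × Fin K) :=
    {g | (∀ i, (g i).1 = c i) ∧ ∀ y, #{i | g i = y} = u y.1 y.2} with hTM
  have cP : #TP * ∏ y : J × RoutePath kmax J, (r y.1 y.2)! = ∏ j, (#{i | c i = j})! := by
    refine card_fiber_mul_prod_factorial c (Prod.fst : J × RoutePath kmax J → J)
      (fun y => r y.1 y.2) fun j => ?_
    rw [← hr j]
    symm
    refine Finset.sum_bij (fun p _ => (j, p)) (by simp) (by simp) ?_ (by simp)
    rintro ⟨j', p⟩ hj
    simp only [mem_filter, mem_univ, true_and] at hj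
    exact ⟨p, mem_univ _, by rw [hj]⟩
  have cM : #TM * ∏ y : J × Fin K, (u y.1 y.2)! = ∏ j, (#{i | c i = j})! := by
    refine card_fiber_mul_prod_factorial c (Prod.fst : J × Fin K → J)
      (fun y => u y.1 y.2) fun j => ?_
    rw [← hu j]
    symm
    refine Finset.sum_bij (fun p _ => (j, p)) (by simp) (by simp) ?_ (by simp)
    rintro ⟨j', p⟩ hj
    simp only [mem_filter, mem_univ, true_and] at hj
    exact ⟨p, mem_univ _, by rw [hj]⟩
  set F : (U → J × RoutePath kmax J) × (U → J × Fin K) → Finset (U → RoutePath kmax U) :=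
    fun x => {s | (∀ i, (s i).map c = (x.1 i).2) ∧ ∀ a, load s a = ((x.2 a).2 : ℕ)} with hF
  set WP : ℝ := ∏ y : J × RoutePath kmax J, A y.1 y.2 ^ r y.1 y.2 with hWP
  set WM : ℝ := ∏ y : J × Fin K, B y.2 ^ u y.1 y.2 with hWM
  set V : ℝ := ∏ y : J × Fin K, ((y.2 : ℕ)! : ℝ) ^ u y.1 y.2 with hV
  have hVpos : 0 < V := Finset.prod_pos fun y _ =>
    pow_pos (Nat.cast_pos.2 (Nat.factorial_pos _)) _
  have hWPpos : 0 < WP := Finset.prod_pos fun y _ => pow_pos (hA _ _) _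
  have hWMpos : 0 < WM := Finset.prod_pos fun y _ => pow_pos (hB _) _
  have hpos : ∀ s : U → RoutePath kmax U, 0 < configWeight c A B s := fun s =>
    mul_pos (Finset.prod_pos fun i _ => hA _ _) (Finset.prod_pos fun i _ => hB _)
  -- All pairs of assignments contribute equally: by `hrh` and `huh` the loads in each cell add up
  -- to the hops into it, so the number of configurations is given exactly, and the weight depends
  -- on the type only.
  have hFw : ∀ x ∈ TP ×ˢ TM, ∑ s ∈ F x, configWeight c A B s =
      (∏ j, ((h j)! : ℝ)) / V * (WP * WM) := by
    rintro ⟨gP, gM⟩ hx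
    rw [Finset.mem_product] at hx
    simp only [hTP, hTM, mem_filter, mem_univ, true_and] at hx
    obtain ⟨⟨hP1, hP2⟩, hM1, hM2⟩ := hx
    have hw : ∀ s ∈ F (gP, gM), configWeight c A B s = WP * WM := by
      intro s hs
      simp only [hF, mem_filter, mem_univ, true_and] at hs
      rw [configWeight, hWP, hWM, ← prod_comp_of_card_fiber gP (fun y => r y.1 y.2) hP2
        (fun y => A y.1 y.2), ← prod_comp_of_card_fiber gM (fun y => u y.1 y.2) hM2
        (fun y => B y.2)]
      congr 1
      · exact Finset.prod_congr rfl fun i _ => by rw [hs.1 i, hP1 i]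
      · exact Finset.prod_congr rfl fun i _ => by rw [hs.2 i]
    rw [Finset.sum_congr rfl hw, Finset.sum_const, nsmul_eq_mul]
    congr 1
    have hl : ∀ j, load (fun i => (gP i).2) j = h j := by
      intro j
      rw [← hrh j, load, sum_comp_of_card_fiber gP (fun y => r y.1 y.2) hP2
        (fun y => y.2.count j), ← Finset.univ_product_univ, Finset.sum_product]
    have hc := card_configurations_mul_eq c (fun i => (gP i).2) (fun i => ((gM i).2 : ℕ))
      (fun j => by
        rw [hl, ← huh j, Finset.sum_filter]
        have e1 := sum_comp_of_card_fiber gM (fun y => u y.1 y.2) hM2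
          (fun y => if y.1 = j then (y.2 : ℕ) else 0)
        simp only [hM1] at e1
        rw [e1, ← Finset.univ_product_univ, Finset.sum_product_right]
        simp)
    simp only [hl] at hc
    rw [eq_div_iff hVpos.ne', hV, ← prod_comp_of_card_fiber gM (fun y => u y.1 y.2) hM2
        (fun y => ((y.2 : ℕ)! : ℝ))]
    exact_mod_cast hc
  -- A configuration determines its cell sequences and its loads.
  have hdisj : Set.PairwiseDisjoint (↑(TP ×ˢ TM)) F := by
    rintro ⟨gP, gM⟩ hx ⟨gP', gM'⟩ hx' hne
    rw [Finset.mem_coe, Finset.mem_product] at hx hx'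
    simp only [hTP, hTM, mem_filter, mem_univ, true_and] at hx hx'
    rw [Function.onFun, Finset.disjoint_left]
    intro s hs hs'
    simp only [hF, mem_filter, mem_univ, true_and] at hs hs'
    refine hne (Prod.ext (funext fun i => Prod.ext ?_ ?_) (funext fun i => Prod.ext ?_ ?_))
    · rw [hx.1.1 i, hx'.1.1 i]
    · rw [← hs.1 i, ← hs'.1 i]
    · rw [hx.2.1 i, hx'.2.1 i]
    · exact Fin.ext (by rw [← hs.2 i, ← hs'.2 i])
  have hle : (#TP : ℝ) * #TM * ((∏ j, ((h j)! : ℝ)) / V * (WP * WM)) ≤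
      ∑ s : U → RoutePath kmax U, configWeight c A B s := by
    refine le_trans (le_of_eq ?_) (Finset.sum_le_sum_of_subset_of_nonneg
      (Finset.subset_univ ((TP ×ˢ TM).biUnion F)) fun s _ _ => (hpos s).le)
    rw [Finset.sum_biUnion hdisj, Finset.sum_congr rfl hFw, Finset.sum_const, nsmul_eq_mul,
      Finset.card_product]
    push_cast
    ring
  have fpos : ∀ k : ℕ, (0 : ℝ) < (k ! : ℝ) := fun k => Nat.cast_pos.2 (Nat.factorial_pos _)
  have hnf : (0 : ℝ) < ∏ j, ((#{i | c i = j})! : ℝ) := Finset.prod_pos fun j _ => fpos _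
  have hhf : (0 : ℝ) < ∏ j, ((h j)! : ℝ) := Finset.prod_pos fun j _ => fpos _
  have hrf : (0 : ℝ) < ∏ y : J × RoutePath kmax J, ((r y.1 y.2)! : ℝ) :=
    Finset.prod_pos fun j _ => fpos _
  have huf : (0 : ℝ) < ∏ y : J × Fin K, ((u y.1 y.2)! : ℝ) :=
    Finset.prod_pos fun j _ => fpos _
  have cP' : (#TP : ℝ) * ∏ y : J × RoutePath kmax J, ((r y.1 y.2)! : ℝ) =
      ∏ j, ((#{i | c i = j})! : ℝ) := by exact_mod_cast cP
  have cM' : (#TM : ℝ) * ∏ y : J × Fin K, ((u y.1 y.2)! : ℝ) =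
      ∏ j, ((#{i | c i = j})! : ℝ) := by exact_mod_cast cM
  have hTPpos : (0 : ℝ) < #TP := pos_of_mul_pos_left (by rw [cP']; exact hnf) hrf.le
  have hTMpos : (0 : ℝ) < #TM := pos_of_mul_pos_left (by rw [cM']; exact hnf) huf.le
  refine le_trans (le_of_eq ?_) (Real.log_le_log (by positivity) hle)
  have l1 := congrArg Real.log cP'
  have l2 := congrArg Real.log cM'
  rw [Real.log_mul hTPpos.ne' hrf.ne', Real.log_prod fun _ _ => (fpos _).ne',
    Real.log_prod fun _ _ => (fpos _).ne', ← Finset.univ_product_univ, Finset.sum_product] at l1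
  rw [Real.log_mul hTMpos.ne' huf.ne', Real.log_prod fun _ _ => (fpos _).ne',
    Real.log_prod fun _ _ => (fpos _).ne', ← Finset.univ_product_univ, Finset.sum_product] at l2
  rw [Real.log_mul (by positivity) (by positivity), Real.log_mul hTPpos.ne' hTMpos.ne',
    Real.log_mul (by positivity) (by positivity), Real.log_div hhf.ne' hVpos.ne',
    Real.log_mul hWPpos.ne' hWMpos.ne', Real.log_prod fun _ _ => (fpos _).ne', hV, hWP, hWM,
    Real.log_prod fun _ _ => (pow_pos (fpos _) _).ne',
    Real.log_prod fun _ _ => (pow_pos (hA _ _) _).ne',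
    Real.log_prod fun _ _ => (pow_pos (hB _) _).ne']
  simp only [Real.log_pow, ← Finset.univ_product_univ, Finset.sum_product]
  simp only [Finset.sum_add_distrib, Finset.sum_sub_distrib, mul_sub, ← Finset.mul_sum] at *
  linarith

end FiniteSystemBounds

/-! ### Stirling bounds with sublinear error -/

section Stirling

theorem mul_log_sub_le_log_factorial (k : ℕ) :
    (k : ℝ) * Real.log k - k ≤ Real.log (k ! : ℝ) := by
  rcases Nat.eq_zero_or_pos k with rfl | hk
  · simp
  · have hk' : (0 : ℝ) < k := Nat.cast_pos.2 hk
    have hf : (0 : ℝ) < (k ! : ℝ) := Nat.cast_pos.2 (Nat.factorial_pos _)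
    have h := Real.log_le_log (by positivity) (Real.pow_div_factorial_le_exp _ hk'.le k)
    rw [Real.log_exp, Real.log_div (by positivity) hf.ne', Real.log_pow] at h
    linarith

/-- An error of logarithmic order is negligible after division by t; the factor 2 leaves enough room
for an elementary induction. -/
theorem log_factorial_le (k : ℕ) :
    Real.log (k ! : ℝ) ≤ (k : ℝ) * Real.log k - k + 1 + 2 * Real.log (k + 1) := by
  induction k with
  | zero => simp
  | succ k ih =>
    have hf : (0 : ℝ) < (k ! : ℝ) := Nat.cast_pos.2 (Nat.factorial_pos _)
    have h1 : Real.log ((k + 1)! : ℝ) = Real.log (k + 1) + Real.log (k ! : ℝ) := by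
      rw [Nat.factorial_succ]
      push_cast
      rw [Real.log_mul (by positivity) hf.ne']
    have h2 : (k : ℝ) / (k + 1) ≤ k * (Real.log (k + 1) - Real.log k) := by
      rcases Nat.eq_zero_or_pos k with rfl | hk
      · simp
      · have hk' : (0 : ℝ) < k := Nat.cast_pos.2 hk
        have h3 := Real.log_le_sub_one_of_pos (x := (k : ℝ) / (k + 1)) (by positivity)
        rw [Real.log_div (by positivity) (by positivity)] at h3
        have h4 : (1 : ℝ) / (k + 1) ≤ Real.log (k + 1) - Real.log k := by
          have : (k : ℝ) / (k + 1) - 1 = -(1 / (k + 1)) := by field_simp; ring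
          linarith
        have := mul_le_mul_of_nonneg_left h4 hk'.le
        rwa [mul_one_div] at this
    have h5 : (1 : ℝ) / (k + 2) ≤ Real.log (k + 2) - Real.log (k + 1) := by
      have h3 := Real.log_le_sub_one_of_pos (x := ((k : ℝ) + 1) / (k + 2)) (by positivity)
      rw [Real.log_div (by positivity) (by positivity)] at h3
      have : ((k : ℝ) + 1) / (k + 2) - 1 = -(1 / (k + 2)) := by field_simp; ring
      linarith
    have h6 : 1 - 2 * ((1 : ℝ) / (k + 2)) ≤ (k : ℝ) / (k + 1) := by
      rw [← sub_nonneg]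
      have : (k : ℝ) / (k + 1) - (1 - 2 * ((1 : ℝ) / (k + 2))) = k / ((k + 1) * (k + 2)) := by
        field_simp; ring
      rw [this]; positivity
    rw [h1]
    push_cast
    have : (k : ℝ) + 1 + 1 = k + 2 := by ring
    rw [this]
    nlinarith

theorem mul_mul_log_mul {t : ℝ} (ht : 0 < t) (x : ℝ) :
    t * x * Real.log (t * x) = t * (x * Real.log x) + t * x * Real.log t := by
  rcases eq_or_ne x 0 with rfl | hx
  · simp
  · rw [Real.log_mul ht.ne' hx]; ring

variable {ι : Type*} {l : Filter ι} {t : ι → ℝ}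

/-- For t ≥ 1, log(k + 1) ≤ log t + log(k/t + 1), where the first term is o(t) and the second one is
bounded. -/
theorem tendsto_log_add_one_div (ht : Tendsto t l atTop) {k : ι → ℝ} {x : ℝ}
    (hk0 : ∀ᶠ i in l, 0 ≤ k i) (hk : Tendsto (fun i => k i / t i) l (𝓝 x)) :
    Tendsto (fun i => Real.log (k i + 1) / t i) l (𝓝 0) := by
  rcases l.eq_or_neBot with rfl | hl
  · exact tendsto_bot
  have hx : 0 ≤ x := ge_of_tendsto hk (by
    filter_upwards [hk0, ht.eventually_ge_atTop 0] with i h1 h2 using div_nonneg h1 h2)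
  have h1 : Tendsto (fun i => Real.log (t i) / t i) l (𝓝 0) :=
    (Real.isLittleO_log_id_atTop).tendsto_div_nhds_zero.comp ht
  have h2 : Tendsto (fun i => Real.log (k i / t i + 1) / t i) l (𝓝 0) :=
    ((hk.add_const 1).log (by positivity)).div_atTop ht
  have h3 := h1.add h2
  rw [add_zero] at h3
  refine tendsto_of_tendsto_of_tendsto_of_le_of_le' tendsto_const_nhds h3 ?_ ?_
  · filter_upwards [hk0, ht.eventually_ge_atTop 0] with i h1 h2
    exact div_nonneg (Real.log_nonneg (by linarith)) h2
  · filter_upwards [hk0, ht.eventually_ge_atTop 1] with i h1 h2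
    have h4 : 0 < t i := by linarith
    rw [← add_div, ← Real.log_mul h4.ne' (by positivity)]
    refine div_le_div_of_nonneg_right (Real.log_le_log (by linarith) ?_) h4.le
    rw [mul_add, mul_div_cancel₀ _ h4.ne']
    linarith

/-- The compensation by k log t makes the limit finite. These compensations cancel between the
factorials and the hop weights once all the constraints are used. -/
theorem tendsto_log_factorial_div (ht : Tendsto t l atTop) {k : ι → ℕ} {x : ℝ}
    (hk : Tendsto (fun i => (k i : ℝ) / t i) l (𝓝 x)) :
    Tendsto (fun i => (Real.log ((k i)! : ℝ) - k i * Real.log (t i)) / t i) l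
      (𝓝 (x * Real.log x - x)) := by
  have h1 : Tendsto (fun i => (k i : ℝ) / t i * Real.log ((k i : ℝ) / t i) - (k i : ℝ) / t i) l
      (𝓝 (x * Real.log x - x)) :=
    ((Real.continuous_mul_log.tendsto x).comp hk).sub hk
  have h2 := tendsto_log_add_one_div ht (.of_forall fun i => (Nat.cast_nonneg (k i))) hk
  have h3 : Tendsto (fun i => 1 / t i) l (𝓝 0) := tendsto_const_nhds.div_atTop ht
  have h4 := h1.add (h3.add (h2.const_mul 2))
  simp only [mul_zero, add_zero] at h4
  refine tendsto_of_tendsto_of_tendsto_of_le_of_le' h1 h4 ?_ ?_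
  all_goals
    filter_upwards [ht.eventually_gt_atTop 0] with i hi
    have e := mul_mul_log_mul hi ((k i : ℝ) / t i)
    rw [mul_div_cancel₀ _ hi.ne'] at e
  · rw [le_div_iff₀ hi]
    have := mul_log_sub_le_log_factorial (k i)
    have e2 : (k i : ℝ) / t i * t i = k i := div_mul_cancel₀ _ hi.ne'
    nlinarith
  · rw [div_le_iff₀ hi]
    have := log_factorial_le (k i)
    have e2 : (k i : ℝ) / t i * t i = k i := div_mul_cancel₀ _ hi.ne'
    have e3 : (1 / t i + 2 * (Real.log (k i + 1) / t i)) * t i = 1 + 2 * Real.log (k i + 1) := by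
      field_simp
    nlinarith

end Stirling

/-! ### The discretized energy -/

section DiscreteEnergy

/-- The weights of the Poisson distribution. -/
def poissonTerm (θ : ℝ) (m : ℕ) : ℝ := Real.exp (-θ) * θ ^ m / (m ! : ℝ)

theorem poissonTerm_pos {θ : ℝ} (hθ : 0 < θ) (m : ℕ) : 0 < poissonTerm θ m := by
  have : (0 : ℝ) < (m ! : ℝ) := Nat.cast_pos.2 (Nat.factorial_pos _)
  unfold poissonTerm
  positivity

theorem hasSum_poissonTerm (θ : ℝ) : HasSum (poissonTerm θ) 1 := by
  have h := (NormedSpace.expSeries_div_hasSum_exp (𝔸 := ℝ) θ).mul_left (Real.exp (-θ))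
  rw [← Real.exp_eq_exp_ℝ, ← Real.exp_add, neg_add_cancel, Real.exp_zero] at h
  simp only [← mul_div_assoc] at h
  exact h

theorem sum_poissonTerm_le {θ : ℝ} (hθ : 0 < θ) (s : Finset ℕ) : ∑ m ∈ s, poissonTerm θ m ≤ 1 :=
  sum_le_hasSum s (fun m _ => (poissonTerm_pos hθ m).le) (hasSum_poissonTerm θ)

theorem log_poissonTerm {θ : ℝ} (hθ : 0 < θ) (m : ℕ) :
    Real.log (poissonTerm θ m) = -θ + m * Real.log θ - Real.log (m ! : ℝ) := by
  have : (0 : ℝ) < (m ! : ℝ) := Nat.cast_pos.2 (Nat.factorial_pos _)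
  unfold poissonTerm
  rw [Real.log_div (by positivity) this.ne', Real.log_mul (by positivity) (by positivity),
    Real.log_exp, Real.log_pow]

/-- The cost of a density `x` of users with `m` incoming hops. -/
def typeCost (θ C : ℝ) (ψ : ℕ → ℝ) (m : ℕ) (x : ℝ) : ℝ :=
  x * Real.log x - x * Real.log (poissonTerm θ m) - x + poissonTerm θ m + (ψ m - C) * x

variable {θ C : ℝ} {ψ : ℕ → ℝ}

theorem continuous_typeCost (m : ℕ) : Continuous (typeCost θ C ψ m) := by
  unfold typeCost
  have := Real.continuous_mul_log
  fun_prop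

/-- Empty classes are not free: over all m the Poisson weights contribute 1 per cell, which the term
`- Fintype.card J` in `discreteEnergy` removes. -/
theorem typeCost_zero (m : ℕ) : typeCost θ C ψ m 0 = poissonTerm θ m := by
  simp [typeCost]

theorem mul_log_sub_mul_log_nonneg {x c : ℝ} (hx : 0 ≤ x) (hc : 0 < c) :
    0 ≤ x * Real.log x - x * Real.log c - x + c := by
  have h := mul_nonneg hc.le (InformationTheory.klFun_nonneg (div_nonneg hx hc.le))
  rw [InformationTheory.klFun_apply] at h
  have e : c * (x / c * Real.log (x / c) + 1 - x / c) =
      x * Real.log x - x * Real.log c - x + c := by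
    rcases eq_or_ne x 0 with rfl | hx0
    · simp
    · rw [Real.log_div hx0 hc.ne']
      field_simp
      ring
  rwa [e] at h

/-- The entropic part is nonnegative. Together with ψ m / m → ∞, a bound of the total cost thus
controls the tails of ∑ m u_m. -/
theorem mul_le_typeCost (hθ : 0 < θ) (m : ℕ) {x : ℝ} (hx : 0 ≤ x) :
    (ψ m - C) * x ≤ typeCost θ C ψ m x := by
  have := mul_log_sub_mul_log_nonneg hx (poissonTerm_pos hθ m)
  unfold typeCost
  linarith

theorem typeCost_nonneg (hθ : 0 < θ) (hC : ∀ m, C ≤ ψ m) (m : ℕ) {x : ℝ} (hx : 0 ≤ x) :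
    0 ≤ typeCost θ C ψ m x :=
  (mul_nonneg (sub_nonneg.2 (hC m)) hx).trans (mul_le_typeCost hθ m hx)

/-- Isolates the terms proportional to x and to x m: their sums over m are prescribed by the
constraints, so θ and C do not affect the variational problem. -/
theorem typeCost_eq (hθ : 0 < θ) (m : ℕ) (x : ℝ) :
    typeCost θ C ψ m x = x * Real.log x + x * Real.log (m ! : ℝ) + ψ m * x + poissonTerm θ m -
      (1 - θ + C) * x - Real.log θ * (x * m) := by
  rw [typeCost, log_poissonTerm hθ]; ring

variable {kmax : ℕ} {J : Type*} [Fintype J] [DecidableEq J]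

/-- The mass of the hops into cell `j`. -/
def hopCount (ν : J → RoutePath kmax J → ℝ) (j : J) : ℝ :=
  ∑ j', ∑ p, ν j' p * (p.count j : ℝ)

/-- The constraints of the variational problem, for masses on a finite set of cells. -/
structure IsDiscreteSetting (L : J → ℝ) (ν : J → RoutePath kmax J → ℝ) (u : J → ℕ → ℝ) :
    Prop where
  ν_nonneg : ∀ j p, 0 ≤ ν j p
  u_nonneg : ∀ j m, 0 ≤ u j m
  start_eq : ∀ j, ∑ p, ν j p = L j
  rel_eq : ∀ j, HasSum (u j) (L j)
  hops_eq : ∀ j, HasSum (fun m => u j m * m) (hopCount ν j)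

/-- The part of the discretized energy that depends on finitely many masses. -/
def routeEnergy (Φ : J → RoutePath kmax J → ℝ) (L : J → ℝ) (ν : J → RoutePath kmax J → ℝ) : ℝ :=
  (∑ j, ∑ p, (ν j p * Real.log (ν j p) + ν j p * Φ j p)) - 2 * ∑ j, L j * Real.log (L j) -
    ∑ j, hopCount ν j * Real.log (hopCount ν j)

/-- The discretized energy. -/
def discreteEnergy (θ C : ℝ) (Φ : J → RoutePath kmax J → ℝ) (ψ : ℕ → ℝ) (L : J → ℝ)
    (ν : J → RoutePath kmax J → ℝ) (u : J → ℕ → ℝ) : ℝ :=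
  routeEnergy Φ L ν + (1 - θ + C) * ∑ j, L j - Fintype.card J +
    ∑ j, ∑' m, typeCost θ C ψ m (u j m)

/-- The weight of a trajectory in a system of `n` users. -/
def hopWeight (n : ℕ) (Φ : J → RoutePath kmax J → ℝ) (j : J) (p : RoutePath kmax J) : ℝ :=
  (1 / (n : ℝ)) ^ (p.1 : ℕ) * Real.exp (-Φ j p)

theorem hopWeight_pos {n : ℕ} (hn : 0 < n) (Φ : J → RoutePath kmax J → ℝ) (j : J)
    (p : RoutePath kmax J) : 0 < hopWeight n Φ j p := by
  unfold hopWeight; positivity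

theorem log_hopWeight {n : ℕ} (hn : 0 < n) (Φ : J → RoutePath kmax J → ℝ) (j : J)
    (p : RoutePath kmax J) :
    Real.log (hopWeight n Φ j p) = -(p.1 : ℕ) * Real.log n - Φ j p := by
  have hn' : (0 : ℝ) < n := Nat.cast_pos.2 hn
  unfold hopWeight
  rw [Real.log_mul (by positivity) (Real.exp_pos _).ne', Real.log_exp, Real.log_pow,
    Real.log_div one_ne_zero hn'.ne', Real.log_one]
  ring

/-- Every relay lies in exactly one cell. This expresses the weight `n ^ (-(number of relays))`
through the hop masses, where it meets the factorials of the h_j. -/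
theorem sum_hopCount (ν : J → RoutePath kmax J → ℝ) :
    ∑ j, hopCount ν j = ∑ j, ∑ p, ν j p * (p.1 : ℕ) := by
  unfold hopCount
  rw [Finset.sum_comm]
  refine Finset.sum_congr rfl fun j _ => ?_
  rw [Finset.sum_comm]
  refine Finset.sum_congr rfl fun p _ => ?_
  rw [← Finset.mul_sum, ← Nat.cast_sum, p.sum_count]

end DiscreteEnergy

/-! ### Rescaled upper bound -/

section UpperBound

variable {kmax : ℕ} {U J : Type*} [Fintype U] [DecidableEq U] [Fintype J] [DecidableEq J]
variable {θ C : ℝ} {ψ : ℕ → ℝ}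

theorem mul_mul_log_div {t x y : ℝ} (ht : 0 < t) (hx : 0 ≤ x) (hxy : x ≤ y) :
    t * x * Real.log (t * x / (t * y)) = t * (x * Real.log x - x * Real.log y) := by
  rcases hx.eq_or_lt with rfl | hx
  · simp
  · rw [mul_div_mul_left _ _ ht.ne', Real.log_div hx.ne' (hx.trans_le hxy).ne']
    ring

/-- The upper bound of the partition function at a positive density, in terms of the masses of a
type. -/
theorem exists_log_partition_div_le (hk : 0 < kmax) (hθ : 0 < θ) (c : U → J)
    (Φ : J → RoutePath kmax J → ℝ) (hU : 0 < Fintype.card U) {t : ℝ} (ht : 0 < t) (L : J → ℝ)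
    (hL : ∀ j, L j = (Finset.card {i | c i = j} : ℝ) / t) :
    ∃ (ν : J → RoutePath kmax J → ℝ) (u : J → ℕ → ℝ),
      (∀ j p, 0 ≤ ν j p) ∧ (∀ j m, 0 ≤ u j m) ∧
      (∀ j, ∑ p, ν j p = L j) ∧
      (∀ j, ∑ m ∈ Finset.range (kmax * Fintype.card U + 1), u j m = L j) ∧
      (∀ j, ∑ m ∈ Finset.range (kmax * Fintype.card U + 1), u j m * m = hopCount ν j) ∧
      Real.log (∑ s, configWeight c (hopWeight (Fintype.card U) Φ) (fun m => Real.exp (-ψ m)) s)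
          / t ≤
        -(routeEnergy Φ L ν + (1 - θ + C) * ∑ j, L j - Fintype.card J +
          (∑ j, ∑ m ∈ Finset.range (kmax * Fintype.card U + 1), typeCost θ C ψ m (u j m)) +
          (∑ j, hopCount ν j) * (1 + Real.log (Fintype.card U / t) + Real.log θ)) +
        (Fintype.card J * (Real.log (kmax * Fintype.card U + 1) / t) +
          ∑ j, (1 / t + 2 * (Real.log (t * hopCount ν j + 1) / t))) := by
  obtain ⟨N, V, h, hN0, hV0, hN, hV, hVK, hVh, hNh, hZ⟩ :=
    exists_log_partition_le c (hopWeight (Fintype.card U) Φ) (fun m => Real.exp (-ψ m)) hk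
      (hopWeight_pos hU Φ) (fun m => Real.exp_pos _)
  set K := kmax * Fintype.card U + 1 with hK
  have hLt : ∀ j, (Finset.card {i | c i = j} : ℝ) = t * L j := fun j => by
    rw [hL, mul_div_cancel₀ _ ht.ne']
  -- Passage from mean counts to masses per unit of t.
  obtain ⟨ν, rfl⟩ : ∃ ν : J → RoutePath kmax J → ℝ, N = fun j p => t * ν j p :=
    ⟨fun j p => N j p / t, by funext j p; rw [mul_div_cancel₀ _ ht.ne']⟩
  obtain ⟨u, rfl⟩ : ∃ u : J → ℕ → ℝ, V = fun j p => t * u j p :=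
    ⟨fun j p => V j p / t, by funext j p; rw [mul_div_cancel₀ _ ht.ne']⟩
  have hν0 : ∀ j p, 0 ≤ ν j p := fun j p => nonneg_of_mul_nonneg_right (hN0 j p) ht
  have hu0 : ∀ j m, 0 ≤ u j m := fun j m => nonneg_of_mul_nonneg_right (hV0 j m) ht
  simp only [hLt] at hN hV hZ
  have hνL : ∀ j, ∑ p, ν j p = L j := fun j => by
    have := hN j; rw [← Finset.mul_sum] at this; exact mul_left_cancel₀ ht.ne' this
  have huL : ∀ j, ∑ m ∈ Finset.range K, u j m = L j := fun j => by
    have := hV j; rw [← Finset.mul_sum] at this; exact mul_left_cancel₀ ht.ne' this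
  have hh : ∀ j, (h j : ℝ) = t * hopCount ν j := fun j => by
    rw [← hNh j, hopCount, Finset.mul_sum]
    simp only [Finset.mul_sum, mul_assoc]
  have huh : ∀ j, ∑ m ∈ Finset.range K, u j m * m = hopCount ν j := fun j => by
    have := hVh j
    rw [hh] at this
    simp only [mul_assoc] at this
    rw [← Finset.mul_sum] at this; exact mul_left_cancel₀ ht.ne' this
  refine ⟨ν, u, hν0, hu0, hνL, huL, huh, ?_⟩
  have hνle : ∀ j p, ν j p ≤ L j := fun j p => by
    rw [← hνL j]; exact Finset.single_le_sum (fun p _ => hν0 j p) (Finset.mem_univ p)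
  have hule : ∀ j, ∀ m ∈ Finset.range K, u j m ≤ L j := fun j m hm => by
    rw [← huL j]; exact Finset.single_le_sum (fun p _ => hu0 j p) hm
  have hn : (0 : ℝ) < Fintype.card U := Nat.cast_pos.2 hU
  have e1 : ∀ j, ∑ p, t * ν j p * (Real.log (hopWeight (Fintype.card U) Φ j p) -
      Real.log (t * ν j p / (t * L j))) =
      t * (-(∑ p, (ν j p * Real.log (ν j p) + ν j p * Φ j p)) + L j * Real.log (L j) -
        (∑ p, ν j p * (p.1 : ℕ)) * Real.log (Fintype.card U)) := by
    intro j
    have : ∀ p, t * ν j p * (Real.log (hopWeight (Fintype.card U) Φ j p) -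
      Real.log (t * ν j p / (t * L j))) =
      t * (-(ν j p * Real.log (ν j p) + ν j p * Φ j p) + ν j p * Real.log (L j) -
        (ν j p * (p.1 : ℕ)) * Real.log (Fintype.card U)) := fun p => by
      rw [mul_sub, mul_mul_log_div ht (hν0 j p) (hνle j p), log_hopWeight hU]
      ring
    rw [Finset.sum_congr rfl fun p _ => this p, ← Finset.mul_sum, Finset.sum_sub_distrib,
      Finset.sum_add_distrib, Finset.sum_neg_distrib, ← Finset.sum_mul, ← Finset.sum_mul, hνL]
  -- Only an inequality, because the Poisson weights with m < K sum to at most 1.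
  have e2 : ∀ j, ∑ m ∈ Finset.range K, t * u j m * (Real.log (Real.exp (-ψ m)) -
      Real.log (t * u j m / (t * L j)) - Real.log (m ! : ℝ)) ≤
      t * (-(∑ m ∈ Finset.range K, typeCost θ C ψ m (u j m)) + 1 + L j * Real.log (L j) -
        (1 - θ + C) * L j - Real.log θ * hopCount ν j) := by
    intro j
    have : ∀ m ∈ Finset.range K, t * u j m * (Real.log (Real.exp (-ψ m)) -
      Real.log (t * u j m / (t * L j)) - Real.log (m ! : ℝ)) =
      t * (-typeCost θ C ψ m (u j m) + poissonTerm θ m + u j m * Real.log (L j) -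
        (1 - θ + C) * u j m - Real.log θ * (u j m * m)) := fun m hm => by
      rw [mul_sub, mul_sub, mul_mul_log_div ht (hu0 j m) (hule j m hm), Real.log_exp,
        typeCost_eq hθ]
      ring
    rw [Finset.sum_congr rfl this, ← Finset.mul_sum, Finset.sum_sub_distrib,
      Finset.sum_sub_distrib, Finset.sum_add_distrib, Finset.sum_add_distrib,
      Finset.sum_neg_distrib, ← Finset.sum_mul, ← Finset.mul_sum, ← Finset.mul_sum, huL, huh]
    refine mul_le_mul_of_nonneg_left ?_ ht.le
    linarith [sum_poissonTerm_le hθ (Finset.range K)]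
  have e3 : ∀ j, Real.log ((h j)! : ℝ) ≤ t * (hopCount ν j * Real.log (hopCount ν j) +
      hopCount ν j * Real.log t - hopCount ν j) +
      (1 + 2 * Real.log (t * hopCount ν j + 1)) := by
    intro j
    have h1 := log_factorial_le (h j)
    rw [hh, mul_mul_log_mul ht] at h1
    linarith
  rw [div_le_iff₀ ht]
  have s1 := Finset.sum_congr rfl fun j (_ : j ∈ Finset.univ) => e1 j
  have s2 := Finset.sum_le_sum fun j (_ : j ∈ Finset.univ) => e2 j
  have s3 := Finset.sum_le_sum fun j (_ : j ∈ Finset.univ) => e3 j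
  rw [s1] at hZ
  refine hZ.trans ((add_le_add_right (add_le_add (add_le_add_right s2 _) s3) _).trans
    (le_of_eq ?_))
  -- The hop masses now collect log t from the factorials, -log n from the weights, and -1 - log θ,
  -- which is the term `1 + log (n / t) + log θ` that vanishes asymptotically.
  have e4 := sum_hopCount ν
  simp only [← Finset.mul_sum, Finset.sum_add_distrib, Finset.sum_sub_distrib,
    Finset.sum_neg_distrib, ← Finset.sum_mul, Finset.sum_const, Finset.card_univ, nsmul_eq_mul,
    routeEnergy]
  rw [← e4, Real.log_div hn.ne' ht.ne', ← Finset.sum_div]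
  field_simp
  ring

end UpperBound

/-! ### Passage to the limit in the upper bound -/

section AsymptoticUpperBound

variable {kmax : ℕ} {J : Type*} [Fintype J] [DecidableEq J]
variable {θ C : ℝ} {ψ : ℕ → ℝ}
variable {ι : Type*} {l : Filter ι}

/-- Compactness along an ultrafilter makes all the infinitely many masses converge at once, in place
of a diagonal subsequence. -/
theorem Ultrafilter.exists_tendsto_of_eventually_mem_Icc (f : Ultrafilter ι) {g : ι → ℝ} {a b : ℝ}
    (h : ∀ᶠ i in f, g i ∈ Set.Icc a b) : ∃ x, Tendsto g f (𝓝 x) := by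
  obtain ⟨x, -, hx⟩ := isCompact_Icc.ultrafilter_le_nhds (f.map g)
    (show ((f.map g : Ultrafilter ℝ) : Filter ℝ) ≤ 𝓟 (Set.Icc a b) from
      le_principal_iff.2 h)
  exact ⟨x, hx⟩

theorem tendsto_card_div {t : ι → ℝ} {n : ι → ℕ} {c : ∀ i, Fin (n i) → J} {L : J → ℝ}
    (hL : ∀ j, Tendsto (fun i => (Finset.card {x | c i x = j} : ℝ) / t i) l (𝓝 (L j))) :
    Tendsto (fun i => (n i : ℝ) / t i) l (𝓝 (∑ j, L j)) := by
  have h := tendsto_finsetSum Finset.univ fun j (_ : j ∈ Finset.univ) => hL j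
  refine h.congr fun i => ?_
  rw [← Finset.sum_div, ← Nat.cast_sum,
    ← Finset.card_eq_sum_card_fiberwise (f := c i) (s := Finset.univ) (by simp)]
  simp

theorem continuous_hopCount (j : J) :
    Continuous fun ν : J → RoutePath kmax J → ℝ => hopCount ν j := by
  unfold hopCount; fun_prop

theorem tendsto_hopCount {ν : ι → J → RoutePath kmax J → ℝ} {ν' : J → RoutePath kmax J → ℝ}
    (h : ∀ j p, Tendsto (fun i => ν i j p) l (𝓝 (ν' j p))) (j : J) :
    Tendsto (fun i => hopCount (ν i) j) l (𝓝 (hopCount ν' j)) :=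
  ((continuous_hopCount j).tendsto ν').comp
    (tendsto_pi_nhds.2 fun j => tendsto_pi_nhds.2 fun p => h j p)

theorem tendsto_routeEnergy (Φ : J → RoutePath kmax J → ℝ)
    {ν : ι → J → RoutePath kmax J → ℝ} {ν' : J → RoutePath kmax J → ℝ}
    (h : ∀ j p, Tendsto (fun i => ν i j p) l (𝓝 (ν' j p))) {L : ι → J → ℝ} {L' : J → ℝ}
    (hL : ∀ j, Tendsto (fun i => L i j) l (𝓝 (L' j))) :
    Tendsto (fun i => routeEnergy Φ (L i) (ν i)) l (𝓝 (routeEnergy Φ L' ν')) := by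
  have hx : ∀ {g : ι → ℝ} {x : ℝ}, Tendsto g l (𝓝 x) →
      Tendsto (fun i => g i * Real.log (g i)) l (𝓝 (x * Real.log x)) := fun hg =>
    (Real.continuous_mul_log.tendsto _).comp hg
  unfold routeEnergy
  refine ((tendsto_finsetSum _ fun j _ => tendsto_finsetSum _ fun p _ =>
    (hx (h j p)).add ((h j p).mul_const _)).sub
    ((tendsto_finsetSum _ fun j _ => hx (hL j)).const_mul 2)).sub
    (tendsto_finsetSum _ fun j _ => hx (tendsto_hopCount h j))

theorem hasSum_of_tail_le {f : ℕ → ℝ} (hf : ∀ m, 0 ≤ f m) {s : ℝ}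
    (h : ∀ ε > 0, ∃ M₀, ∀ M ≥ M₀, |s - ∑ m ∈ Finset.range M, f m| ≤ ε) : HasSum f s := by
  rw [hasSum_iff_tendsto_nat_of_nonneg hf, Metric.tendsto_atTop]
  intro ε hε
  obtain ⟨M₀, hM₀⟩ := h (ε / 2) (by positivity)
  refine ⟨M₀, fun M hM => ?_⟩
  rw [dist_comm, Real.dist_eq]
  linarith [hM₀ M hM]

/-- If every discretized setting has energy at least `b`, the exponential rate of the partition
function is asymptotically at most `-b`. -/
theorem eventually_log_partition_div_le (hk : 0 < kmax) (hθ : 0 < θ) (hC : ∀ m, C ≤ ψ m)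
    (hψ : Tendsto (fun m : ℕ => ψ m / m) atTop atTop) (Φ : J → RoutePath kmax J → ℝ)
    {t : ι → ℝ} (ht : Tendsto t l atTop) {n : ι → ℕ} (c : ∀ i, Fin (n i) → J) {L : J → ℝ}
    (hL : ∀ j, Tendsto (fun i => (Finset.card {x | c i x = j} : ℝ) / t i) l (𝓝 (L j)))
    (hL0 : 0 < ∑ j, L j) (hθL : 1 + Real.log (∑ j, L j) + Real.log θ = 0) {b b' : ℝ}
    (hb : ∀ (ν : J → RoutePath kmax J → ℝ) (u : J → ℕ → ℝ), IsDiscreteSetting L ν u →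
      (∀ j, Summable fun m => typeCost θ C ψ m (u j m)) → b ≤ discreteEnergy θ C Φ ψ L ν u)
    (hbb : b' < b) :
    ∀ᶠ i in l, Real.log (∑ s, configWeight (c i) (hopWeight (n i) Φ)
      (fun m => Real.exp (-ψ m)) s) / t i ≤ -b' := by
  -- If the bound fails frequently, an ultrafilter finer than l concentrates on the failures; the
  -- limits of the mean types along it form a discrete setting of energy at most b' < b.
  by_contra hcon
  rw [not_eventually] at hcon
  have : (l ⊓ 𝓟 {i | ¬ Real.log (∑ s, configWeight (c i) (hopWeight (n i) Φ)
      (fun m => Real.exp (-ψ m)) s) / t i ≤ -b'}).NeBot := frequently_mem_iff_neBot.1 hcon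
  set 𝒰 := Ultrafilter.of (l ⊓ 𝓟 {i | ¬ Real.log (∑ s, configWeight (c i) (hopWeight (n i) Φ)
      (fun m => Real.exp (-ψ m)) s) / t i ≤ -b'}) with h𝒰
  have hle : (𝒰 : Filter ι) ≤ l := (Ultrafilter.of_le _).trans inf_le_left
  have hbad : ∀ᶠ i in (𝒰 : Filter ι), ¬ Real.log (∑ s, configWeight (c i) (hopWeight (n i) Φ)
      (fun m => Real.exp (-ψ m)) s) / t i ≤ -b' :=
    ((Ultrafilter.of_le _).trans inf_le_right) (mem_principal_self _)
  replace ht := ht.mono_left hle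
  replace hL := fun j => (hL j).mono_left hle
  clear hcon
  have hn := tendsto_card_div hL
  have hn0 : ∀ᶠ i in (𝒰 : Filter ι), 0 < n i := by
    filter_upwards [hn.eventually_const_lt hL0, ht.eventually_gt_atTop 0] with i h1 h2
    have : (0 : ℝ) < n i := by rwa [lt_div_iff₀ h2, zero_mul] at h1
    exact_mod_cast this
  have hex : ∀ i, ∃ (ν : J → RoutePath kmax J → ℝ) (u : J → ℕ → ℝ), 0 < n i → 0 < t i →
      (∀ j p, 0 ≤ ν j p) ∧ (∀ j m, 0 ≤ u j m) ∧
      (∀ j, ∑ p, ν j p = (Finset.card {x | c i x = j} : ℝ) / t i) ∧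
      (∀ j, ∑ m ∈ Finset.range (kmax * n i + 1), u j m =
        (Finset.card {x | c i x = j} : ℝ) / t i) ∧
      (∀ j, ∑ m ∈ Finset.range (kmax * n i + 1), u j m * m = hopCount ν j) ∧
      Real.log (∑ s, configWeight (c i) (hopWeight (n i) Φ) (fun m => Real.exp (-ψ m)) s)
          / t i ≤
        -(routeEnergy Φ (fun j => (Finset.card {x | c i x = j} : ℝ) / t i) ν +
          (1 - θ + C) * ∑ j, (Finset.card {x | c i x = j} : ℝ) / t i - Fintype.card J +
          (∑ j, ∑ m ∈ Finset.range (kmax * n i + 1), typeCost θ C ψ m (u j m)) +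
          (∑ j, hopCount ν j) * (1 + Real.log (n i / t i) + Real.log θ)) +
        (Fintype.card J * (Real.log (kmax * n i + 1) / t i) +
          ∑ j, (1 / t i + 2 * (Real.log (t i * hopCount ν j + 1) / t i))) := by
    intro i
    -- Dummy values are used outside this case, which is eventually excluded.
    by_cases h : 0 < n i ∧ 0 < t i
    · obtain ⟨ν, u, h1⟩ := exists_log_partition_div_le (ψ := ψ) (C := C) hk hθ (c i) Φ
        (by simpa using h.1) h.2 (fun j => (Finset.card {x | c i x = j} : ℝ) / t i)
        (fun j => rfl)
      simp only [Fintype.card_fin] at h1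
      exact ⟨ν, u, fun _ _ => h1⟩
    · exact ⟨fun _ _ => 0, fun _ _ => 0, fun h1 h2 => absurd ⟨h1, h2⟩ h⟩
  choose ν u H using hex
  have hev : ∀ᶠ i in (𝒰 : Filter ι), 0 < n i ∧ 0 < t i := hn0.and (ht.eventually_gt_atTop 0)
  have hLb : ∀ᶠ i in (𝒰 : Filter ι), ∀ j,
      (Finset.card {x | c i x = j} : ℝ) / t i ≤ L j + 1 :=
    eventually_all.2 fun j => (hL j).eventually_le_const (by linarith)
  have hνlim : ∀ j p, ∃ x, Tendsto (fun i => ν i j p) 𝒰 (𝓝 x) := fun j p => by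
    refine Ultrafilter.exists_tendsto_of_eventually_mem_Icc 𝒰 (a := 0) (b := L j + 1) ?_
    filter_upwards [hev, hLb] with i h1 h2
    obtain ⟨H1, -, H3, -⟩ := H i h1.1 h1.2
    refine ⟨H1 j p, le_trans ?_ (h2 j)⟩
    rw [← H3 j]; exact Finset.single_le_sum (fun p _ => H1 j p) (Finset.mem_univ p)
  choose ν' hν' using hνlim
  have hKn : Tendsto (fun i => kmax * n i + 1) (𝒰 : Filter ι) atTop := by
    have h1 : Tendsto (fun i => (n i : ℝ)) (𝒰 : Filter ι) atTop := by
      have := ht.atTop_mul_pos hL0 hn |>.congr' (f₂ := fun i => (n i : ℝ))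
        (by filter_upwards [ht.eventually_gt_atTop 0] with i hi
            exact mul_div_cancel₀ _ hi.ne')
      exact this
    rw [tendsto_natCast_atTop_iff] at h1
    refine tendsto_atTop_mono (fun i => ?_) h1
    have := Nat.le_mul_of_pos_left (n i) hk
    omega
  have hulim : ∀ j m, ∃ x, Tendsto (fun i => u i j m) 𝒰 (𝓝 x) := fun j m => by
    refine Ultrafilter.exists_tendsto_of_eventually_mem_Icc 𝒰 (a := 0) (b := L j + 1) ?_
    filter_upwards [hev, hLb, hKn.eventually_gt_atTop m] with i h1 h2 h3
    obtain ⟨-, H2, -, H4, -⟩ := H i h1.1 h1.2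
    refine ⟨H2 j m, le_trans ?_ (h2 j)⟩
    rw [← H4 j]
    exact Finset.single_le_sum (fun p _ => H2 j p) (Finset.mem_range.2 h3)
  choose u' hu' using hulim
  have hhop := tendsto_hopCount hν'
  have hroute := tendsto_routeEnergy Φ hν' hL
  -- The bound is solved for the total cost of the loads: `D i` is the budget left to them on the
  -- failure set, and it converges since it contains finitely many masses only.
  set D : ι → ℝ := fun i => b' -
    (routeEnergy Φ (fun j => (Finset.card {x | c i x = j} : ℝ) / t i) (ν i) +
          (1 - θ + C) * ∑ j, (Finset.card {x | c i x = j} : ℝ) / t i - Fintype.card J +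
          (∑ j, hopCount (ν i) j) * (1 + Real.log (n i / t i) + Real.log θ)) +
        (Fintype.card J * (Real.log (kmax * n i + 1) / t i) +
          ∑ j, (1 / t i + 2 * (Real.log (t i * hopCount (ν i) j + 1) / t i))) with hD
  set D' : ℝ := b' - (routeEnergy Φ L ν' + (1 - θ + C) * ∑ j, L j - Fintype.card J) with hD'
  have hDlim : Tendsto D 𝒰 (𝓝 D') := by
    have l1 : Tendsto (fun i => 1 + Real.log (n i / t i) + Real.log θ) (𝒰 : Filter ι) (𝓝 0) := by
      rw [← hθL]
      exact ((hn.log hL0.ne').const_add 1).add_const _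
    have l2 : Tendsto (fun i => Real.log (kmax * n i + 1) / t i) (𝒰 : Filter ι) (𝓝 0) := by
      refine tendsto_log_add_one_div ht (k := fun i => (kmax : ℝ) * n i)
        (x := kmax * ∑ j, L j) (.of_forall fun i => by positivity) ?_
      simp only [mul_div_assoc]
      exact hn.const_mul _
    have l3 : ∀ j, Tendsto (fun i => Real.log (t i * hopCount (ν i) j + 1) / t i)
        (𝒰 : Filter ι) (𝓝 0) := fun j => by
      refine tendsto_log_add_one_div ht (x := hopCount ν' j) ?_ ?_
      · filter_upwards [hev] with i hi
        obtain ⟨H1, -⟩ := H i hi.1 hi.2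
        exact mul_nonneg hi.2.le (Finset.sum_nonneg fun _ _ => Finset.sum_nonneg fun _ _ =>
          mul_nonneg (H1 _ _) (Nat.cast_nonneg _))
      · refine (hhop j).congr' ?_
        filter_upwards [hev] with i hi
        rw [mul_div_cancel_left₀ _ hi.2.ne']
    have l4 : Tendsto (fun i => 1 / t i) (𝒰 : Filter ι) (𝓝 0) := tendsto_const_nhds.div_atTop ht
    have l5 := ((((hroute.add ((tendsto_finsetSum Finset.univ fun j _ => hL j).const_mul
      (1 - θ + C))).sub_const (Fintype.card J : ℝ)).add
      ((tendsto_finsetSum Finset.univ fun j _ => hhop j).mul l1)).const_sub b').add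
      ((l2.const_mul (Fintype.card J : ℝ)).add (tendsto_finsetSum Finset.univ fun j _ =>
        l4.add ((l3 j).const_mul 2)))
    simp only [mul_zero, add_zero, Finset.sum_const_zero] at l5
    exact l5
  have hcost : ∀ᶠ i in (𝒰 : Filter ι), ∑ j, ∑ m ∈ Finset.range (kmax * n i + 1),
      typeCost θ C ψ m (u i j m) ≤ D i := by
    filter_upwards [hev, hbad] with i h1 h2
    obtain ⟨-, -, -, -, -, H6⟩ := H i h1.1 h1.2
    rw [not_le] at h2
    simp only [hD]
    linarith
  have hu0 : ∀ᶠ i in (𝒰 : Filter ι), ∀ j m, 0 ≤ u i j m := by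
    filter_upwards [hev] with i hi using (H i hi.1 hi.2).2.1
  have hν'0 : ∀ j p, 0 ≤ ν' j p := fun j p => ge_of_tendsto (hν' j p) (by
    filter_upwards [hev] with i hi using (H i hi.1 hi.2).1 j p)
  have hu'0 : ∀ j m, 0 ≤ u' j m := fun j m => ge_of_tendsto (hu' j m) (by
    filter_upwards [hu0] with i hi using hi j m)
  -- Fatou's argument: nonnegative costs are truncated at M, the limit is taken in i, and then M →
  -- ∞.
  have hpart : ∀ M, ∑ j, ∑ m ∈ Finset.range M, typeCost θ C ψ m (u' j m) ≤ D' := by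
    intro M
    have h1 : Tendsto (fun i => ∑ j, ∑ m ∈ Finset.range M, typeCost θ C ψ m (u i j m)) 𝒰
        (𝓝 (∑ j, ∑ m ∈ Finset.range M, typeCost θ C ψ m (u' j m))) :=
      tendsto_finsetSum _ fun j _ => tendsto_finsetSum _ fun m _ =>
        ((continuous_typeCost m).tendsto _).comp (hu' j m)
    refine le_of_tendsto_of_tendsto h1 hDlim ?_
    filter_upwards [hcost, hu0, hKn.eventually_ge_atTop M] with i h2 h3 h4
    refine (Finset.sum_le_sum fun j _ => ?_).trans h2
    exact Finset.sum_le_sum_of_subset_of_nonneg (Finset.range_mono h4) fun m _ _ =>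
      typeCost_nonneg hθ hC m (h3 j m)
  have hpart1 : ∀ j M, ∑ m ∈ Finset.range M, typeCost θ C ψ m (u' j m) ≤ D' := fun j M =>
    le_trans (Finset.single_le_sum (f := fun j => ∑ m ∈ Finset.range M,
      typeCost θ C ψ m (u' j m)) (fun j _ => Finset.sum_nonneg fun m _ =>
      typeCost_nonneg hθ hC m (hu'0 j m)) (Finset.mem_univ j)) (hpart M)
  have hsummable : ∀ j, Summable fun m => typeCost θ C ψ m (u' j m) := fun j =>
    summable_of_sum_range_le (fun m => typeCost_nonneg hθ hC m (hu'0 j m)) (hpart1 j)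
  have htotal : ∑ j, ∑' m, typeCost θ C ψ m (u' j m) ≤ D' := by
    have h1 : Tendsto (fun M => ∑ j, ∑ m ∈ Finset.range M, typeCost θ C ψ m (u' j m)) atTop
        (𝓝 (∑ j, ∑' m, typeCost θ C ψ m (u' j m))) :=
      tendsto_finsetSum _ fun j _ => (hsummable j).hasSum.tendsto_sum_nat
    exact le_of_tendsto' h1 hpart
  -- Uniform integrability of the loads: beyond M₀ the cost dominates R m u_m, and R is chosen so
  -- that the bounded budget leaves at most ε. Only here is the superlinear growth of ψ needed.
  have htail : ∀ ε > 0, ∃ M₀ : ℕ, ∀ M ≥ M₀, ∀ᶠ i in (𝒰 : Filter ι), ∀ j,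
      ∑ m ∈ Finset.Ico M (kmax * n i + 1), u i j m * m ≤ ε := by
    intro ε hε
    have hD1 : ∀ᶠ i in (𝒰 : Filter ι), D i ≤ |D'| + 1 :=
      hDlim.eventually_le_const (by linarith [le_abs_self D'])
    set R : ℝ := (|D'| + 1) / ε with hR
    have hR0 : 0 < R := by positivity
    obtain ⟨M₁, hM₁⟩ := eventually_atTop.1 (hψ.eventually_ge_atTop (R + |C|))
    refine ⟨M₁ + 1, fun M hM => ?_⟩
    filter_upwards [hD1, hcost, hu0] with i h1 h2 h3
    intro j
    have h4 : ∀ m ∈ Finset.Ico M (kmax * n i + 1), R * (u i j m * m) ≤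
        typeCost θ C ψ m (u i j m) := by
      intro m hm
      have hm1 : M₁ + 1 ≤ m := hM.le.trans (Finset.mem_Ico.1 hm).1
      have hm0 : (1 : ℝ) ≤ m := by exact_mod_cast (by omega : 1 ≤ m)
      have h5 := hM₁ m (by omega)
      rw [le_div_iff₀ (by linarith)] at h5
      refine le_trans ?_ (mul_le_typeCost hθ m (h3 j m))
      have h6 : R * m ≤ ψ m - C := by nlinarith [le_abs_self C, abs_nonneg C]
      nlinarith [h3 j m]
    have h5 : R * ∑ m ∈ Finset.Ico M (kmax * n i + 1), u i j m * m ≤ |D'| + 1 := by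
      rw [Finset.mul_sum]
      refine (Finset.sum_le_sum h4).trans (le_trans ?_ (h2.trans h1))
      refine le_trans (Finset.sum_le_sum_of_subset_of_nonneg (t := Finset.range (kmax * n i + 1))
        (fun m hm => Finset.mem_range.2 (Finset.mem_Ico.1 hm).2)
        fun m _ _ => typeCost_nonneg hθ hC m (h3 j m)) ?_
      exact Finset.single_le_sum (f := fun j => ∑ m ∈ Finset.range (kmax * n i + 1),
        typeCost θ C ψ m (u i j m)) (fun j _ => Finset.sum_nonneg fun m _ =>
        typeCost_nonneg hθ hC m (h3 j m)) (Finset.mem_univ j)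
    rw [hR, div_mul_eq_mul_div, div_le_iff₀ hε] at h5
    exact le_of_mul_le_mul_left h5 (by positivity)
  have hset : IsDiscreteSetting L ν' u' := by
    refine ⟨hν'0, hu'0, fun j => ?_, fun j => ?_, fun j => ?_⟩
    · refine tendsto_nhds_unique (tendsto_finsetSum _ fun p _ => hν' j p) ((hL j).congr' ?_)
      filter_upwards [hev] with i hi using ((H i hi.1 hi.2).2.2.1 j).symm
    · refine hasSum_of_tail_le (hu'0 j) fun ε hε => ?_
      obtain ⟨M₀, hM₀⟩ := htail ε hε
      -- With M ≥ 1 every discarded m is at least 1, so the tail of the masses is bounded by the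
      -- tail of the hops.
      refine ⟨M₀ + 1, fun M hM => ?_⟩
      have h1 : Tendsto (fun i => |(Finset.card {x | c i x = j} : ℝ) / t i -
          ∑ m ∈ Finset.range M, u i j m|) 𝒰 (𝓝 |L j - ∑ m ∈ Finset.range M, u' j m|) :=
        ((hL j).sub (tendsto_finsetSum _ fun m _ => hu' j m)).abs
      refine le_of_tendsto h1 ?_
      filter_upwards [hev, hM₀ M (by omega), hKn.eventually_ge_atTop M] with i h2 h3 h4
      obtain ⟨-, H2, -, H4, -⟩ := H i h2.1 h2.2
      rw [← H4 j, ← Finset.sum_range_add_sum_Ico _ h4, add_sub_cancel_left,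
        abs_of_nonneg (Finset.sum_nonneg fun m _ => H2 j m)]
      refine le_trans (Finset.sum_le_sum fun m hm => ?_) (h3 j)
      have : (1 : ℝ) ≤ m := by
        have := (Finset.mem_Ico.1 hm).1
        exact_mod_cast (by omega : 1 ≤ m)
      exact le_mul_of_one_le_right (H2 j m) this
    · refine hasSum_of_tail_le (fun m => mul_nonneg (hu'0 j m) (Nat.cast_nonneg _)) fun ε hε => ?_
      obtain ⟨M₀, hM₀⟩ := htail ε hε
      refine ⟨M₀, fun M hM => ?_⟩
      have h1 : Tendsto (fun i => |hopCount (ν i) j -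
          ∑ m ∈ Finset.range M, u i j m * m|) 𝒰
          (𝓝 |hopCount ν' j - ∑ m ∈ Finset.range M, u' j m * m|) :=
        ((hhop j).sub (tendsto_finsetSum _ fun m _ => (hu' j m).mul_const _)).abs
      refine le_of_tendsto h1 ?_
      filter_upwards [hev, hM₀ M (by omega), hKn.eventually_ge_atTop M] with i h2 h3 h4
      obtain ⟨-, H2, -, -, H5, -⟩ := H i h2.1 h2.2
      rw [← H5 j, ← Finset.sum_range_add_sum_Ico _ h4, add_sub_cancel_left,
        abs_of_nonneg (Finset.sum_nonneg fun m _ => mul_nonneg (H2 j m) (Nat.cast_nonneg _))]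
      exact h3 j
  have hfin := hb ν' u' hset hsummable
  simp only [discreteEnergy] at hfin
  simp only [hD'] at htotal
  linarith

end AsymptoticUpperBound

/-! ### Lower bound by rounding a setting to integers -/

section AsymptoticLowerBound

variable {kmax : ℕ} {J : Type*} [Fintype J] [DecidableEq J]
variable {θ C : ℝ} {ψ : ℕ → ℝ}
variable {ι : Type*} {l : Filter ι}

/-- The trajectory without relays. -/
def directPath (hk : 0 < kmax) : RoutePath kmax J := ⟨⟨0, hk⟩, Fin.elim0⟩

theorem count_directPath (hk : 0 < kmax) (j : J) : (directPath hk : RoutePath kmax J).count j = 0 := by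
  unfold RoutePath.count directPath
  rw [Finset.card_eq_zero]
  exact Finset.eq_empty_of_forall_notMem fun x => x.elim0

theorem hopCount_nonneg {ν : J → RoutePath kmax J → ℝ} (hν : ∀ j p, 0 ≤ ν j p) (j : J) :
    0 ≤ hopCount ν j :=
  Finset.sum_nonneg fun _ _ => Finset.sum_nonneg fun _ _ =>
    mul_nonneg (hν _ _) (Nat.cast_nonneg _)

/-- Subtracting the Poisson weights leaves a finitely supported sum, and the weights themselves add
up to 1. -/
theorem tsum_typeCost_eq (hθ : 0 < θ) {L h : ℝ} {u : ℕ → ℝ} {K : ℕ} (hK : ∀ m, K ≤ m → u m = 0)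
    (hL : ∑ m ∈ Finset.range K, u m = L) (hh : ∑ m ∈ Finset.range K, u m * m = h) :
    ∑' m, typeCost θ C ψ m (u m) = 1 - (1 - θ + C) * L - Real.log θ * h +
      ∑ m ∈ Finset.range K, (u m * Real.log (u m) + u m * Real.log (m ! : ℝ) + ψ m * u m) := by
  have h1 : ∑' m, (typeCost θ C ψ m (u m) - poissonTerm θ m) =
      ∑ m ∈ Finset.range K, (typeCost θ C ψ m (u m) - poissonTerm θ m) :=
    tsum_eq_sum fun m hm => by
      rw [hK m (by simpa using hm), typeCost_zero, sub_self]
  have h2 : Summable fun m => (typeCost θ C ψ m (u m) - poissonTerm θ m) :=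
    summable_of_ne_finset_zero (s := Finset.range K) fun m hm => by
      rw [hK m (by simpa using hm), typeCost_zero, sub_self]
  have h3 := h2.tsum_add (hasSum_poissonTerm θ).summable
  simp only [sub_add_cancel] at h3
  rw [h3, h1, (hasSum_poissonTerm θ).tsum_eq]
  have h4 : ∀ m ∈ Finset.range K, typeCost θ C ψ m (u m) - poissonTerm θ m =
      (u m * Real.log (u m) + u m * Real.log (m ! : ℝ) + ψ m * u m) -
      (1 - θ + C) * u m - Real.log θ * (u m * m) := fun m _ => by rw [typeCost_eq hθ]; ring
  rw [Finset.sum_congr rfl h4, Finset.sum_sub_distrib, Finset.sum_sub_distrib, ← Finset.mul_sum,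
    ← Finset.mul_sum, hL, hh]
  ring

/-- The lower bound of the finite system, in terms of rescaled quantities. -/
theorem le_log_partition_div {U : Type*} [Fintype U] [DecidableEq U] {K : ℕ} (c : U → J)
    (hU : 0 < Fintype.card U) (Φ : J → RoutePath kmax J → ℝ) {t : ℝ} (ht : 0 < t)
    (r : J → RoutePath kmax J → ℕ) (u : J → Fin K → ℕ)
    (hr : ∀ j, ∑ p, r j p = Finset.card {i | c i = j})
    (hu : ∀ j, ∑ m, u j m = Finset.card {i | c i = j})
    (h : J → ℕ) (hrh : ∀ j, ∑ j', ∑ p, r j' p * p.count j = h j)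
    (huh : ∀ j, ∑ m, u j m * (m : ℕ) = h j) :
    (∑ j, ∑ p, (-((r j p : ℝ) / t * Φ j p) -
        (Real.log ((r j p)! : ℝ) - r j p * Real.log t) / t)) -
      (∑ j, (h j : ℝ) / t) * Real.log (Fintype.card U / t) +
      (∑ j, ∑ m, ((u j m : ℝ) / t * (-ψ m - Real.log ((m : ℕ)! : ℝ)) -
        (Real.log ((u j m)! : ℝ) - u j m * Real.log t) / t)) +
      ∑ j, (2 * ((Real.log ((Finset.card {i | c i = j})! : ℝ) -
        (Finset.card {i | c i = j} : ℝ) * Real.log t) / t) +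
        (Real.log ((h j)! : ℝ) - h j * Real.log t) / t) ≤
    Real.log (∑ s, configWeight c (hopWeight (Fintype.card U) Φ) (fun m => Real.exp (-ψ m)) s)
      / t := by
  have h1 := le_log_partition c (hopWeight (Fintype.card U) Φ) (fun m => Real.exp (-ψ m))
    (hopWeight_pos hU Φ) (fun m => Real.exp_pos _) r u hr hu h hrh huh
  rw [le_div_iff₀ ht]
  refine le_trans (le_of_eq ?_) h1
  have hn : (0 : ℝ) < Fintype.card U := Nat.cast_pos.2 hU
  have e0 : ∀ j, hopCount (fun j p => (r j p : ℝ)) j = h j := fun j => by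
    rw [← hrh j]; push_cast; rfl
  have e1 := sum_hopCount fun j p => (r j p : ℝ)
  simp only [e0] at e1
  have e2 : ∀ j, (Finset.card {i | c i = j} : ℝ) = ∑ p, (r j p : ℝ) := fun j => by
    rw [← hr j]; push_cast; rfl
  have e3 : ∀ j, (Finset.card {i | c i = j} : ℝ) = ∑ m, (u j m : ℝ) := fun j => by
    rw [← hu j]; push_cast; rfl
  have e4 : ∑ j, (Finset.card {i | c i = j} : ℝ) * Real.log t =
      ∑ j, ∑ p, (r j p : ℝ) * Real.log t :=
    Finset.sum_congr rfl fun j _ => by rw [e2, Finset.sum_mul]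
  have e5 : ∑ j, (Finset.card {i | c i = j} : ℝ) * Real.log t =
      ∑ j, ∑ m, (u j m : ℝ) * Real.log t :=
    Finset.sum_congr rfl fun j _ => by rw [e3, Finset.sum_mul]
  have e6 : ∑ j, ∑ p, (r j p : ℝ) * Real.log (hopWeight (Fintype.card U) Φ j p) =
      -(∑ j, (h j : ℝ)) * Real.log (Fintype.card U) - ∑ j, ∑ p, (r j p : ℝ) * Φ j p := by
    rw [e1]
    simp only [log_hopWeight hU, mul_sub, Finset.sum_sub_distrib, Finset.sum_mul, neg_mul,
      Finset.sum_neg_distrib, mul_neg, mul_assoc]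
  have t2 : ∀ x y : ℝ, x / t * y = (x * y) / t := fun x y => by ring
  simp only [t2, Real.log_exp, mul_sub, mul_neg, Finset.sum_sub_distrib, Finset.sum_add_distrib,
    ← mul_div_assoc, ← sub_div, ← add_div, ← Finset.sum_div, ← Finset.mul_sum,
    Finset.sum_neg_distrib, e6]
  rw [Real.log_div hn.ne' ht.ne']
  simp only [← Finset.sum_mul] at e4 e5 ⊢
  field_simp
  linarith

/-- The masses have to be rounded to counts satisfying the three constraints exactly. Relayed
trajectories are rounded up and direct ones take the remaining users; loads of at least 2 are
rounded down, load 1 takes the remaining hops, and load 0 the remaining users. Positive mass of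
direct trajectories and of load 0 keeps these remainders nonnegative. -/
theorem eventually_le_log_partition_div (hk : 0 < kmax) (hθ : 0 < θ)
    (Φ : J → RoutePath kmax J → ℝ)
    {t : ι → ℝ} (ht : Tendsto t l atTop) {n : ι → ℕ} (c : ∀ i, Fin (n i) → J) {L : J → ℝ}
    (hL : ∀ j, Tendsto (fun i => (Finset.card {x | c i x = j} : ℝ) / t i) l (𝓝 (L j)))
    (hL0 : 0 < ∑ j, L j) (hθL : 1 + Real.log (∑ j, L j) + Real.log θ = 0)
    {ν : J → RoutePath kmax J → ℝ} {u : J → ℕ → ℝ} (hset : IsDiscreteSetting L ν u)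
    {K : ℕ} (hK : ∀ j m, K + 2 ≤ m → u j m = 0)
    (hpos : ∀ j, L j ≠ 0 → 0 < ν j (directPath hk) ∧ 0 < u j 0) {b : ℝ}
    (hb : discreteEnergy θ C Φ ψ L ν u < b) :
    ∀ᶠ i in l, -b ≤ Real.log (∑ s, configWeight (c i) (hopWeight (n i) Φ)
      (fun m => Real.exp (-ψ m)) s) / t i := by
  have hν0 := hset.ν_nonneg
  have hu0 := hset.u_nonneg
  have huL : ∀ j, ∑ m ∈ Finset.range (K + 2), u j m = L j := fun j =>
    (hasSum_sum_of_ne_finset_zero fun m hm => hK j m (by simpa using hm)).unique (hset.rel_eq j)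
  have huh : ∀ j, ∑ m ∈ Finset.range (K + 2), u j m * m = hopCount ν j := fun j =>
    (hasSum_sum_of_ne_finset_zero fun m hm => by
      rw [hK j m (by simpa using hm), zero_mul]).unique (hset.hops_eq j)
  have huL' : ∀ j, u j 0 + (u j 1 + ∑ m : Fin K, u j (m + 2)) = L j := fun j => by
    rw [← huL j, ← Fin.sum_univ_eq_sum_range, Fin.sum_univ_succ, Fin.sum_univ_succ]
    rfl
  have huh' : ∀ j, u j 1 + ∑ m : Fin K, ((m : ℕ) + 2 : ℝ) * u j (m + 2) = hopCount ν j :=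
    fun j => by
    rw [← huh j, ← Fin.sum_univ_eq_sum_range (fun m => u j m * m), Fin.sum_univ_succ,
      Fin.sum_univ_succ]
    simp only [Fin.val_zero, Fin.val_succ]
    push_cast
    rw [mul_zero, zero_add, mul_one]
    congr 1
    refine Finset.sum_congr rfl fun m _ => ?_
    rw [mul_comm, add_assoc, one_add_one_eq_two]
    ring
  have hL0' : ∀ j, 0 ≤ L j := fun j => by
    rw [← hset.start_eq j]; exact Finset.sum_nonneg fun p _ => hν0 j p
  have hνz : ∀ j, L j = 0 → ∀ p, ν j p = 0 := fun j hj p => by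
    have h1 := hset.start_eq j
    rw [hj, Finset.sum_eq_zero_iff_of_nonneg fun p _ => hν0 j p] at h1
    exact h1 p (Finset.mem_univ p)
  have huz : ∀ j, L j = 0 → ∀ m, u j m = 0 := fun j hj m => by
    have h1 := hset.rel_eq j
    rw [hj, hasSum_zero_iff_of_nonneg (hu0 j)] at h1
    exact congrFun h1 m
  have hhz : ∀ j, L j = 0 → hopCount ν j = 0 := fun j hj => by
    rw [← huh j]; exact Finset.sum_eq_zero fun m _ => by rw [huz j hj, zero_mul]
  have hνcz : ∀ j, L j = 0 → ∀ j' p, p.count j ≠ 0 → ν j' p = 0 := fun j hj j' p hp => by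
    have h1 := hhz j hj
    rw [hopCount, Finset.sum_eq_zero_iff_of_nonneg fun j' _ => Finset.sum_nonneg fun p _ =>
      mul_nonneg (hν0 j' p) (Nat.cast_nonneg _)] at h1
    have h2 := h1 j' (Finset.mem_univ _)
    rw [Finset.sum_eq_zero_iff_of_nonneg fun p _ =>
      mul_nonneg (hν0 j' p) (Nat.cast_nonneg _)] at h2
    have h3 := h2 p (Finset.mem_univ _)
    simpa [hp] using h3
  set nn : ι → J → ℕ := fun i j => Finset.card {x | c i x = j} with hnn
  set R : ι → J → ℕ := fun i j => ∑ p ∈ Finset.univ.erase (directPath hk), ⌈ν j p * t i⌉₊ with hR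
  set r : ι → J → RoutePath kmax J → ℕ := fun i j p =>
    if p = directPath hk then nn i j - R i j else ⌈ν j p * t i⌉₊ with hr
  set H : ι → J → ℕ := fun i j => ∑ j', ∑ p, r i j' p * p.count j with hH
  set v : ι → J → Fin K → ℕ := fun i j m => ⌊u j (m + 2) * t i⌋₊ with hv
  set u1 : ι → J → ℕ := fun i j => H i j - ∑ m : Fin K, ((m : ℕ) + 2) * v i j m with hu1
  set w : ι → J → Fin (K + 2) → ℕ := fun i j =>
    Fin.cons (nn i j - (u1 i j + ∑ m, v i j m)) (Fin.cons (u1 i j) (v i j)) with hw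
  have hceil : ∀ j p, Tendsto (fun i => (⌈ν j p * t i⌉₊ : ℝ) / t i) l (𝓝 (ν j p)) := fun j p =>
    (tendsto_nat_ceil_mul_div_atTop (hν0 j p)).comp ht
  have hfloor : ∀ j (m : Fin K), Tendsto (fun i => (v i j m : ℝ) / t i) l (𝓝 (u j (m + 2))) :=
    fun j m => (tendsto_nat_floor_mul_div_atTop (hu0 j _)).comp ht
  have hRlim : ∀ j, Tendsto (fun i => (R i j : ℝ) / t i) l (𝓝 (L j - ν j (directPath hk))) := by
    intro j
    have h1 := tendsto_finsetSum (Finset.univ.erase (directPath hk)) fun p _ => hceil j p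
    rw [← hset.start_eq j, ← Finset.add_sum_erase _ _ (Finset.mem_univ (directPath hk)),
      add_sub_cancel_left]
    refine h1.congr fun i => ?_
    rw [hR, ← Finset.sum_div]; push_cast; rfl
  have htpos : ∀ᶠ i in l, 0 < t i := ht.eventually_gt_atTop 0
  -- If `L j = 0`, all masses of the cell vanish and are rounded to 0 exactly; otherwise the direct
  -- trajectories leave a macroscopic margin.
  have hRle : ∀ᶠ i in l, ∀ j, R i j ≤ nn i j := by
    refine eventually_all.2 fun j => ?_
    by_cases hj : L j = 0
    · refine .of_forall fun i => ?_
      simp only [hR, hνz j hj, zero_mul, Nat.ceil_zero, Finset.sum_const_zero, zero_le]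
    · filter_upwards [htpos, (hRlim j).eventually_lt (hL j) (by linarith [(hpos j hj).1])]
        with i h1 h2
      rw [div_lt_div_iff_of_pos_right h1] at h2
      exact_mod_cast h2.le
  have hrsum : ∀ᶠ i in l, ∀ j, ∑ p, r i j p = nn i j := by
    filter_upwards [hRle] with i hi
    intro j
    rw [← Finset.add_sum_erase _ _ (Finset.mem_univ (directPath hk))]
    have : ∑ p ∈ Finset.univ.erase (directPath hk), r i j p = R i j := by
      refine Finset.sum_congr rfl fun p hp => ?_
      simp only [hr, if_neg (Finset.ne_of_mem_erase hp)]
    rw [this]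
    simp only [hr, if_true]
    exact Nat.sub_add_cancel (hi j)
  have hrlim : ∀ j p, Tendsto (fun i => (r i j p : ℝ) / t i) l (𝓝 (ν j p)) := by
    intro j p
    by_cases hp : p = directPath hk
    · subst hp
      have h1 := (hL j).sub (hRlim j)
      rw [sub_sub_cancel] at h1
      refine h1.congr' ?_
      filter_upwards [hRle] with i hi
      simp only [hr, if_true]
      rw [Nat.cast_sub (hi j), sub_div]
    · simp only [hr, if_neg hp]
      exact hceil j p
  have hHlim : ∀ j, Tendsto (fun i => (H i j : ℝ) / t i) l (𝓝 (hopCount ν j)) := by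
    intro j
    refine (tendsto_hopCount hrlim j).congr fun i => ?_
    simp only [hH, hopCount]
    push_cast
    simp only [Finset.sum_div, div_mul_eq_mul_div]
  have hHz : ∀ j, L j = 0 → ∀ i, H i j = 0 := by
    intro j hj i
    refine Finset.sum_eq_zero fun j' _ => Finset.sum_eq_zero fun p _ => ?_
    by_cases hc : p.count j = 0
    · rw [hc, mul_zero]
    · have hp : p ≠ directPath hk := fun h => hc (by rw [h, count_directPath])
      simp only [hr, if_neg hp, hνcz j hj j' p hc, zero_mul, Nat.ceil_zero]
  -- Trajectories were rounded up and loads down, so the subtraction defining `u1` is not truncated.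
  have hVle : ∀ᶠ i in l, ∀ j, ∑ m : Fin K, ((m : ℕ) + 2) * v i j m ≤ H i j := by
    filter_upwards [htpos] with i hi
    intro j
    have h1 : ((∑ m : Fin K, ((m : ℕ) + 2) * v i j m : ℕ) : ℝ) ≤ hopCount ν j * t i := by
      rw [← huh' j, add_mul, Finset.sum_mul]
      push_cast
      refine le_add_of_nonneg_of_le (mul_nonneg (hu0 j 1) hi.le) (Finset.sum_le_sum fun m _ => ?_)
      rw [mul_assoc]
      exact mul_le_mul_of_nonneg_left (Nat.floor_le (mul_nonneg (hu0 _ _) hi.le)) (by positivity)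
    have h2 : hopCount ν j * t i ≤ (H i j : ℝ) := by
      simp only [hopCount, hH, Finset.sum_mul]
      push_cast
      refine Finset.sum_le_sum fun j' _ => Finset.sum_le_sum fun p _ => ?_
      by_cases hp : p = directPath hk
      · rw [hp, count_directPath]; simp
      · rw [mul_right_comm]
        refine mul_le_mul_of_nonneg_right ?_ (Nat.cast_nonneg _)
        simp only [hr, if_neg hp]
        exact Nat.le_ceil _
    exact_mod_cast h1.trans h2
  have hu1lim : ∀ j, Tendsto (fun i => (u1 i j : ℝ) / t i) l (𝓝 (u j 1)) := by
    intro j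
    have h1 := (hHlim j).sub (tendsto_finsetSum Finset.univ fun (m : Fin K) _ =>
      (hfloor j m).const_mul ((m : ℕ) + 2 : ℝ))
    rw [← huh' j, add_sub_cancel_right] at h1
    refine h1.congr' ?_
    filter_upwards [hVle] with i hi
    simp only [hu1]
    rw [Nat.cast_sub (hi j), sub_div]
    push_cast
    simp only [Finset.sum_div, mul_div_assoc]
  have hu1z : ∀ j, L j = 0 → ∀ i, u1 i j = 0 := fun j hj i => by
    simp only [hu1, hHz j hj i, zero_tsub]
  have hSlim : ∀ j, Tendsto (fun i => ((u1 i j + ∑ m, v i j m : ℕ) : ℝ) / t i) l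
      (𝓝 (L j - u j 0)) := by
    intro j
    have h1 := (hu1lim j).add (tendsto_finsetSum Finset.univ fun (m : Fin K) _ => hfloor j m)
    rw [← huL' j, add_sub_cancel_left]
    refine h1.congr fun i => ?_
    push_cast
    rw [add_div, Finset.sum_div]
  have hSle : ∀ᶠ i in l, ∀ j, u1 i j + ∑ m, v i j m ≤ nn i j := by
    refine eventually_all.2 fun j => ?_
    by_cases hj : L j = 0
    · refine .of_forall fun i => ?_
      simp only [hu1z j hj i, hv, huz j hj, zero_mul, Nat.floor_zero, Finset.sum_const_zero,
        add_zero, zero_le]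
    · filter_upwards [htpos, (hSlim j).eventually_lt (hL j) (by linarith [(hpos j hj).2])]
        with i h1 h2
      rw [div_lt_div_iff_of_pos_right h1] at h2
      exact_mod_cast h2.le
  have hwlim : ∀ j m, Tendsto (fun i => (w i j m : ℝ) / t i) l (𝓝 (u j m)) := by
    intro j m
    refine Fin.cases ?_ (fun m => ?_) m
    · have h1 := (hL j).sub (hSlim j)
      rw [sub_sub_cancel] at h1
      refine h1.congr' ?_
      filter_upwards [hSle] with i hi
      simp only [hw, Fin.cons_zero]
      rw [Nat.cast_sub (hi j), sub_div]
    · refine Fin.cases ?_ (fun m => ?_) m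
      · simpa [hw] using hu1lim j
      · simpa [hw, add_assoc] using hfloor j m
  have hwsum : ∀ᶠ i in l, ∀ j, ∑ m, w i j m = nn i j := by
    filter_upwards [hSle] with i hi
    intro j
    rw [Fin.sum_univ_succ, Fin.sum_univ_succ]
    simp only [hw, Fin.cons_zero, Fin.cons_succ]
    exact Nat.sub_add_cancel (hi j)
  have hwh : ∀ᶠ i in l, ∀ j, ∑ m, w i j m * (m : ℕ) = H i j := by
    filter_upwards [hVle] with i hi
    intro j
    rw [Fin.sum_univ_succ, Fin.sum_univ_succ]
    simp only [hw, Fin.cons_zero, Fin.cons_succ, Fin.val_zero, Fin.val_succ, mul_zero, zero_add,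
      mul_one]
    have h1 : ∑ m : Fin K, v i j m * ((m : ℕ) + 1 + 1) = ∑ m : Fin K, ((m : ℕ) + 2) * v i j m :=
      Finset.sum_congr rfl fun m _ => by ring
    rw [h1]
    exact Nat.sub_add_cancel (hi j)
  have hn := tendsto_card_div hL
  have hn0 : ∀ᶠ i in l, 0 < n i := by
    filter_upwards [hn.eventually_const_lt hL0, htpos] with i h1 h2
    have : (0 : ℝ) < n i := by rwa [lt_div_iff₀ h2, zero_mul] at h1
    exact_mod_cast this
  have hlim := ((((tendsto_finsetSum Finset.univ fun j _ => tendsto_finsetSum Finset.univ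
    fun p _ => (((hrlim j p).mul_const (Φ j p)).neg.sub
      (tendsto_log_factorial_div ht (hrlim j p)))).sub
    ((tendsto_finsetSum Finset.univ fun j _ => hHlim j).mul (hn.log hL0.ne'))).add
    (tendsto_finsetSum Finset.univ fun j _ => tendsto_finsetSum Finset.univ
      fun (m : Fin (K + 2)) _ => (((hwlim j m).mul_const (-ψ m - Real.log ((m : ℕ)! : ℝ))).sub
      (tendsto_log_factorial_div ht (hwlim j m))))).add
    (tendsto_finsetSum Finset.univ fun j _ => ((tendsto_log_factorial_div ht (hL j)).const_mul
      2).add (tendsto_log_factorial_div ht (hHlim j))))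
  have hval : ((∑ j, ∑ p, (-(ν j p * Φ j p) - (ν j p * Real.log (ν j p) - ν j p)) -
      (∑ j, hopCount ν j) * Real.log (∑ j, L j)) +
      ∑ j, ∑ m : Fin (K + 2), (u j m * (-ψ m - Real.log ((m : ℕ)! : ℝ)) -
        (u j m * Real.log (u j m) - u j m))) +
      ∑ j, (2 * (L j * Real.log (L j) - L j) +
        (hopCount ν j * Real.log (hopCount ν j) - hopCount ν j)) =
      -discreteEnergy θ C Φ ψ L ν u := by
    have s1 : ∀ j, ∑ m : Fin (K + 2), (u j m * (-ψ m - Real.log ((m : ℕ)! : ℝ)) -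
        (u j m * Real.log (u j m) - u j m)) = 1 - (1 - θ + C) * L j - Real.log θ * hopCount ν j -
        ∑' m, typeCost θ C ψ m (u j m) + L j := by
      intro j
      rw [tsum_typeCost_eq hθ (hK j) (huL j) (huh j),
        Fin.sum_univ_eq_sum_range (fun m => (u j m * (-ψ m - Real.log (m ! : ℝ)) -
        (u j m * Real.log (u j m) - u j m)))]
      have s2 : ∀ m ∈ Finset.range (K + 2), (u j m * (-ψ m - Real.log (m ! : ℝ)) -
        (u j m * Real.log (u j m) - u j m)) = u j m - (u j m * Real.log (u j m) +
          u j m * Real.log (m ! : ℝ) + ψ m * u j m) := fun m _ => by ring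
      rw [Finset.sum_congr rfl s2, Finset.sum_sub_distrib, huL]
      ring
    rw [Finset.sum_congr rfl fun j _ => s1 j]
    simp only [Finset.sum_sub_distrib, Finset.sum_add_distrib, Finset.sum_neg_distrib,
      ← Finset.mul_sum, hset.start_eq, Finset.sum_const, Finset.card_univ, nsmul_eq_mul,
      discreteEnergy, routeEnergy]
    -- The choice of θ cancels the terms linear in the number of hops.
    have : Real.log θ = -(1 + Real.log (∑ j, L j)) := by linarith
    rw [this]
    ring
  rw [hval] at hlim
  filter_upwards [hlim.eventually_const_lt (neg_lt_neg hb), hn0, htpos, hrsum, hwsum, hwh]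
    with i h1 h2 h3 h4 h5 h6
  refine h1.le.trans ?_
  have h7 := le_log_partition_div (ψ := ψ) (c i) (by simpa using h2) Φ h3 (r i) (w i) h4 h5 (H i)
    (fun j => rfl) h6
  simp only [Fintype.card_fin] at h7
  exact h7

end AsymptoticLowerBound

/-! ### Approximation by positive settings with bounded loads -/

section Approximation

variable {kmax : ℕ} {J : Type*} [Fintype J] [DecidableEq J]
variable {θ C : ℝ} {ψ : ℕ → ℝ}

theorem convexOn_typeCost (m : ℕ) : ConvexOn ℝ (Set.Ici 0) (typeCost θ C ψ m) := by
  refine ⟨convex_Ici 0, fun x hx y hy a b ha hb hab => ?_⟩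
  have h := Real.convexOn_mul_log.2 hx hy ha hb hab
  simp only [smul_eq_mul] at h ⊢
  unfold typeCost
  have hb' : b = 1 - a := by linarith
  subst hb'
  linarith

theorem hopCount_lin (a b : ℝ) (ν₁ ν₂ : J → RoutePath kmax J → ℝ) (j : J) :
    hopCount (fun j p => a * ν₁ j p + b * ν₂ j p) j = a * hopCount ν₁ j + b * hopCount ν₂ j := by
  simp only [hopCount, Finset.mul_sum, ← Finset.sum_add_distrib]
  exact Finset.sum_congr rfl fun _ _ => Finset.sum_congr rfl fun _ _ => by ring

theorem IsDiscreteSetting.mix {L : J → ℝ} {ν₁ ν₂ : J → RoutePath kmax J → ℝ}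
    {u₁ u₂ : J → ℕ → ℝ} (h₁ : IsDiscreteSetting L ν₁ u₁) (h₂ : IsDiscreteSetting L ν₂ u₂)
    {a b : ℝ} (ha : 0 ≤ a) (hb : 0 ≤ b) (hab : a + b = 1) :
    IsDiscreteSetting L (fun j p => a * ν₁ j p + b * ν₂ j p)
      (fun j m => a * u₁ j m + b * u₂ j m) where
  ν_nonneg j p := add_nonneg (mul_nonneg ha (h₁.ν_nonneg j p)) (mul_nonneg hb (h₂.ν_nonneg j p))
  u_nonneg j p := add_nonneg (mul_nonneg ha (h₁.u_nonneg j p)) (mul_nonneg hb (h₂.u_nonneg j p))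
  start_eq j := by
    rw [Finset.sum_add_distrib, ← Finset.mul_sum, ← Finset.mul_sum, h₁.start_eq, h₂.start_eq,
      ← add_mul, hab, one_mul]
  rel_eq j := by
    have := ((h₁.rel_eq j).mul_left a).add ((h₂.rel_eq j).mul_left b)
    rwa [← add_mul, hab, one_mul] at this
  hops_eq j := by
    have := ((h₁.hops_eq j).mul_left a).add ((h₂.hops_eq j).mul_left b)
    rw [hopCount_lin]
    refine this.congr_fun fun m => ?_
    ring

/-- The setting in which every trajectory is direct. -/
theorem isDiscreteSetting_direct (hk : 0 < kmax) {L : J → ℝ} (hL : ∀ j, 0 ≤ L j) :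
    IsDiscreteSetting L (fun j p => if p = directPath hk then L j else 0)
      (fun j m => if m = 0 then L j else 0) where
  ν_nonneg j p := by split_ifs <;> simp [hL j]
  u_nonneg j p := by split_ifs <;> simp [hL j]
  start_eq j := by simp
  rel_eq j := hasSum_ite_eq 0 (L j)
  hops_eq j := by
    have h1 : hopCount (fun j p => if p = directPath hk then L j else 0) j = 0 :=
      Finset.sum_eq_zero fun j' _ => Finset.sum_eq_zero fun p _ => by
        by_cases hp : p = directPath hk
        · rw [hp, count_directPath]; simp
        · simp [hp]
    rw [h1]
    have h2 : (fun m : ℕ => (if m = 0 then L j else 0) * (m : ℝ)) = fun _ => 0 := by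
      funext m
      by_cases hm : m = 0 <;> simp [hm]
    rw [h2]; exact hasSum_zero

theorem IsDiscreteSetting.L_nonneg {L : J → ℝ} {ν : J → RoutePath kmax J → ℝ} {u : J → ℕ → ℝ}
    (hset : IsDiscreteSetting L ν u) (j : J) : 0 ≤ L j := by
  rw [← hset.start_eq j]; exact Finset.sum_nonneg fun p _ => hset.ν_nonneg j p

/-- Every setting is approximated by settings in which direct trajectories and users without
incoming hops have positive density. -/
theorem exists_positive_setting (hk : 0 < kmax) (hθ : 0 < θ) (hC : ∀ m, C ≤ ψ m)
    (Φ : J → RoutePath kmax J → ℝ) {L : J → ℝ} {ν : J → RoutePath kmax J → ℝ} {u : J → ℕ → ℝ}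
    (hset : IsDiscreteSetting L ν u) (hsum : ∀ j, Summable fun m => typeCost θ C ψ m (u j m))
    {b : ℝ} (hb : discreteEnergy θ C Φ ψ L ν u < b) :
    ∃ (ν' : J → RoutePath kmax J → ℝ) (u' : J → ℕ → ℝ), IsDiscreteSetting L ν' u' ∧
      (∀ j, Summable fun m => typeCost θ C ψ m (u' j m)) ∧
      (∀ j, L j ≠ 0 → 0 < ν' j (directPath hk) ∧ 0 < u' j 0) ∧
      discreteEnergy θ C Φ ψ L ν' u' < b := by
  have hL := hset.L_nonneg
  have hdir := isDiscreteSetting_direct hk hL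
  set ν₀ : J → RoutePath kmax J → ℝ := fun j p => if p = directPath hk then L j else 0 with hν₀
  set u₀ : J → ℕ → ℝ := fun j m => if m = 0 then L j else 0 with hu₀
  have hsum₀ : ∀ j, Summable fun m => typeCost θ C ψ m (u₀ j m) := by
    intro j
    have h1 : Summable fun m => typeCost θ C ψ m (u₀ j m) - poissonTerm θ m :=
      summable_of_ne_finset_zero (s := {0}) fun m hm => by
        have : m ≠ 0 := by simpa using hm
        simp only [hu₀, if_neg this, typeCost_zero, sub_self]
    exact (h1.add (hasSum_poissonTerm θ).summable).congr fun m => by ring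
  -- Mixing with the direct setting: convexity bounds the infinite sum over the loads, while
  -- `routeEnergy`, a function of finitely many masses, is handled by continuity.
  have hconv : ∀ ε ∈ Set.Ioo (0 : ℝ) 1, ∀ j m,
      typeCost θ C ψ m ((1 - ε) * u j m + ε * u₀ j m) ≤
        (1 - ε) * typeCost θ C ψ m (u j m) + ε * typeCost θ C ψ m (u₀ j m) := fun ε hε j m =>
    (convexOn_typeCost m).2 (hset.u_nonneg j m) (hdir.u_nonneg j m) (by linarith [hε.2]) hε.1.le
      (by ring)
  have hlimν : ∀ j p, Tendsto (fun ε : ℝ => (1 - ε) * ν j p + ε * ν₀ j p) (𝓝[>] 0)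
      (𝓝 (ν j p)) := fun j p => by
    have : Continuous fun ε : ℝ => (1 - ε) * ν j p + ε * ν₀ j p := by fun_prop
    have h2 := this.tendsto 0
    simp only [sub_zero, one_mul, zero_mul, add_zero] at h2
    exact h2.mono_left nhdsWithin_le_nhds
  have hlimT : Tendsto (fun ε : ℝ => ∑ j, ((1 - ε) * ∑' m, typeCost θ C ψ m (u j m) +
      ε * ∑' m, typeCost θ C ψ m (u₀ j m))) (𝓝[>] 0)
      (𝓝 (∑ j, ∑' m, typeCost θ C ψ m (u j m))) := by
    have : Continuous fun ε : ℝ => ∑ j, ((1 - ε) * ∑' m, typeCost θ C ψ m (u j m) +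
      ε * ∑' m, typeCost θ C ψ m (u₀ j m)) := by fun_prop
    have h2 := this.tendsto 0
    simp only [sub_zero, one_mul, zero_mul, add_zero] at h2
    exact h2.mono_left nhdsWithin_le_nhds
  have hlim := (((tendsto_routeEnergy Φ hlimν fun j => tendsto_const_nhds (x := L j)).add_const
    ((1 - θ + C) * ∑ j, L j)).sub_const (Fintype.card J : ℝ)).add hlimT
  obtain ⟨ε, hε1, hε⟩ := ((hlim.eventually_lt_const hb).and
    (Ioo_mem_nhdsGT (zero_lt_one (α := ℝ)))).exists
  have hsumε : ∀ j, Summable fun m => typeCost θ C ψ m ((1 - ε) * u j m + ε * u₀ j m) := fun j =>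
    Summable.of_nonneg_of_le (fun m => typeCost_nonneg hθ hC m (add_nonneg
      (mul_nonneg (by linarith [hε.2]) (hset.u_nonneg j m))
      (mul_nonneg hε.1.le (hdir.u_nonneg j m)))) (hconv ε hε j)
      (((hsum j).mul_left _).add ((hsum₀ j).mul_left _))
  refine ⟨_, _, hset.mix hdir (a := 1 - ε) (b := ε) (by linarith [hε.2]) hε.1.le (by ring),
    hsumε, fun j hj => ⟨?_, ?_⟩, ?_⟩
  · have hLj : 0 < L j := lt_of_le_of_ne (hL j) (Ne.symm hj)
    simp only [hν₀, if_true]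
    exact add_pos_of_nonneg_of_pos (mul_nonneg (by linarith [hε.2]) (hset.ν_nonneg _ _))
      (mul_pos hε.1 hLj)
  · have hLj : 0 < L j := lt_of_le_of_ne (hL j) (Ne.symm hj)
    simp only [hu₀, if_true]
    exact add_pos_of_nonneg_of_pos (mul_nonneg (by linarith [hε.2]) (hset.u_nonneg _ _))
      (mul_pos hε.1 hLj)
  · refine lt_of_le_of_lt ?_ hε1
    unfold discreteEnergy
    refine add_le_add_right (Finset.sum_le_sum fun j _ => ?_) _
    have h1 := (hsumε j).tsum_le_tsum (hconv ε hε j)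
      (((hsum j).mul_left _).add ((hsum₀ j).mul_left _))
    rwa [((hsum j).mul_left (1 - ε)).tsum_add ((hsum₀ j).mul_left ε), tsum_mul_left,
      tsum_mul_left] at h1

/-- Truncation of the numbers of incoming hops, at the expense of users with at most one hop. -/
theorem exists_truncated_setting (hk : 0 < kmax)
    (Φ : J → RoutePath kmax J → ℝ) {L : J → ℝ} {ν : J → RoutePath kmax J → ℝ} {u : J → ℕ → ℝ}
    (hset : IsDiscreteSetting L ν u) (hsum : ∀ j, Summable fun m => typeCost θ C ψ m (u j m))
    (hpos : ∀ j, L j ≠ 0 → 0 < ν j (directPath hk) ∧ 0 < u j 0)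
    {b : ℝ} (hb : discreteEnergy θ C Φ ψ L ν u < b) :
    ∃ (u' : J → ℕ → ℝ) (K : ℕ), IsDiscreteSetting L ν u' ∧
      (∀ j m, K + 2 ≤ m → u' j m = 0) ∧
      (∀ j, L j ≠ 0 → 0 < ν j (directPath hk) ∧ 0 < u' j 0) ∧
      discreteEnergy θ C Φ ψ L ν u' < b := by
  -- `τ` and `σ` are the hops and the users lost by cutting the loads at K + 2, a bound that always
  -- keeps the loads 0 and 1.
  set τ : ℕ → J → ℝ := fun K j => hopCount ν j - ∑ m ∈ Finset.range (K + 2), u j m * m with hτ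
  set σ : ℕ → J → ℝ := fun K j => L j - ∑ m ∈ Finset.range (K + 2), u j m with hσ
  have hu0 := hset.u_nonneg
  have hτ0 : ∀ K j, 0 ≤ τ K j := fun K j => sub_nonneg.2
    (sum_le_hasSum _ (fun m _ => mul_nonneg (hu0 j m) (Nat.cast_nonneg _)) (hset.hops_eq j))
  have hτlim : ∀ j, Tendsto (fun K => τ K j) atTop (𝓝 0) := fun j => by
    have := ((hset.hops_eq j).tendsto_sum_nat.comp (tendsto_add_atTop_nat 2)).const_sub
      (hopCount ν j)
    rwa [sub_self] at this
  have hσlim : ∀ j, Tendsto (fun K => σ K j) atTop (𝓝 0) := fun j => by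
    have := ((hset.rel_eq j).tendsto_sum_nat.comp (tendsto_add_atTop_nat 2)).const_sub (L j)
    rwa [sub_self] at this
  -- Load 1 receives the lost hops τ, and load 0 then needs σ - τ to restore the number of users. As
  -- this may be negative, positivity of `u j 0` is required; both corrections tend to 0.
  set v : ℕ → J → ℕ → ℝ := fun K j m => (if m < K + 2 then u j m else 0) +
    (if m = 1 then τ K j else 0) + (if m = 0 then σ K j - τ K j else 0) with hv
  have hv0 : ∀ K j, v K j 0 = u j 0 + (σ K j - τ K j) := fun K j => by simp [hv]
  have hv1 : ∀ K j, v K j 1 = u j 1 + τ K j := fun K j => by simp [hv]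
  have hv2 : ∀ K j m, m < K + 2 → m ≠ 0 → m ≠ 1 → v K j m = u j m := fun K j m h1 h2 h3 => by
    simp [hv, h1, h2, h3]
  have hvK : ∀ K j m, K + 2 ≤ m → v K j m = 0 := fun K j m hm => by
    simp only [hv, if_neg (by omega : ¬ m < K + 2), if_neg (by omega : m ≠ 1),
      if_neg (by omega : m ≠ 0), add_zero]
  have hvsum : ∀ K j (g : ℕ → ℝ → ℝ), ∑ m ∈ Finset.range (K + 2), g m (v K j m) =
      ∑ m ∈ Finset.range (K + 2), g m (u j m) + (g 1 (u j 1 + τ K j) - g 1 (u j 1)) +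
        (g 0 (u j 0 + (σ K j - τ K j)) - g 0 (u j 0)) := by
    intro K j g
    rw [Finset.sum_range_succ', Finset.sum_range_succ', Finset.sum_range_succ' _ (K + 1),
      Finset.sum_range_succ' _ K, hv0, zero_add, hv1,
      Finset.sum_congr rfl fun m hm => by
        rw [hv2 K j (m + 1 + 1) (by have := Finset.mem_range.1 hm; omega) (by omega) (by omega)]]
    ring
  have hsetK : ∀ K, (∀ j, 0 ≤ v K j 0) → IsDiscreteSetting L ν (v K) := fun K h0 =>
    { ν_nonneg := hset.ν_nonneg
      u_nonneg := fun j m => by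
        rcases Nat.eq_zero_or_pos m with rfl | hm
        · exact h0 j
        · simp only [hv, if_neg hm.ne', add_zero]
          refine add_nonneg ?_ ?_ <;> split_ifs <;> simp [hu0 j m, hτ0 K j]
      start_eq := hset.start_eq
      rel_eq := fun j => by
        have h1 : HasSum (v K j) (∑ m ∈ Finset.range (K + 2), v K j m) :=
          hasSum_sum_of_ne_finset_zero fun m hm => hvK K j m (by simpa using hm)
        rw [hvsum K j fun _ x => x] at h1
        convert h1 using 1
        simp only [hσ]; ring
      hops_eq := fun j => by
        have h1 : HasSum (fun m => v K j m * m) (∑ m ∈ Finset.range (K + 2), v K j m * m) :=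
          hasSum_sum_of_ne_finset_zero fun m hm => by rw [hvK K j m (by simpa using hm), zero_mul]
        rw [hvsum K j fun m x => x * m] at h1
        convert h1 using 1
        simp only [hτ]; push_cast; ring }
  have hpos0 : ∀ᶠ K in atTop, ∀ j, 0 ≤ v K j 0 ∧ (L j ≠ 0 → 0 < v K j 0) := by
    refine eventually_all.2 fun j => ?_
    by_cases hj : L j = 0
    · have hz : u j = 0 := by
        have h1 := hset.rel_eq j
        rwa [hj, hasSum_zero_iff_of_nonneg (hu0 j)] at h1
      have hh : hopCount ν j = 0 := by
        have h1 := hset.hops_eq j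
        simp only [hz, Pi.zero_apply, zero_mul] at h1
        exact h1.unique hasSum_zero
      refine .of_forall fun K => ⟨?_, fun h => absurd hj h⟩
      simp [hv0, hσ, hτ, hz, hj, hh]
    · have h1 := ((hσlim j).sub (hτlim j)).const_add (u j 0)
      simp only [sub_zero, add_zero] at h1
      filter_upwards [h1.eventually_const_lt (hpos j hj).2] with K hK
      rw [hv0]
      exact ⟨hK.le, fun _ => hK⟩
  have hT : ∀ j, Tendsto (fun K => ∑' m, typeCost θ C ψ m (v K j m)) atTop
      (𝓝 (∑' m, typeCost θ C ψ m (u j m))) := by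
    intro j
    have e : ∀ K, ∑' m, typeCost θ C ψ m (v K j m) =
        ∑ m ∈ Finset.range (K + 2), typeCost θ C ψ m (u j m) +
        (typeCost θ C ψ 1 (u j 1 + τ K j) - typeCost θ C ψ 1 (u j 1)) +
        (typeCost θ C ψ 0 (u j 0 + (σ K j - τ K j)) - typeCost θ C ψ 0 (u j 0)) +
        (1 - ∑ m ∈ Finset.range (K + 2), poissonTerm θ m) := by
      intro K
      rw [← hvsum K j (typeCost θ C ψ)]
      have h0 : ∀ m ∉ Finset.range (K + 2), typeCost θ C ψ m (v K j m) - poissonTerm θ m = 0 :=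
        fun m hm => by rw [hvK K j m (by simpa using hm), typeCost_zero, sub_self]
      have h2 := ((hasSum_sum_of_ne_finset_zero h0).add (hasSum_poissonTerm θ)).tsum_eq
      simp only [sub_add_cancel] at h2
      rw [h2, Finset.sum_sub_distrib]
      ring
    simp only [e]
    have t1 := (hsum j).hasSum.tendsto_sum_nat.comp (tendsto_add_atTop_nat 2)
    have t2 := ((hasSum_poissonTerm θ).tendsto_sum_nat.comp (tendsto_add_atTop_nat 2)).const_sub 1
    have t3 := (((continuous_typeCost (θ := θ) (C := C) (ψ := ψ) 1).tendsto (u j 1 + 0)).comp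
      ((hτlim j).const_add (u j 1))).sub_const (typeCost θ C ψ 1 (u j 1))
    have t4 := (((continuous_typeCost (θ := θ) (C := C) (ψ := ψ) 0).tendsto
      (u j 0 + (0 - 0))).comp (((hσlim j).sub (hτlim j)).const_add (u j 0))).sub_const
      (typeCost θ C ψ 0 (u j 0))
    have := ((t1.add t3).add t4).add t2
    simpa using this
  have hlim : Tendsto (fun K => discreteEnergy θ C Φ ψ L ν (v K)) atTop
      (𝓝 (discreteEnergy θ C Φ ψ L ν u)) :=
    (tendsto_finsetSum _ fun j _ => hT j).const_add _
  obtain ⟨K, h1, h2⟩ := ((hlim.eventually_lt_const hb).and hpos0).exists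
  exact ⟨v K, K, hsetK K fun j => (h2 j).1, hvK K, fun j hj => ⟨(hpos j hj).1, (h2 j).2 hj⟩, h1⟩

variable {ι : Type*} {l : Filter ι}

/-- Every discretized setting yields an asymptotic lower bound of the exponential rate of the
partition function. -/
theorem eventually_le_log_partition_div_of_lt (hk : 0 < kmax) (hθ : 0 < θ) (hC : ∀ m, C ≤ ψ m)
    (Φ : J → RoutePath kmax J → ℝ)
    {t : ι → ℝ} (ht : Tendsto t l atTop) {n : ι → ℕ} (c : ∀ i, Fin (n i) → J) {L : J → ℝ}
    (hL : ∀ j, Tendsto (fun i => (Finset.card {x | c i x = j} : ℝ) / t i) l (𝓝 (L j)))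
    (hL0 : 0 < ∑ j, L j) (hθL : 1 + Real.log (∑ j, L j) + Real.log θ = 0)
    {ν : J → RoutePath kmax J → ℝ} {u : J → ℕ → ℝ} (hset : IsDiscreteSetting L ν u)
    (hsum : ∀ j, Summable fun m => typeCost θ C ψ m (u j m)) {b : ℝ}
    (hb : discreteEnergy θ C Φ ψ L ν u < b) :
    ∀ᶠ i in l, -b ≤ Real.log (∑ s, configWeight (c i) (hopWeight (n i) Φ)
      (fun m => Real.exp (-ψ m)) s) / t i := by
  obtain ⟨ν', u', h1, h2, h3, h4⟩ := exists_positive_setting hk hθ hC Φ hset hsum hb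
  obtain ⟨u'', K, h5, h6, h7, h8⟩ := exists_truncated_setting hk Φ h1 h2 h3 h4
  exact eventually_le_log_partition_div hk hθ Φ ht c hL hL0 hθL h5 h6 h7 h8

end Approximation

/-! ### Relative entropy on finite sets and under coarse graining -/

/-- The summand of the relative entropy of finite measures on a countable set. -/
def klTerm (x c : ℝ) : ℝ := x * Real.log x - x * Real.log c - x + c

theorem klTerm_nonneg {x c : ℝ} (hx : 0 ≤ x) (hc : 0 ≤ c) (h : c = 0 → x = 0) :
    0 ≤ klTerm x c := by
  rcases hc.eq_or_lt with rfl | hc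
  · simp [klTerm, h rfl]
  · exact mul_log_sub_mul_log_nonneg hx hc

theorem mul_klFun_eq_klTerm (y c : ℝ) :
    c * InformationTheory.klFun y = klTerm (y * c) c := by
  rw [InformationTheory.klFun_apply, klTerm]
  rcases eq_or_ne c 0 with rfl | hc
  · simp
  rcases eq_or_ne y 0 with rfl | hy
  · simp
  · rw [Real.log_mul hy hc]; ring

section FiniteEntropy

open InformationTheory

variable {E α : Type*} [MeasurableSpace E] [Fintype α] [MeasurableSpace α]
  [MeasurableSingletonClass α]

theorem toReal_klDiv_fintype (ν ρ : Measure α) [IsFiniteMeasure ν] [IsFiniteMeasure ρ]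
    (h : ν ≪ ρ) : (klDiv ν ρ).toReal = ∑ a, klTerm (ν.real {a}) (ρ.real {a}) := by
  rw [toReal_klDiv_eq_integral_klFun h, integral_fintype .of_finite]
  refine Finset.sum_congr rfl fun a _ => ?_
  rw [smul_eq_mul, mul_klFun_eq_klTerm]
  congr 1
  conv_rhs => rw [← Measure.withDensity_rnDeriv_eq ν ρ h]
  rw [measureReal_def, measureReal_def, withDensity_apply _ (measurableSet_singleton a),
    lintegral_singleton, ENNReal.toReal_mul]

/-- Data processing: relative entropy does not increase under the push-forward by g. -/
theorem sum_klTerm_le_toReal_klDiv (ν ρ : Measure E) [IsFiniteMeasure ν] [IsFiniteMeasure ρ]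
    {g : E → α} (hg : Measurable g) (h : klDiv ν ρ ≠ ⊤) :
    ∑ a, klTerm (ν.real (g ⁻¹' {a})) (ρ.real (g ⁻¹' {a})) ≤ (klDiv ν ρ).toReal := by
  have hac : ν ≪ ρ := (klDiv_ne_top_iff.1 h).1
  have h1 := ENNReal.toReal_mono h (klDiv_map_le ν ρ hg)
  rw [toReal_klDiv_fintype _ _ (hac.map hg)] at h1
  simpa only [map_measureReal_apply hg (measurableSet_singleton _)] using h1

/-- If the density factors through g, coarse graining by g loses nothing, so the data processing
inequality becomes an equality. -/
theorem klDiv_withDensity_comp (ρ : Measure E) [IsFiniteMeasure ρ]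
    {g : E → α} (hg : Measurable g) (r : α → ℝ) (hr : ∀ a, 0 ≤ r a) :
    klDiv (ρ.withDensity fun x => ENNReal.ofReal (r (g x))) ρ =
      ENNReal.ofReal (∑ a, klTerm (r a * ρ.real (g ⁻¹' {a})) (ρ.real (g ⁻¹' {a}))) := by
  have hm : Measurable fun x => ENNReal.ofReal (r (g x)) :=
    (ENNReal.measurable_ofReal.comp (measurable_of_finite r)).comp hg
  have : IsFiniteMeasure (ρ.withDensity fun x => ENNReal.ofReal (r (g x))) := by
    refine isFiniteMeasure_withDensity ?_
    have h1 : ∀ x, ENNReal.ofReal (r (g x)) ≤ ENNReal.ofReal (∑ a, r a) := fun x =>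
      ENNReal.ofReal_le_ofReal (Finset.single_le_sum (fun a _ => hr a) (Finset.mem_univ (g x)))
    refine ne_of_lt (lt_of_le_of_lt (lintegral_mono h1) ?_)
    rw [lintegral_const]
    exact ENNReal.mul_lt_top ENNReal.ofReal_lt_top (measure_lt_top _ _)
  rw [klDiv_eq_lintegral_klFun_of_ac (withDensity_absolutelyContinuous _ _)]
  have h1 : ∫⁻ x, ENNReal.ofReal (klFun ((∂(ρ.withDensity fun x =>
      ENNReal.ofReal (r (g x)))/∂ρ) x).toReal) ∂ρ =
      ∫⁻ x, ENNReal.ofReal (klFun (r (g x))) ∂ρ := by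
    refine lintegral_congr_ae ?_
    filter_upwards [Measure.rnDeriv_withDensity ρ hm] with x hx
    rw [hx, ENNReal.toReal_ofReal (hr _)]
  rw [h1, ← lintegral_map (f := fun a => ENNReal.ofReal (klFun (r a))) (measurable_of_finite _) hg,
    lintegral_fintype, ENNReal.ofReal_sum_of_nonneg]
  · refine Finset.sum_congr rfl fun a _ => ?_
    rw [← mul_klFun_eq_klTerm, Measure.map_apply hg (measurableSet_singleton a), mul_comm,
      ENNReal.ofReal_mul measureReal_nonneg, ofReal_measureReal]
  · intro a _
    rw [← mul_klFun_eq_klTerm]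
    exact mul_nonneg measureReal_nonneg (klFun_nonneg (hr a))

end FiniteEntropy

/-! ### The discretized energy as a sum of relative entropies -/

section DiscreteEntropy

variable {kmax : ℕ} {J : Type*} [Fintype J] [DecidableEq J]
variable {θ C : ℝ} {ψ : ℕ → ℝ}

theorem klTerm_mul_right {x c L : ℝ} (hc : 0 < c) (h : L = 0 → x = 0) :
    klTerm x (c * L) = klTerm x c - x * Real.log L + c * (L - 1) := by
  unfold klTerm
  rcases eq_or_ne L 0 with rfl | hL
  · simp [h rfl]
  · rw [Real.log_mul hc.ne' hL]; ring

theorem typeCost_eq_klTerm (m : ℕ) (x : ℝ) :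
    typeCost θ C ψ m x = klTerm x (poissonTerm θ m) + (ψ m - C) * x := rfl

namespace IsDiscreteSetting

variable {L : J → ℝ} {ν : J → RoutePath kmax J → ℝ} {u : J → ℕ → ℝ}

theorem u_eq_zero (hset : IsDiscreteSetting L ν u) {j : J} (hj : L j = 0) (m : ℕ) : u j m = 0 := by
  have h1 := hset.rel_eq j
  rw [hj, hasSum_zero_iff_of_nonneg (hset.u_nonneg j)] at h1
  exact congrFun h1 m

theorem ν_eq_zero_of_start (hset : IsDiscreteSetting L ν u) {j : J} (hj : L j = 0)
    (p : RoutePath kmax J) : ν j p = 0 := by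
  have h1 := hset.start_eq j
  rw [hj, Finset.sum_eq_zero_iff_of_nonneg fun p _ => hset.ν_nonneg j p] at h1
  exact h1 p (Finset.mem_univ p)

theorem ν_eq_zero_of_hop (hset : IsDiscreteSetting L ν u) {j : J} {p : RoutePath kmax J} (i : Fin p.1)
    (hj : hopCount ν (p.2 i) = 0) : ν j p = 0 := by
  rw [hopCount, Finset.sum_eq_zero_iff_of_nonneg fun j' _ => Finset.sum_nonneg fun p _ =>
    mul_nonneg (hset.ν_nonneg j' p) (Nat.cast_nonneg _)] at hj
  have h2 := hj j (Finset.mem_univ _)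
  rw [Finset.sum_eq_zero_iff_of_nonneg fun p _ =>
    mul_nonneg (hset.ν_nonneg j p) (Nat.cast_nonneg _)] at h2
  have h3 := h2 p (Finset.mem_univ _)
  have h4 : p.count (p.2 i) ≠ 0 := (Finset.card_pos.2 ⟨i, by simp⟩).ne'
  simpa [h4] using h3

theorem ν_eq_zero_of_mul_prod_eq_zero (hset : IsDiscreteSetting L ν u) {j : J} {p : RoutePath kmax J}
    (h : L j * ∏ i, hopCount ν (p.2 i) = 0) : ν j p = 0 := by
  rcases mul_eq_zero.1 h with h | h
  · exact hset.ν_eq_zero_of_start h p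
  · obtain ⟨i, -, hi⟩ := Finset.prod_eq_zero_iff.1 h
    exact hset.ν_eq_zero_of_hop i hi

/-- Scaling the reference weights by `L j` changes the summands by multiples of `u j m` and of the
Poisson weights, both summable. -/
theorem summable_klTerm_iff (hset : IsDiscreteSetting L ν u) (hθ : 0 < θ) (j : J) :
    Summable (fun m => klTerm (u j m) (poissonTerm θ m * L j)) ↔
      Summable fun m => klTerm (u j m) (poissonTerm θ m) := by
  have h1 : Summable fun m => -(u j m * Real.log (L j)) + poissonTerm θ m * (L j - 1) :=
    ((hset.rel_eq j).summable.mul_right _).neg.add ((hasSum_poissonTerm θ).summable.mul_right _)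
  have h2 : ∀ m, klTerm (u j m) (poissonTerm θ m * L j) = klTerm (u j m) (poissonTerm θ m) +
      (-(u j m * Real.log (L j)) + poissonTerm θ m * (L j - 1)) := fun m => by
    rw [klTerm_mul_right (poissonTerm_pos hθ m) fun h => hset.u_eq_zero h m]; ring
  simp only [h2]
  exact ⟨fun h => by simpa using h.sub h1, fun h => h.add h1⟩

theorem tsum_klTerm (hset : IsDiscreteSetting L ν u) (hθ : 0 < θ) (j : J)
    (h : Summable fun m => klTerm (u j m) (poissonTerm θ m)) :
    ∑' m, klTerm (u j m) (poissonTerm θ m * L j) = ∑' m, klTerm (u j m) (poissonTerm θ m) -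
      L j * Real.log (L j) + (L j - 1) := by
  have h1 := ((h.hasSum.sub ((hset.rel_eq j).mul_right (Real.log (L j)))).add
    ((hasSum_poissonTerm θ).mul_right (L j - 1))).tsum_eq
  rw [one_mul] at h1
  rw [← h1]
  exact tsum_congr fun m => klTerm_mul_right (poissonTerm_pos hθ m) fun h => hset.u_eq_zero h m

/-- The logarithm of the product over relays is regrouped by cells and yields the hop entropies; the
total mass of the reference measure factors into powers of the total hop mass. -/
theorem sum_klTerm_paths (hset : IsDiscreteSetting L ν u) :
    ∑ j, ∑ p : RoutePath kmax J, klTerm (ν j p) (L j * ∏ i, hopCount ν (p.2 i)) =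
      (∑ j, ∑ p, ν j p * Real.log (ν j p)) - ∑ j, L j * Real.log (L j) -
        ∑ j, hopCount ν j * Real.log (hopCount ν j) - ∑ j, L j +
        (∑ j, L j) * ∑ κ : Fin kmax, (∑ j, hopCount ν j) ^ (κ : ℕ) := by
  have h1 : ∀ j p, klTerm (ν j p) (L j * ∏ i, hopCount ν (p.2 i)) =
      ν j p * Real.log (ν j p) - ν j p * Real.log (L j) -
        (∑ j', ν j p * (p.count j' : ℝ) * Real.log (hopCount ν j')) - ν j p +
        L j * ∏ i, hopCount ν (p.2 i) := by
    intro j p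
    unfold klTerm
    have e : ν j p * Real.log (L j * ∏ i, hopCount ν (p.2 i)) = ν j p * Real.log (L j) +
        ∑ j', ν j p * (p.count j' : ℝ) * Real.log (hopCount ν j') := by
      by_cases h0 : ν j p = 0
      · simp [h0]
      · have hL : L j ≠ 0 := fun h => h0 (hset.ν_eq_zero_of_start h p)
        have hh : ∀ i ∈ (Finset.univ : Finset (Fin p.1)), hopCount ν (p.2 i) ≠ 0 :=
          fun i _ h => h0 (hset.ν_eq_zero_of_hop i h)
        rw [Real.log_mul hL (Finset.prod_ne_zero_iff.2 hh), Real.log_prod hh, mul_add]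
        congr 1
        simp only [mul_assoc, ← Finset.mul_sum]
        congr 1
        rw [← Finset.sum_fiberwise (g := p.2)]
        refine Finset.sum_congr rfl fun j' _ => ?_
        rw [RoutePath.count, ← nsmul_eq_mul, ← Finset.sum_const]
        exact Finset.sum_congr rfl fun i hi => by rw [(Finset.mem_filter.1 hi).2]
    rw [e]; ring
  simp only [h1, Finset.sum_add_distrib, Finset.sum_sub_distrib, ← Finset.sum_mul,
    hset.start_eq]
  have h2 : ∑ j, ∑ p : RoutePath kmax J, ∑ j', ν j p * (p.count j' : ℝ) *
      Real.log (hopCount ν j') = ∑ j, hopCount ν j * Real.log (hopCount ν j) := by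
    simp only [hopCount, Finset.sum_mul]
    rw [Finset.sum_congr rfl fun j _ => Finset.sum_comm, Finset.sum_comm]
  have h3 : ∀ j, ∑ p : RoutePath kmax J, L j * ∏ i, hopCount ν (p.2 i) =
      L j * ∑ κ : Fin kmax, (∑ j, hopCount ν j) ^ (κ : ℕ) := by
    intro j
    rw [← Finset.mul_sum, Fintype.sum_sigma]
    congr 1
    refine Finset.sum_congr rfl fun κ _ => ?_
    have := Finset.prod_univ_sum (fun _ : Fin κ => (Finset.univ : Finset J))
      (fun _ j => hopCount ν j)
    rw [Fintype.piFinset_univ, Finset.prod_const, Finset.card_univ, Fintype.card_fin] at this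
    exact this.symm
  rw [h2, Finset.sum_congr rfl fun j _ => h3 j, ← Finset.sum_mul]

/-- The discretized energy in terms of relative entropies. -/
theorem discreteEnergy_eq (hset : IsDiscreteSetting L ν u) (hθ : 0 < θ) (Φ : J → RoutePath kmax J → ℝ)
    (h1 : ∀ j, Summable fun m => klTerm (u j m) (poissonTerm θ m))
    (h2 : ∀ j, Summable fun m => (ψ m - C) * u j m) :
    discreteEnergy θ C Φ ψ L ν u =
      (∑ j, ∑ p : RoutePath kmax J, klTerm (ν j p) (L j * ∏ i, hopCount ν (p.2 i))) +
      (∑ j, ∑' m, klTerm (u j m) (poissonTerm θ m * L j)) +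
      ((∑ j, L j) * (1 - ∑ κ : Fin kmax, (∑ j, hopCount ν j) ^ (κ : ℕ)) - θ * ∑ j, L j) +
      (∑ j, ∑ p, ν j p * Φ j p) + ((∑ j, ∑' m, (ψ m - C) * u j m) + C * ∑ j, L j) := by
  have e1 : ∀ j, ∑' m, typeCost θ C ψ m (u j m) =
      ∑' m, klTerm (u j m) (poissonTerm θ m) + ∑' m, (ψ m - C) * u j m := fun j =>
    (h1 j).tsum_add (h2 j)
  rw [hset.sum_klTerm_paths, Finset.sum_congr rfl fun j _ => hset.tsum_klTerm hθ j (h1 j),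
    discreteEnergy, routeEnergy, Finset.sum_congr rfl fun j _ => e1 j]
  simp only [Finset.sum_add_distrib, Finset.sum_sub_distrib, Finset.sum_const, Finset.card_univ,
    nsmul_eq_mul]
  ring

end IsDiscreteSetting

end DiscreteEntropy

/-! ### Coarse graining of admissible settings -/

section Cells

variable {E J : Type*} [MeasurableSpace E] [Fintype J] [DecidableEq J] [MeasurableSpace J]
  [DiscreteMeasurableSpace J]

/-- The cells of the points of a trajectory. -/
def cellOf (c : E → J) (κ : ℕ) (x : Fin (κ + 1) → E) : J × (Fin κ → J) :=
  (c (x 0), fun l => c (x l.succ))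

theorem measurable_cellOf {c : E → J} (hc : Measurable c) (κ : ℕ) : Measurable (cellOf c κ) := by
  unfold cellOf; fun_prop

theorem sum_measureReal_fiber_mul {α : Type*} [Fintype α] [MeasurableSpace α]
    [MeasurableSingletonClass α] (m : Measure E) [IsFiniteMeasure m] {g : E → α}
    (hg : Measurable g) (w : α → ℝ) :
    ∑ a, m.real (g ⁻¹' {a}) * w a = ∫ x, w (g x) ∂m := by
  rw [← integral_map hg.aemeasurable (measurable_of_finite w).aestronglyMeasurable,
    integral_fintype .of_finite]
  exact Finset.sum_congr rfl fun a _ => by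
    rw [map_measureReal_apply hg (measurableSet_singleton a), smul_eq_mul]

/-- The fibres are boxes, on which the reference measures μ ⊗ M^κ are explicit products. -/
theorem cellOf_preimage (c : E → J) (κ : ℕ) (y : J × (Fin κ → J)) :
    cellOf c κ ⁻¹' {y} = Set.univ.pi
      (Fin.cons (α := fun _ => Set E) (c ⁻¹' {y.1}) fun l => c ⁻¹' {y.2 l}) := by
  ext x
  simp only [Set.mem_preimage, Set.mem_singleton_iff, cellOf, Set.mem_pi, Set.mem_univ,
    true_implies, Fin.forall_fin_succ, Fin.cons_zero, Fin.cons_succ, Prod.ext_iff, funext_iff]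

instance isFiniteMeasure_cons (μ M : Measure E) [IsFiniteMeasure μ] [IsFiniteMeasure M] (κ : ℕ)
    (i : Fin (κ + 1)) :
    IsFiniteMeasure ((Fin.cons μ fun _ : Fin κ => M : Fin (κ + 1) → Measure E) i) := by
  refine Fin.cases ?_ (fun i => ?_) i
  · rw [Fin.cons_zero]; infer_instance
  · rw [Fin.cons_succ]; infer_instance

theorem pi_cons_real_pi (μ M : Measure E) [IsFiniteMeasure μ] [IsFiniteMeasure M] (κ : ℕ)
    (A : Set E) (B : Fin κ → Set E) :
    (Measure.pi (Fin.cons μ fun _ : Fin κ => M : Fin (κ + 1) → Measure E)).real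
      (Set.univ.pi (Fin.cons (α := fun _ => Set E) A B)) = μ.real A * ∏ l, M.real (B l) := by
  rw [measureReal_def, Measure.pi_pi, Fin.prod_univ_succ, ENNReal.toReal_mul, ENNReal.toReal_prod]
  rfl

theorem pi_cons_real_cellOf (μ M : Measure E) [IsFiniteMeasure μ] [IsFiniteMeasure M]
    (c : E → J) (κ : ℕ) (y : J × (Fin κ → J)) :
    (Measure.pi (Fin.cons μ fun _ : Fin κ => M : Fin (κ + 1) → Measure E)).real
      (cellOf c κ ⁻¹' {y}) = μ.real (c ⁻¹' {y.1}) * ∏ l, M.real (c ⁻¹' {y.2 l}) := by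
  rw [cellOf_preimage, pi_cons_real_pi]

end Cells

namespace AdmissibleSetting

variable {d : ℕ} {W : Set (EuclideanSpace ℝ (Fin d))} {μ : FiniteMeasure W} {kmax : ℕ}
  (Ψ : AdmissibleSetting μ kmax)

theorem hopMeasure_eq : Ψ.hopMeasure = ∑ κ : Fin kmax, ∑ l : Fin (κ : ℕ),
    Measure.map (fun x => x l.succ) (Ψ.ν κ : Measure (Fin (κ + 1 : ℕ) → W)) := Ψ.hops_eq

/-- Not visible from ∑ m μ_m, but clear from the other side of the hop constraint, which has
finitely many finite marginals. -/
instance : IsFiniteMeasure Ψ.hopMeasure := by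
  rw [hopMeasure_eq]; infer_instance

theorem tsum_rel_univ : ∑' m, (Ψ.rel m : Measure W) Set.univ = (μ : Measure W) Set.univ := by
  conv_rhs => rw [← Ψ.rel_eq]
  rw [Measure.sum_apply _ MeasurableSet.univ]

theorem tsum_negPart_ne_top {η : ℕ → ℝ} {Cη : ℝ} (hη : ∀ m, Cη ≤ η m) :
    ∑' m, ENNReal.ofReal (-η m) * (Ψ.rel m : Measure W) Set.univ ≠ ⊤ := by
  have h1 : ∑' m, ENNReal.ofReal (-η m) * (Ψ.rel m : Measure W) Set.univ ≤
      ENNReal.ofReal (-Cη) * (μ : Measure W) Set.univ := by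
    rw [← Ψ.tsum_rel_univ, ← ENNReal.tsum_mul_left]
    exact ENNReal.tsum_le_tsum fun m =>
      mul_le_mul_left (ENNReal.ofReal_le_ofReal (neg_le_neg (hη m))) _
  exact ne_of_lt (h1.trans_lt (ENNReal.mul_lt_top ENNReal.ofReal_lt_top (measure_lt_top _ _)))

/-- The sum of the relative entropies of the trajectory measures. -/
def routeEntropy : ℝ≥0∞ := ∑ κ : Fin kmax,
      InformationTheory.klDiv (Ψ.ν κ : Measure (Fin (κ + 1 : ℕ) → W))
        (Measure.pi (Fin.cons (μ : Measure W) fun _ : Fin (κ : ℕ) => Ψ.hopMeasure))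

/-- The sum of the relative entropies of the relay measures. -/
def relayEntropy : ℝ≥0∞ := ∑' m : ℕ, InformationTheory.klDiv (Ψ.rel m : Measure W)
        (ENNReal.ofReal (poissonWeight μ m) • (μ : Measure W))

variable {f : (κ : Fin kmax) → FiniteMeasure W × (Fin (κ + 1 : ℕ) → W) → ℝ}
  {η : ℕ → ℝ} {γ β : ℝ}

theorem freeEnergy_eq_coe (h1 : Ψ.routeEntropy ≠ ⊤) (h2 : Ψ.relayEntropy ≠ ⊤)
    (hP : ∑' m, ENNReal.ofReal (η m) * (Ψ.rel m : Measure W) Set.univ ≠ ⊤)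
    (hN : ∑' m, ENNReal.ofReal (-η m) * (Ψ.rel m : Measure W) Set.univ ≠ ⊤) :
    Ψ.freeEnergy f η γ β = ((Ψ.routeEntropy.toReal + Ψ.relayEntropy.toReal +
      ((μ.mass : ℝ) * (1 - ∑ κ : Fin kmax, Ψ.hopMeasure.real Set.univ ^ (κ : ℕ)) -
      1 / Real.exp 1) + γ * Ψ.interference f +
      β * ((∑' m, ENNReal.ofReal (η m) * (Ψ.rel m : Measure W) Set.univ).toReal -
        (∑' m, ENNReal.ofReal (-η m) * (Ψ.rel m : Measure W) Set.univ).toReal) : ℝ) : EReal) := by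
  unfold freeEnergy entropy congestion
  change (Ψ.routeEntropy : EReal) + (Ψ.relayEntropy : EReal) + _ + _ + _ = _
  rw [← EReal.coe_ennreal_toReal h1, ← EReal.coe_ennreal_toReal h2, ← EReal.coe_ennreal_toReal hP,
    ← EReal.coe_ennreal_toReal hN]
  push_cast
  rfl

/-- No summand equals ⊥, the negative congestion part being finite, so one infinite summand would
make the whole sum infinite. -/
theorem ne_top_of_freeEnergy_ne_top (hβ : 0 < β) (h : Ψ.freeEnergy f η γ β ≠ ⊤)
    (hN : ∑' m, ENNReal.ofReal (-η m) * (Ψ.rel m : Measure W) Set.univ ≠ ⊤) :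
    Ψ.routeEntropy ≠ ⊤ ∧ Ψ.relayEntropy ≠ ⊤ ∧
      ∑' m, ENNReal.ofReal (η m) * (Ψ.rel m : Measure W) Set.univ ≠ ⊤ := by
  unfold freeEnergy entropy congestion at h
  change (Ψ.routeEntropy : EReal) + (Ψ.relayEntropy : EReal) + _ + _ + _ ≠ _ at h
  rw [← EReal.coe_ennreal_toReal hN] at h
  set cst : ℝ := ((μ.mass : ℝ) * (1 - ∑ κ : Fin kmax, Ψ.hopMeasure.real Set.univ ^ (κ : ℕ)) -
      1 / Real.exp 1 : ℝ)
  set A := Ψ.routeEntropy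
  set B := Ψ.relayEntropy
  set P := ∑' m, ENNReal.ofReal (η m) * (Ψ.rel m : Measure W) Set.univ
  set n := (∑' m, ENNReal.ofReal (-η m) * (Ψ.rel m : Measure W) Set.univ).toReal
  have hlast : (β : EReal) * ((P : EReal) - (n : EReal)) ≠ ⊥ := by
    by_cases hP : P = ⊤
    · rw [hP, EReal.coe_ennreal_top, EReal.top_sub_coe, EReal.coe_mul_top_of_pos hβ]
      exact bot_ne_top.symm
    · rw [← EReal.coe_ennreal_toReal hP, ← EReal.coe_sub, ← EReal.coe_mul]
      exact EReal.coe_ne_bot _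
  refine ⟨fun hA => h ?_, fun hB => h ?_, fun hP => h ?_⟩
  · rw [hA, EReal.coe_ennreal_top, EReal.top_add_of_ne_bot (EReal.coe_ennreal_ne_bot _),
      EReal.top_add_of_ne_bot (EReal.coe_ne_bot _), EReal.top_add_of_ne_bot (EReal.coe_ne_bot _),
      EReal.top_add_of_ne_bot hlast]
  · rw [hB, EReal.coe_ennreal_top, EReal.add_top_of_ne_bot (EReal.coe_ennreal_ne_bot _),
      EReal.top_add_of_ne_bot (EReal.coe_ne_bot _), EReal.top_add_of_ne_bot (EReal.coe_ne_bot _),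
      EReal.top_add_of_ne_bot hlast]
  · rw [hP, EReal.coe_ennreal_top, EReal.top_sub_coe, EReal.coe_mul_top_of_pos hβ]
    refine EReal.add_top_of_ne_bot ?_
    simp only [ne_eq, EReal.add_eq_bot_iff, EReal.coe_ennreal_ne_bot, EReal.coe_ne_bot, or_self,
      not_false_eq_true]

theorem hasSum_congestion
    (hP : ∑' m, ENNReal.ofReal (η m) * (Ψ.rel m : Measure W) Set.univ ≠ ⊤)
    (hN : ∑' m, ENNReal.ofReal (-η m) * (Ψ.rel m : Measure W) Set.univ ≠ ⊤) :
    HasSum (fun m => η m * (Ψ.rel m : Measure W).real Set.univ)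
      ((∑' m, ENNReal.ofReal (η m) * (Ψ.rel m : Measure W) Set.univ).toReal -
        (∑' m, ENNReal.ofReal (-η m) * (Ψ.rel m : Measure W) Set.univ).toReal) := by
  have h1 := (ENNReal.hasSum_toReal hP).sub (ENNReal.hasSum_toReal hN)
  rw [← ENNReal.tsum_toReal_eq (fun m => ENNReal.ne_top_of_tsum_ne_top hP m),
    ← ENNReal.tsum_toReal_eq (fun m => ENNReal.ne_top_of_tsum_ne_top hN m)] at h1
  refine h1.congr_fun fun m => ?_
  simp only [ENNReal.toReal_mul, ENNReal.toReal_ofReal', measureReal_def]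
  rw [← sub_mul]
  congr 1
  rcases le_total 0 (η m) with h | h
  · rw [max_eq_left h, max_eq_right (by linarith), sub_zero]
  · rw [max_eq_right h, max_eq_left (by linarith)]; ring

variable {J : Type*} [Fintype J] [DecidableEq J] [MeasurableSpace J] [DiscreteMeasurableSpace J]
  (c : W → J)

/-- The masses of the trajectories through given cells. -/
def cellMass (j : J) (p : RoutePath kmax J) : ℝ :=
  (Ψ.ν p.1 : Measure (Fin (p.1 + 1 : ℕ) → W)).real (cellOf c p.1 ⁻¹' {(j, p.2)})

variable {c}

theorem sum_cellMass_mul (hc : Measurable c) (G : J → RoutePath kmax J → ℝ) :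
    ∑ j, ∑ p, Ψ.cellMass c j p * G j p = ∑ κ : Fin kmax,
      ∫ x, G (c (x 0)) ⟨κ, fun l => c (x l.succ)⟩ ∂(Ψ.ν κ : Measure (Fin (κ + 1 : ℕ) → W)) := by
  simp only [Fintype.sum_sigma]
  rw [Finset.sum_comm]
  refine Finset.sum_congr rfl fun κ _ => ?_
  refine Eq.trans ?_ (sum_measureReal_fiber_mul (Ψ.ν κ : Measure (Fin (κ + 1 : ℕ) → W))
    (measurable_cellOf hc κ) (fun y => G y.1 ⟨κ, y.2⟩))
  rw [Fintype.sum_prod_type]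
  rfl

/-- The constraints are identities of measures on W; the discrete ones are their values on the
cells. -/
theorem isDiscreteSetting_cellMass (hc : Measurable c) :
    IsDiscreteSetting (fun j => (μ : Measure W).real (c ⁻¹' {j})) (Ψ.cellMass c)
      (fun j m => (Ψ.rel m : Measure W).real (c ⁻¹' {j})) where
  ν_nonneg j p := measureReal_nonneg
  u_nonneg j m := measureReal_nonneg
  start_eq j := by
    have h1 := Ψ.sum_cellMass_mul hc fun j' _ => if j' = j then 1 else 0
    simp only [mul_ite, mul_one, mul_zero] at h1
    rw [Finset.sum_comm] at h1
    simp only [Finset.sum_ite_eq', Finset.mem_univ, if_true] at h1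
    rw [h1]
    conv_rhs => rw [← Ψ.start_eq]
    have hm : MeasurableSet (c ⁻¹' {j}) := hc (measurableSet_singleton j)
    rw [measureReal_def, Measure.finsetSum_apply _ _ _, ENNReal.toReal_sum fun _ _ =>
      measure_ne_top _ _]
    refine Finset.sum_congr rfl fun κ _ => ?_
    rw [Measure.map_apply (measurable_pi_apply 0) hm, ← measureReal_def,
      ← integral_indicator_one ((measurable_pi_apply 0) hm)]
    refine integral_congr_ae (.of_forall fun x => ?_)
    by_cases h : c (x 0) = j
    · exact (if_pos h).trans (Set.indicator_of_mem (s := (fun x : Fin (κ + 1 : ℕ) → W => x 0) ⁻¹' (c ⁻¹' {j})) h 1).symm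
    · exact (if_neg h).trans
        (Set.indicator_of_notMem (s := (fun x : Fin (κ + 1 : ℕ) → W => x 0) ⁻¹' (c ⁻¹' {j})) h 1).symm
  rel_eq j := by
    have hm : MeasurableSet (c ⁻¹' {j}) := hc (measurableSet_singleton j)
    have h1 : ∑' m, (Ψ.rel m : Measure W) (c ⁻¹' {j}) = (μ : Measure W) (c ⁻¹' {j}) := by
      conv_rhs => rw [← Ψ.rel_eq]
      rw [Measure.sum_apply _ hm]
    have h2 := ENNReal.hasSum_toReal (h1 ▸ measure_ne_top _ _)
    rwa [← ENNReal.tsum_toReal_eq fun m => measure_ne_top _ _, h1] at h2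
  hops_eq j := by
    have hm : MeasurableSet (c ⁻¹' {j}) := hc (measurableSet_singleton j)
    have h1 : ∑' m : ℕ, (m : ℝ≥0∞) * (Ψ.rel m : Measure W) (c ⁻¹' {j}) =
        Ψ.hopMeasure (c ⁻¹' {j}) := by
      rw [hopMeasure, Measure.sum_apply _ hm]
      rfl
    have h2 := ENNReal.hasSum_toReal (h1 ▸ measure_ne_top _ _)
    rw [← ENNReal.tsum_toReal_eq fun m => ENNReal.mul_ne_top (ENNReal.natCast_ne_top m)
      (measure_ne_top _ _), h1] at h2
    have h3 : hopCount (Ψ.cellMass c) j = (Ψ.hopMeasure (c ⁻¹' {j})).toReal := by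
      rw [hopCount, Ψ.sum_cellMass_mul hc fun _ p => (p.count j : ℝ), hopMeasure_eq,
        Measure.finsetSum_apply, ENNReal.toReal_sum fun _ _ => measure_ne_top _ _]
      refine Finset.sum_congr rfl fun κ _ => ?_
      rw [Measure.finsetSum_apply, ENNReal.toReal_sum fun _ _ => measure_ne_top _ _]
      have h4 : ∀ l : Fin κ, (Measure.map (fun x => x l.succ)
          (Ψ.ν κ : Measure (Fin (κ + 1 : ℕ) → W)) (c ⁻¹' {j})).toReal =
          ∫ x, ((fun x : Fin (κ + 1 : ℕ) → W => x l.succ) ⁻¹' (c ⁻¹' {j})).indicator 1 x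
            ∂(Ψ.ν κ : Measure (Fin (κ + 1 : ℕ) → W)) := fun l => by
        rw [Measure.map_apply (measurable_pi_apply l.succ) hm, ← measureReal_def,
          ← integral_indicator_one ((measurable_pi_apply l.succ) hm)]
      rw [Finset.sum_congr rfl fun l _ => h4 l, ← integral_finsetSum]
      · refine integral_congr_ae (.of_forall fun x => ?_)
        change (Finset.card {l : Fin κ | c (x l.succ) = j} : ℝ) = _
        rw [Finset.card_filter]
        push_cast
        refine Finset.sum_congr rfl fun l _ => ?_
        by_cases h : c (x l.succ) = j
        · exact (if_pos h).trans
            (Set.indicator_of_mem (s := (fun x : Fin (κ + 1 : ℕ) → W => x l.succ) ⁻¹' (c ⁻¹' {j})) h 1).symm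
        · exact (if_neg h).trans
            (Set.indicator_of_notMem (s := (fun x : Fin (κ + 1 : ℕ) → W => x l.succ) ⁻¹' (c ⁻¹' {j})) h 1).symm
      · intro l _
        exact (integrable_const 1).indicator ((measurable_pi_apply _) hm)
    rw [h3]
    refine h2.congr_fun fun m => ?_
    rw [ENNReal.toReal_mul, ENNReal.toReal_natCast, mul_comm, measureReal_def]

theorem hopCount_cellMass (hc : Measurable c) (j : J) :
    hopCount (Ψ.cellMass c) j = Ψ.hopMeasure.real (c ⁻¹' {j}) := by
  have hm : MeasurableSet (c ⁻¹' {j}) := hc (measurableSet_singleton j)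
  have h1 := ((Ψ.isDiscreteSetting_cellMass hc).hops_eq j).tsum_eq
  rw [← h1, measureReal_def, hopMeasure, Measure.sum_apply _ hm, ENNReal.tsum_toReal_eq]
  · refine tsum_congr fun m => ?_
    rw [Measure.smul_apply, smul_eq_mul, ENNReal.toReal_mul, ENNReal.toReal_natCast, mul_comm,
      measureReal_def]
  · intro m
    rw [Measure.smul_apply, smul_eq_mul]
    exact ENNReal.mul_ne_top (ENNReal.natCast_ne_top m) (measure_ne_top _ _)

theorem sum_measureReal_fiber (m : Measure W) [IsFiniteMeasure m] (hc : Measurable c) :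
    ∑ j, m.real (c ⁻¹' {j}) = m.real Set.univ := by
  have := sum_measureReal_fiber_mul m hc fun _ => (1 : ℝ)
  simpa using this

/-- By the start constraint the trajectory measures have total mass μ(W), so a uniform error ε
integrates to at most ε μ(W). -/
theorem abs_interference_sub_le (hc : Measurable c) (Φ : J → RoutePath kmax J → ℝ) {ε : ℝ}
    (hΦ : ∀ (κ : Fin kmax) (x : Fin (κ + 1 : ℕ) → W),
      |γ * f κ (μ, x) - Φ (c (x 0)) ⟨κ, fun l => c (x l.succ)⟩| ≤ ε)
    (hf : ∀ κ, Integrable (fun x => f κ (μ, x)) (Ψ.ν κ : Measure (Fin (κ + 1 : ℕ) → W))) :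
    |γ * Ψ.interference f - ∑ j, ∑ p, Ψ.cellMass c j p * Φ j p| ≤ ε * μ.mass := by
  rw [Ψ.sum_cellMass_mul hc, interference, Finset.mul_sum, ← Finset.sum_sub_distrib]
  have h1 : (μ.mass : ℝ) = ∑ κ : Fin kmax,
      (Ψ.ν κ : Measure (Fin (κ + 1 : ℕ) → W)).real Set.univ := by
    have h2 : (μ : Measure W) Set.univ = ∑ κ : Fin kmax,
        (Ψ.ν κ : Measure (Fin (κ + 1 : ℕ) → W)) Set.univ := by
      conv_lhs => rw [← Ψ.start_eq]
      rw [Measure.finsetSum_apply]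
      exact Finset.sum_congr rfl fun κ _ => by
        rw [Measure.map_apply (measurable_pi_apply 0) MeasurableSet.univ, Set.preimage_univ]
    have h3 := congrArg ENNReal.toReal h2
    rw [ENNReal.toReal_sum fun _ _ => measure_ne_top _ _] at h3
    exact h3
  rw [h1, Finset.mul_sum]
  refine (Finset.abs_sum_le_sum_abs _ _).trans (Finset.sum_le_sum fun κ _ => ?_)
  have hi : Integrable (fun x : Fin (κ + 1 : ℕ) → W => Φ (c (x 0)) ⟨κ, fun l => c (x l.succ)⟩)
      (Ψ.ν κ : Measure (Fin (κ + 1 : ℕ) → W)) := by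
    have h2 : Integrable (fun y : J × (Fin κ → J) => Φ y.1 ⟨κ, y.2⟩)
        (Measure.map (cellOf c κ) (Ψ.ν κ : Measure (Fin (κ + 1 : ℕ) → W))) := .of_finite
    exact h2.comp_measurable (measurable_cellOf hc κ)
  rw [← integral_const_mul, ← integral_sub ((hf κ).const_mul γ) hi]
  rw [← Real.norm_eq_abs]
  exact norm_integral_le_of_norm_le_const (.of_forall fun x => hΦ κ x)

end AdmissibleSetting

namespace AdmissibleSetting

variable {d : ℕ} {W : Set (EuclideanSpace ℝ (Fin d))} {μ : FiniteMeasure W} {kmax : ℕ}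
  (Ψ : AdmissibleSetting μ kmax)
variable {f : (κ : Fin kmax) → FiniteMeasure W × (Fin (κ + 1 : ℕ) → W) → ℝ}
  {η : ℕ → ℝ} {γ β : ℝ}
variable {J : Type*} [Fintype J] [DecidableEq J] [MeasurableSpace J] [DiscreteMeasurableSpace J]
  {c : W → J}

/-- Data processing for the cell map, applied for every number of relays. -/
theorem sum_klTerm_cellMass_le (hc : Measurable c) (h : Ψ.routeEntropy ≠ ⊤) :
    ∑ j, ∑ p : RoutePath kmax J, klTerm (Ψ.cellMass c j p)
      ((μ : Measure W).real (c ⁻¹' {j}) * ∏ i, hopCount (Ψ.cellMass c) (p.2 i)) ≤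
      Ψ.routeEntropy.toReal := by
  have h0 : ∀ κ ∈ (Finset.univ : Finset (Fin kmax)), InformationTheory.klDiv
      (Ψ.ν κ : Measure (Fin (κ + 1 : ℕ) → W))
      (Measure.pi (Fin.cons (μ : Measure W) fun _ : Fin (κ : ℕ) => Ψ.hopMeasure)) ≠ ⊤ :=
    ENNReal.sum_ne_top.1 h
  rw [routeEntropy, ENNReal.toReal_sum h0]
  simp only [Fintype.sum_sigma]
  rw [Finset.sum_comm]
  refine Finset.sum_le_sum fun κ hκ => le_trans (le_of_eq ?_)
    (sum_klTerm_le_toReal_klDiv _ _ (measurable_cellOf hc κ) (h0 κ hκ))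
  rw [Fintype.sum_prod_type]
  refine Finset.sum_congr rfl fun j _ => Finset.sum_congr rfl fun q _ => ?_
  rw [pi_cons_real_cellOf]
  simp only [Ψ.hopCount_cellMass hc]
  rfl

theorem poissonWeight_eq (μ : FiniteMeasure W) (m : ℕ) :
    poissonWeight μ m = poissonTerm (1 / (Real.exp 1 * (μ.mass : ℝ))) m := rfl

theorem real_poissonWeight_smul (μ : FiniteMeasure W) (m : ℕ) (A : Set W) :
    (ENNReal.ofReal (poissonWeight μ m) • (μ : Measure W)).real A =
      poissonWeight μ m * (μ : Measure W).real A := by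
  rw [measureReal_def, Measure.smul_apply, smul_eq_mul, ENNReal.toReal_mul,
    ENNReal.toReal_ofReal, measureReal_def]
  rw [poissonWeight]; positivity

theorem sum_klTerm_rel_le (hc : Measurable c) (h : Ψ.relayEntropy ≠ ⊤) (hμ : 0 < μ.mass) :
    (∀ j, Summable fun m => klTerm ((Ψ.rel m : Measure W).real (c ⁻¹' {j}))
      (poissonWeight μ m * (μ : Measure W).real (c ⁻¹' {j}))) ∧
    ∑ j, ∑' m, klTerm ((Ψ.rel m : Measure W).real (c ⁻¹' {j}))
      (poissonWeight μ m * (μ : Measure W).real (c ⁻¹' {j})) ≤ Ψ.relayEntropy.toReal := by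
  have hμ' : (0 : ℝ) < μ.mass := by exact_mod_cast hμ
  have h0 : ∀ m, InformationTheory.klDiv (Ψ.rel m : Measure W)
      (ENNReal.ofReal (poissonWeight μ m) • (μ : Measure W)) ≠ ⊤ :=
    fun m => ENNReal.ne_top_of_tsum_ne_top h m
  have hfin : ∀ m, IsFiniteMeasure (ENNReal.ofReal (poissonWeight μ m) • (μ : Measure W)) :=
    fun m => (μ : Measure W).smul_finite ENNReal.ofReal_ne_top
  have hle : ∀ m, ∑ j, klTerm ((Ψ.rel m : Measure W).real (c ⁻¹' {j}))
      (poissonWeight μ m * (μ : Measure W).real (c ⁻¹' {j})) ≤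
      (InformationTheory.klDiv (Ψ.rel m : Measure W)
        (ENNReal.ofReal (poissonWeight μ m) • (μ : Measure W))).toReal := fun m => by
    have := sum_klTerm_le_toReal_klDiv _ _ hc (h0 m)
    simpa only [real_poissonWeight_smul] using this
  have hdisc := Ψ.isDiscreteSetting_cellMass hc
  have hpw : ∀ m, 0 < poissonWeight μ m := fun m => by
    rw [poissonWeight_eq]; exact poissonTerm_pos (by positivity) m
  have hnn : ∀ j m, 0 ≤ klTerm ((Ψ.rel m : Measure W).real (c ⁻¹' {j}))
      (poissonWeight μ m * (μ : Measure W).real (c ⁻¹' {j})) := fun j m =>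
    klTerm_nonneg measureReal_nonneg (mul_nonneg (hpw m).le measureReal_nonneg) fun h0 =>
      hdisc.u_eq_zero ((mul_eq_zero.1 h0).resolve_left (hpw m).ne') m
  have hs := ENNReal.hasSum_toReal h
  have hsum : ∀ j, Summable fun m => klTerm ((Ψ.rel m : Measure W).real (c ⁻¹' {j}))
      (poissonWeight μ m * (μ : Measure W).real (c ⁻¹' {j})) := fun j =>
    Summable.of_nonneg_of_le (hnn j) (fun m => (Finset.single_le_sum (fun j _ => hnn j m)
      (Finset.mem_univ j)).trans (hle m)) hs.summable
  refine ⟨hsum, ?_⟩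
  rw [relayEntropy, ENNReal.tsum_toReal_eq h0, ← Summable.tsum_finsetSum fun j _ => hsum j]
  exact (summable_sum fun j _ => hsum j).tsum_le_tsum hle hs.summable

/-- Discretization of an admissible setting of finite free energy. -/
theorem discreteEnergy_cellMass_le (hc : Measurable c) (hμ : 0 < μ.mass) (hβ : 0 < β)
    (Φ : J → RoutePath kmax J → ℝ) {ε Cη : ℝ} (hη : ∀ m, Cη ≤ η m)
    (hΦ : ∀ (κ : Fin kmax) (x : Fin (κ + 1 : ℕ) → W),
      |γ * f κ (μ, x) - Φ (c (x 0)) ⟨κ, fun l => c (x l.succ)⟩| ≤ ε)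
    (hf : ∀ κ, Integrable (fun x => f κ (μ, x)) (Ψ.ν κ : Measure (Fin (κ + 1 : ℕ) → W)))
    (h : Ψ.freeEnergy f η γ β ≠ ⊤) :
    (∀ j, Summable fun m => typeCost (1 / (Real.exp 1 * (μ.mass : ℝ))) (β * Cη)
      (fun m => β * η m) m ((Ψ.rel m : Measure W).real (c ⁻¹' {j}))) ∧
    ((discreteEnergy (1 / (Real.exp 1 * (μ.mass : ℝ))) (β * Cη) Φ (fun m => β * η m)
      (fun j => (μ : Measure W).real (c ⁻¹' {j})) (Ψ.cellMass c)
      (fun j m => (Ψ.rel m : Measure W).real (c ⁻¹' {j})) - ε * μ.mass : ℝ) : EReal) ≤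
      Ψ.freeEnergy f η γ β := by
  have hμ' : (0 : ℝ) < μ.mass := by exact_mod_cast hμ
  set θ := 1 / (Real.exp 1 * (μ.mass : ℝ)) with hθdef
  have hθ : 0 < θ := by positivity
  have hN := Ψ.tsum_negPart_ne_top hη
  obtain ⟨h1, h2, hP⟩ := Ψ.ne_top_of_freeEnergy_ne_top hβ h hN
  have hdisc := Ψ.isDiscreteSetting_cellMass hc
  obtain ⟨hs, hrel⟩ := Ψ.sum_klTerm_rel_le hc h2 hμ
  simp only [poissonWeight_eq, ← hθdef] at hs hrel
  have hs1 := fun j => (hdisc.summable_klTerm_iff hθ j).1 (hs j)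
  have hcong := Ψ.hasSum_congestion hP hN
  have huniv : ∀ m, ∑ j, (Ψ.rel m : Measure W).real (c ⁻¹' {j}) =
      (Ψ.rel m : Measure W).real Set.univ := fun m => sum_measureReal_fiber _ hc
  have hLsum : ∑ j, (μ : Measure W).real (c ⁻¹' {j}) = μ.mass := sum_measureReal_fiber _ hc
  have htot : HasSum (fun m => (Ψ.rel m : Measure W).real Set.univ) (μ.mass : ℝ) := by
    rw [← hLsum]
    simp only [← huniv]
    exact hasSum_sum fun j _ => hdisc.rel_eq j
  have hcong2 : HasSum (fun m => (β * η m - β * Cη) * (Ψ.rel m : Measure W).real Set.univ) _ :=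
    ((hcong.sub (htot.mul_left Cη)).mul_left β).congr_fun fun m => by ring
  -- Subtracting the lower bound of η makes the terms nonnegative, so summability passes from W to
  -- each cell.
  have hs2 : ∀ j, Summable fun m => (β * η m - β * Cη) * (Ψ.rel m : Measure W).real (c ⁻¹' {j}) :=
    fun j => Summable.of_nonneg_of_le
      (fun m => mul_nonneg (by nlinarith [hη m]) measureReal_nonneg)
      (fun m => mul_le_mul_of_nonneg_left (measureReal_mono (Set.subset_univ _))
        (by nlinarith [hη m])) hcong2.summable
  have hs2sum : ∑ j, ∑' m, (β * η m - β * Cη) * (Ψ.rel m : Measure W).real (c ⁻¹' {j}) =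
      ∑' m, (β * η m - β * Cη) * (Ψ.rel m : Measure W).real Set.univ := by
    rw [← Summable.tsum_finsetSum fun j _ => hs2 j]
    simp only [← Finset.mul_sum, huniv]
  refine ⟨fun j => (hs1 j).add (hs2 j), ?_⟩
  rw [Ψ.freeEnergy_eq_coe h1 h2 hP hN, EReal.coe_le_coe_iff,
    hdisc.discreteEnergy_eq hθ Φ hs1 hs2, hs2sum, hcong2.tsum_eq, hLsum]
  have hroute := Ψ.sum_klTerm_cellMass_le hc h1
  have hhop : ∑ j, hopCount (Ψ.cellMass c) j = Ψ.hopMeasure.real Set.univ := by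
    simp only [Ψ.hopCount_cellMass hc]
    exact sum_measureReal_fiber _ hc
  have hint := Ψ.abs_interference_sub_le hc Φ hΦ hf
  have hθm : θ * μ.mass = 1 / Real.exp 1 := by rw [hθdef]; field_simp
  rw [hhop, hθm]
  have := (abs_le.1 hint).1
  linarith

end AdmissibleSetting

/-! ### Lifting discrete settings by densities constant on cells -/

section StepDensity

variable {E α : Type*} [MeasurableSpace E] [Fintype α] [MeasurableSpace α]
  [MeasurableSingletonClass α]

/-- The measure with density `r ∘ g`. -/
def stepMeasure (ρ : Measure E) (g : E → α) (r : α → ℝ) : Measure E :=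
  ρ.withDensity fun x => ENNReal.ofReal (r (g x))

theorem stepMeasure_apply (ρ : Measure E) {g : E → α} (hg : Measurable g) (r : α → ℝ) {B : Set E}
    (hB : MeasurableSet B) :
    stepMeasure ρ g r B = ∑ a, ENNReal.ofReal (r a) * ρ (g ⁻¹' {a} ∩ B) := by
  rw [stepMeasure, withDensity_apply _ hB,
    ← lintegral_map (f := fun a => ENNReal.ofReal (r a)) (measurable_of_finite _) hg,
    lintegral_fintype]
  refine Finset.sum_congr rfl fun a _ => ?_
  rw [Measure.map_apply hg (measurableSet_singleton a),
    Measure.restrict_apply (hg (measurableSet_singleton a))]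

theorem isFiniteMeasure_stepMeasure (ρ : Measure E) [IsFiniteMeasure ρ] {g : E → α}
    (hg : Measurable g) (r : α → ℝ) : IsFiniteMeasure (stepMeasure ρ g r) := by
  refine ⟨?_⟩
  rw [stepMeasure_apply ρ hg r MeasurableSet.univ]
  exact ENNReal.sum_lt_top.2 fun a _ =>
    ENNReal.mul_lt_top ENNReal.ofReal_lt_top (measure_lt_top _ _)

theorem stepMeasure_real (ρ : Measure E) [IsFiniteMeasure ρ] {g : E → α} (hg : Measurable g)
    {r : α → ℝ} (hr : ∀ a, 0 ≤ r a) {B : Set E} (hB : MeasurableSet B) :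
    (stepMeasure ρ g r).real B = ∑ a, r a * ρ.real (g ⁻¹' {a} ∩ B) := by
  rw [measureReal_def, stepMeasure_apply ρ hg r hB, ENNReal.toReal_sum fun a _ =>
    ENNReal.mul_ne_top ENNReal.ofReal_ne_top (measure_ne_top _ _)]
  exact Finset.sum_congr rfl fun a _ => by
    rw [ENNReal.toReal_mul, ENNReal.toReal_ofReal (hr a), measureReal_def]

theorem stepMeasure_real_fiber (ρ : Measure E) [IsFiniteMeasure ρ] {g : E → α} (hg : Measurable g)
    {r : α → ℝ} (hr : ∀ a, 0 ≤ r a) (b : α) :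
    (stepMeasure ρ g r).real (g ⁻¹' {b}) = r b * ρ.real (g ⁻¹' {b}) := by
  rw [stepMeasure_real ρ hg hr (hg (measurableSet_singleton b)), Finset.sum_eq_single b]
  · rw [Set.inter_self]
  · intro a _ hab
    have : g ⁻¹' {a} ∩ g ⁻¹' {b} = ∅ := by
      ext x
      simp only [Set.mem_inter_iff, Set.mem_preimage, Set.mem_singleton_iff,
        Set.mem_empty_iff_false, iff_false, not_and]
      rintro rfl h
      exact hab h
    rw [this, measureReal_empty, mul_zero]
  · simp

theorem stepMeasure_smul (ρ : Measure E) {g : E → α} (hg : Measurable g) {a : ℝ} (ha : 0 < a)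
    (r : α → ℝ) :
    stepMeasure (ENNReal.ofReal a • ρ) g (fun b => r b / a) = stepMeasure ρ g r := by
  ext B hB
  rw [stepMeasure_apply _ hg _ hB, stepMeasure_apply _ hg _ hB]
  refine Finset.sum_congr rfl fun b _ => ?_
  rw [Measure.smul_apply, smul_eq_mul, ← mul_assoc, ← ENNReal.ofReal_mul' ha.le,
    div_mul_cancel₀ _ ha.ne']

theorem sum_measureReal_fiber_inter (ρ : Measure E) [IsFiniteMeasure ρ] {g : E → α}
    (hg : Measurable g) {B : Set E} (hB : MeasurableSet B) :
    ∑ a, ρ.real (g ⁻¹' {a} ∩ B) = ρ.real B := by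
  have h := stepMeasure_real ρ hg (r := fun _ => 1) (fun _ => zero_le_one) hB
  simp only [one_mul] at h
  rw [← h, stepMeasure]
  simp

theorem measure_sum_eq_of_hasSum {ι : Type*} {ν : ι → Measure E} [∀ i, IsFiniteMeasure (ν i)]
    {ρ : Measure E} [IsFiniteMeasure ρ]
    (h : ∀ B, MeasurableSet B → HasSum (fun i => (ν i).real B) (ρ.real B)) :
    Measure.sum ν = ρ := by
  ext B hB
  rw [Measure.sum_apply _ hB, ← ofReal_measureReal (μ := ρ), ← (h B hB).tsum_eq,
    ENNReal.ofReal_tsum_of_nonneg (fun i => measureReal_nonneg) (h B hB).summable]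
  exact tsum_congr fun i => (ofReal_measureReal).symm

end StepDensity

section Lift

variable {d : ℕ} {W : Set (EuclideanSpace ℝ (Fin d))} {μ : FiniteMeasure W} {kmax : ℕ}
variable {J : Type*} [Fintype J] [DecidableEq J] [MeasurableSpace J] [DiscreteMeasurableSpace J]
  {c : W → J} {ν : J → RoutePath kmax J → ℝ} {u : J → ℕ → ℝ}

/-- A cell without users receives no hops. This makes the convention 0/0 = 0 harmless in the
densities of the lift. -/
theorem hopCount_eq_zero {L : J → ℝ} (hset : IsDiscreteSetting L ν u) {j : J} (hj : L j = 0) :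
    hopCount ν j = 0 := by
  have h := hset.hops_eq j
  simp only [hset.u_eq_zero hj, zero_mul] at h
  exact h.unique hasSum_zero

/-- The hop measure of the lift of a discrete setting. -/
def liftHop (μ : FiniteMeasure W) (c : W → J) (ν : J → RoutePath kmax J → ℝ) : Measure W :=
  stepMeasure (μ : Measure W) c fun j => hopCount ν j / (μ : Measure W).real (c ⁻¹' {j})

/-- The trajectory measures of the lift of a discrete setting. -/
def liftRoute (μ : FiniteMeasure W) (c : W → J) (ν : J → RoutePath kmax J → ℝ) (κ : Fin kmax) :
    Measure (Fin (κ + 1 : ℕ) → W) :=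
  stepMeasure (Measure.pi (Fin.cons (μ : Measure W) fun _ : Fin (κ : ℕ) => liftHop μ c ν))
    (cellOf c κ) fun y => ν y.1 ⟨κ, y.2⟩ /
      ((μ : Measure W).real (c ⁻¹' {y.1}) * ∏ l, hopCount ν (y.2 l))

/-- The relay measures of the lift of a discrete setting. -/
def liftRelay (μ : FiniteMeasure W) (c : W → J) (u : J → ℕ → ℝ) (m : ℕ) : Measure W :=
  stepMeasure (μ : Measure W) c fun j => u j m / (μ : Measure W).real (c ⁻¹' {j})

theorem liftHop_real_inter (hset : IsDiscreteSetting (fun j => (μ : Measure W).real (c ⁻¹' {j})) ν u)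
    (hc : Measurable c) (j : J) {B : Set W} (hB : MeasurableSet B) :
    (liftHop μ c ν).real (c ⁻¹' {j} ∩ B) = hopCount ν j *
      ((μ : Measure W).real (c ⁻¹' {j} ∩ B) / (μ : Measure W).real (c ⁻¹' {j})) := by
  have hj := hc (measurableSet_singleton j)
  rw [liftHop, stepMeasure_real _ hc (fun j => div_nonneg (hopCount_nonneg hset.ν_nonneg j)
    measureReal_nonneg) (hj.inter hB), Finset.sum_eq_single j]
  · rw [← Set.inter_assoc, Set.inter_self]; ring
  · intro a _ hab
    have : c ⁻¹' {a} ∩ (c ⁻¹' {j} ∩ B) = ∅ := by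
      ext x
      simp only [Set.mem_inter_iff, Set.mem_preimage, Set.mem_singleton_iff,
        Set.mem_empty_iff_false, iff_false, not_and]
      rintro rfl h
      exact (hab h).elim
    rw [this, measureReal_empty, mul_zero]
  · simp

theorem liftHop_real_fiber (hset : IsDiscreteSetting (fun j => (μ : Measure W).real (c ⁻¹' {j})) ν u)
    (hc : Measurable c) (j : J) : (liftHop μ c ν).real (c ⁻¹' {j}) = hopCount ν j := by
  have h := liftHop_real_inter hset hc j MeasurableSet.univ
  rw [Set.inter_univ] at h
  rw [h]
  by_cases hj : (μ : Measure W).real (c ⁻¹' {j}) = 0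
  · rw [hopCount_eq_zero hset hj, zero_mul]
  · rw [div_self hj, mul_one]

theorem cellOf_preimage_inter_pi (κ : ℕ) (y : J × (Fin κ → J)) (A : Set W) (B : Fin κ → Set W) :
    cellOf c κ ⁻¹' {y} ∩ Set.univ.pi (Fin.cons (α := fun _ => Set W) A B) =
      Set.univ.pi (Fin.cons (α := fun _ => Set W) (c ⁻¹' {y.1} ∩ A)
        fun l => c ⁻¹' {y.2 l} ∩ B l) := by
  rw [cellOf_preimage, ← Set.pi_inter_distrib]
  congr 1
  funext i
  refine Fin.cases ?_ (fun i => ?_) i <;> simp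

theorem liftRoute_density_nonneg
    (hset : IsDiscreteSetting (fun j => (μ : Measure W).real (c ⁻¹' {j})) ν u) (κ : Fin kmax)
    (y : J × (Fin κ → J)) : 0 ≤ ν y.1 ⟨κ, y.2⟩ /
      ((μ : Measure W).real (c ⁻¹' {y.1}) * ∏ l, hopCount ν (y.2 l)) :=
  div_nonneg (hset.ν_nonneg _ _)
    (mul_nonneg measureReal_nonneg (Finset.prod_nonneg fun _ _ => hopCount_nonneg hset.ν_nonneg _))

/-- Given the cells, the points of a lifted trajectory are independent, each with law μ conditioned
on its cell; the hop masses cancel. -/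
theorem liftRoute_real_pi
    (hset : IsDiscreteSetting (fun j => (μ : Measure W).real (c ⁻¹' {j})) ν u)
    (hc : Measurable c) (κ : Fin kmax) {A : Set W} {B : Fin κ → Set W} (hA : MeasurableSet A)
    (hB : ∀ l, MeasurableSet (B l)) :
    (liftRoute μ c ν κ).real (Set.univ.pi (Fin.cons (α := fun _ => Set W) A B)) =
      ∑ j, ∑ q : Fin κ → J, ν j ⟨κ, q⟩ *
        ((μ : Measure W).real (c ⁻¹' {j} ∩ A) / (μ : Measure W).real (c ⁻¹' {j})) *
        ∏ l, (μ : Measure W).real (c ⁻¹' {q l} ∩ B l) / (μ : Measure W).real (c ⁻¹' {q l}) := by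
  have := isFiniteMeasure_stepMeasure (μ : Measure W) hc
    fun j => hopCount ν j / (μ : Measure W).real (c ⁻¹' {j})
  have : IsFiniteMeasure (liftHop μ c ν) := this
  have hbox : MeasurableSet (Set.univ.pi (Fin.cons (α := fun _ => Set W) A B)) :=
    MeasurableSet.univ_pi fun i => by refine Fin.cases ?_ (fun i => ?_) i <;> simp [hA, hB]
  rw [liftRoute, stepMeasure_real _ (measurable_cellOf hc κ) (liftRoute_density_nonneg hset κ) hbox,
    Fintype.sum_prod_type]
  refine Finset.sum_congr rfl fun j _ => Finset.sum_congr rfl fun q _ => ?_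
  rw [cellOf_preimage_inter_pi, pi_cons_real_pi]
  simp only [liftHop_real_inter hset hc _ (hB _), Finset.prod_mul_distrib]
  by_cases h : (μ : Measure W).real (c ⁻¹' {j}) * ∏ l, hopCount ν (q l) = 0
  · rw [hset.ν_eq_zero_of_mul_prod_eq_zero (p := ⟨κ, q⟩) h]; simp
  · have h1 := left_ne_zero_of_mul h
    have h2 := right_ne_zero_of_mul h
    field_simp

theorem measureReal_fiber_div {ρ : Measure W} {j : J} (h : ρ.real (c ⁻¹' {j}) ≠ 0) :
    ρ.real (c ⁻¹' {j} ∩ Set.univ) / ρ.real (c ⁻¹' {j}) = 1 := by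
  rw [Set.inter_univ, div_self h]

theorem measureReal_fiber_mul_div (ρ : Measure W) [IsFiniteMeasure ρ] (j : J) (A : Set W) :
    ρ.real (c ⁻¹' {j}) * (ρ.real (c ⁻¹' {j} ∩ A) / ρ.real (c ⁻¹' {j})) =
      ρ.real (c ⁻¹' {j} ∩ A) := by
  by_cases hj : ρ.real (c ⁻¹' {j}) = 0
  · have h0 : ρ.real (c ⁻¹' {j} ∩ A) = 0 :=
      le_antisymm ((measureReal_mono Set.inter_subset_left).trans_eq hj) measureReal_nonneg
    rw [hj, h0, zero_mul]
  · rw [mul_div_cancel₀ _ hj]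

theorem relays_ne_zero (hset : IsDiscreteSetting (fun j => (μ : Measure W).real (c ⁻¹' {j})) ν u)
    {j : J} {p : RoutePath kmax J} (h : ν j p ≠ 0) (l : Fin p.1) :
    (μ : Measure W).real (c ⁻¹' {p.2 l}) ≠ 0 := fun h0 =>
  h (hset.ν_eq_zero_of_hop l (hopCount_eq_zero hset h0))

theorem liftRoute_map_zero_real
    (hset : IsDiscreteSetting (fun j => (μ : Measure W).real (c ⁻¹' {j})) ν u)
    (hc : Measurable c) (κ : Fin kmax) {A : Set W} (hA : MeasurableSet A) :
    (Measure.map (fun x => x 0) (liftRoute μ c ν κ)).real A =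
      ∑ j, (∑ q : Fin κ → J, ν j ⟨κ, q⟩) *
        ((μ : Measure W).real (c ⁻¹' {j} ∩ A) / (μ : Measure W).real (c ⁻¹' {j})) := by
  rw [map_measureReal_apply (measurable_pi_apply 0) hA]
  have e : (fun x : Fin (κ + 1 : ℕ) → W => x 0) ⁻¹' A =
      Set.univ.pi (Fin.cons (α := fun _ => Set W) A fun _ => Set.univ) := by
    ext x; simp [Fin.forall_fin_succ]
  rw [e, liftRoute_real_pi hset hc κ hA fun _ => MeasurableSet.univ]
  refine Finset.sum_congr rfl fun j _ => ?_
  rw [Finset.sum_mul]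
  refine Finset.sum_congr rfl fun q _ => ?_
  by_cases h : ν j ⟨κ, q⟩ = 0
  · simp [h]
  · rw [Finset.prod_eq_one fun l _ => measureReal_fiber_div (relays_ne_zero hset h l), mul_one]

theorem liftRoute_map_succ_real
    (hset : IsDiscreteSetting (fun j => (μ : Measure W).real (c ⁻¹' {j})) ν u)
    (hc : Measurable c) (κ : Fin kmax) (i : Fin κ) {A : Set W} (hA : MeasurableSet A) :
    (Measure.map (fun x => x i.succ) (liftRoute μ c ν κ)).real A =
      ∑ j, ∑ q : Fin κ → J, ν j ⟨κ, q⟩ *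
        ((μ : Measure W).real (c ⁻¹' {q i} ∩ A) / (μ : Measure W).real (c ⁻¹' {q i})) := by
  rw [map_measureReal_apply (measurable_pi_apply i.succ) hA]
  have e : (fun x : Fin (κ + 1 : ℕ) → W => x i.succ) ⁻¹' A = Set.univ.pi
      (Fin.cons (α := fun _ => Set W) Set.univ fun l => if l = i then A else Set.univ) := by
    ext x
    simp only [Set.mem_preimage, Set.mem_pi, Set.mem_univ, true_implies, Fin.forall_fin_succ,
      Fin.cons_zero, Fin.cons_succ, true_and]
    refine ⟨fun h l => ?_, fun h => by simpa using h i⟩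
    split_ifs with hl
    · exact hl ▸ h
    · trivial
  have hB : ∀ l, MeasurableSet (if l = i then A else Set.univ : Set W) := fun l => by
    split_ifs
    exacts [hA, MeasurableSet.univ]
  rw [e, liftRoute_real_pi hset hc κ MeasurableSet.univ hB]
  refine Finset.sum_congr rfl fun j _ => Finset.sum_congr rfl fun q _ => ?_
  by_cases h : ν j ⟨κ, q⟩ = 0
  · simp [h]
  · rw [measureReal_fiber_div fun h0 => h (hset.ν_eq_zero_of_start h0 _), mul_one,
      Finset.prod_eq_single i]
    · rw [if_pos rfl]
    · intro l _ hl
      rw [if_neg hl]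
      exact measureReal_fiber_div (relays_ne_zero hset h l)
    · simp

theorem liftRelay_real
    (hset : IsDiscreteSetting (fun j => (μ : Measure W).real (c ⁻¹' {j})) ν u)
    (hc : Measurable c) (m : ℕ) {A : Set W} (hA : MeasurableSet A) :
    (liftRelay μ c u m).real A =
      ∑ j, u j m * ((μ : Measure W).real (c ⁻¹' {j} ∩ A) / (μ : Measure W).real (c ⁻¹' {j})) := by
  rw [liftRelay, stepMeasure_real _ hc (fun j => div_nonneg (hset.u_nonneg j m) measureReal_nonneg)
    hA]
  exact Finset.sum_congr rfl fun j _ => by ring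

theorem liftRelay_real_fiber
    (hset : IsDiscreteSetting (fun j => (μ : Measure W).real (c ⁻¹' {j})) ν u)
    (hc : Measurable c) (m : ℕ) (j : J) : (liftRelay μ c u m).real (c ⁻¹' {j}) = u j m := by
  rw [liftRelay, stepMeasure_real_fiber _ hc fun j => div_nonneg (hset.u_nonneg j m)
    measureReal_nonneg]
  by_cases hj : (μ : Measure W).real (c ⁻¹' {j}) = 0
  · rw [hset.u_eq_zero hj, zero_div, zero_mul]
  · rw [div_mul_cancel₀ _ hj]

theorem isFiniteMeasure_liftRoute (hc : Measurable c) (κ : Fin kmax) :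
    IsFiniteMeasure (liftRoute μ c ν κ) := by
  have : IsFiniteMeasure (liftHop μ c ν) := isFiniteMeasure_stepMeasure _ hc _
  exact isFiniteMeasure_stepMeasure _ (measurable_cellOf hc κ) _

theorem hasSum_liftRelay_hops
    (hset : IsDiscreteSetting (fun j => (μ : Measure W).real (c ⁻¹' {j})) ν u)
    (hc : Measurable c) {A : Set W} (hA : MeasurableSet A) :
    HasSum (fun m : ℕ => (m : ℝ) * (liftRelay μ c u m).real A) ((liftHop μ c ν).real A) := by
  have h1 : (liftHop μ c ν).real A = ∑ j, hopCount ν j *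
      ((μ : Measure W).real (c ⁻¹' {j} ∩ A) / (μ : Measure W).real (c ⁻¹' {j})) := by
    rw [liftHop, stepMeasure_real _ hc (fun j => div_nonneg (hopCount_nonneg hset.ν_nonneg j)
      measureReal_nonneg) hA]
    exact Finset.sum_congr rfl fun j _ => by ring
  rw [h1]
  refine (hasSum_sum fun j _ => (hset.hops_eq j).mul_right _).congr_fun fun m => ?_
  rw [liftRelay_real hset hc m hA, Finset.mul_sum]
  exact Finset.sum_congr rfl fun j _ => by ring

/-- A relay in cell j contributes μ conditioned on j to the marginals. Counting the relays per cell
gives `hopCount`, hence the same measure as from the loads. -/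
theorem sum_liftRoute_hops
    (hset : IsDiscreteSetting (fun j => (μ : Measure W).real (c ⁻¹' {j})) ν u)
    (hc : Measurable c) :
    ∑ κ : Fin kmax, ∑ l : Fin (κ : ℕ), Measure.map (fun x => x l.succ) (liftRoute μ c ν κ) =
      liftHop μ c ν := by
  have : IsFiniteMeasure (liftHop μ c ν) := isFiniteMeasure_stepMeasure _ hc _
  have hfin := fun κ => isFiniteMeasure_liftRoute (μ := μ) (ν := ν) hc κ
  ext A hA
  rw [← ENNReal.toReal_eq_toReal_iff' (measure_ne_top _ _) (measure_ne_top _ _),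
    Measure.finsetSum_apply, ENNReal.toReal_sum fun _ _ => measure_ne_top _ _]
  have h1 : ∀ κ : Fin kmax, ((∑ l : Fin (κ : ℕ), Measure.map (fun x => x l.succ)
      (liftRoute μ c ν κ)) A).toReal = ∑ j, ∑ q : Fin κ → J, ∑ l, ν j ⟨κ, q⟩ *
        ((μ : Measure W).real (c ⁻¹' {q l} ∩ A) / (μ : Measure W).real (c ⁻¹' {q l})) := by
    intro κ
    rw [Measure.finsetSum_apply, ENNReal.toReal_sum fun _ _ => measure_ne_top _ _]
    refine (Finset.sum_congr rfl fun l _ => liftRoute_map_succ_real hset hc κ l hA).trans ?_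
    rw [Finset.sum_comm]
    exact Finset.sum_congr rfl fun j _ => Finset.sum_comm
  rw [Finset.sum_congr rfl fun κ _ => h1 κ, Finset.sum_comm, ← measureReal_def,
    ← (hasSum_liftRelay_hops hset hc hA).tsum_eq]
  have h2 : (liftHop μ c ν).real A = ∑ j, hopCount ν j *
      ((μ : Measure W).real (c ⁻¹' {j} ∩ A) / (μ : Measure W).real (c ⁻¹' {j})) := by
    rw [liftHop, stepMeasure_real _ hc (fun j => div_nonneg (hopCount_nonneg hset.ν_nonneg j)
      measureReal_nonneg) hA]
    exact Finset.sum_congr rfl fun j _ => by ring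
  rw [(hasSum_liftRelay_hops hset hc hA).tsum_eq, h2]
  simp only [hopCount, Finset.sum_mul]
  conv_rhs => rw [Finset.sum_comm]
  refine Finset.sum_congr rfl fun j _ => ?_
  rw [← Fintype.sum_sigma (fun p : RoutePath kmax J => ∑ l, ν j p *
    ((μ : Measure W).real (c ⁻¹' {p.2 l} ∩ A) / (μ : Measure W).real (c ⁻¹' {p.2 l}))),
    Finset.sum_comm]
  refine Finset.sum_congr rfl fun p _ => ?_
  rw [← Finset.sum_fiberwise (g := p.2)]
  refine Finset.sum_congr rfl fun j' _ => ?_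
  rw [RoutePath.count, mul_assoc, mul_left_comm, ← nsmul_eq_mul, ← Finset.sum_const]
  exact Finset.sum_congr rfl fun i hi => by rw [(Finset.mem_filter.1 hi).2]

/-- The admissible setting whose densities are constant on the cells. -/
def AdmissibleSetting.lift (hset : IsDiscreteSetting (fun j => (μ : Measure W).real (c ⁻¹' {j})) ν u)
    (hc : Measurable c) : AdmissibleSetting μ kmax where
  ν κ := ⟨liftRoute μ c ν κ, isFiniteMeasure_liftRoute hc κ⟩
  rel m := ⟨liftRelay μ c u m, isFiniteMeasure_stepMeasure _ hc _⟩
  start_eq := by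
    have hfin := fun κ => isFiniteMeasure_liftRoute (μ := μ) (ν := ν) hc κ
    change ∑ κ : Fin kmax, Measure.map (fun x => x 0) (liftRoute μ c ν κ) = _
    ext A hA
    rw [← ENNReal.toReal_eq_toReal_iff' (measure_ne_top _ _) (measure_ne_top _ _),
      Measure.finsetSum_apply, ENNReal.toReal_sum fun _ _ => measure_ne_top _ _]
    refine (Finset.sum_congr rfl fun κ _ => liftRoute_map_zero_real hset hc κ hA).trans ?_
    rw [Finset.sum_comm, ← measureReal_def, ← sum_measureReal_fiber_inter _ hc hA]
    refine Finset.sum_congr rfl fun j _ => ?_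
    rw [← Finset.sum_mul, ← Fintype.sum_sigma (fun p : RoutePath kmax J => ν j p), hset.start_eq,
      measureReal_fiber_mul_div]
  rel_eq := by
    have hfin : ∀ m, IsFiniteMeasure (liftRelay μ c u m) :=
      fun m => isFiniteMeasure_stepMeasure _ hc _
    refine measure_sum_eq_of_hasSum (ν := fun m => liftRelay μ c u m) fun A hA => ?_
    rw [← sum_measureReal_fiber_inter _ hc hA]
    simp only [liftRelay_real hset hc _ hA]
    refine hasSum_sum fun j _ => ?_
    have h := (hset.rel_eq j).mul_right
      ((μ : Measure W).real (c ⁻¹' {j} ∩ A) / (μ : Measure W).real (c ⁻¹' {j}))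
    rwa [measureReal_fiber_mul_div] at h
  hops_eq := by
    refine Eq.trans ?_ (sum_liftRoute_hops hset hc).symm
    have : IsFiniteMeasure (liftHop μ c ν) := isFiniteMeasure_stepMeasure _ hc _
    have hfin : ∀ m, IsFiniteMeasure (liftRelay μ c u m) :=
      fun m => isFiniteMeasure_stepMeasure _ hc _
    have hfin' : ∀ m : ℕ, IsFiniteMeasure ((m : ℝ≥0∞) • liftRelay μ c u m) :=
      fun m => (liftRelay μ c u m).smul_finite (ENNReal.natCast_ne_top m)
    refine measure_sum_eq_of_hasSum (ν := fun m : ℕ => (m : ℝ≥0∞) • liftRelay μ c u m)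
      fun A hA => ?_
    refine (hasSum_liftRelay_hops hset hc hA).congr_fun fun m => ?_
    rw [measureReal_def, Measure.smul_apply, smul_eq_mul, ENNReal.toReal_mul,
      ENNReal.toReal_natCast, measureReal_def]

end Lift

namespace AdmissibleSetting

variable {d : ℕ} {W : Set (EuclideanSpace ℝ (Fin d))} {μ : FiniteMeasure W} {kmax : ℕ}
variable {f : (κ : Fin kmax) → FiniteMeasure W × (Fin (κ + 1 : ℕ) → W) → ℝ}
  {η : ℕ → ℝ} {γ β : ℝ}
variable {J : Type*} [Fintype J] [DecidableEq J] [MeasurableSpace J] [DiscreteMeasurableSpace J]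
  {c : W → J} {ν : J → RoutePath kmax J → ℝ} {u : J → ℕ → ℝ}

theorem hopMeasure_lift
    (hset : IsDiscreteSetting (fun j => (μ : Measure W).real (c ⁻¹' {j})) ν u)
    (hc : Measurable c) : (lift hset hc).hopMeasure = liftHop μ c ν :=
  (hopMeasure_eq _).trans (sum_liftRoute_hops hset hc)

theorem cellMass_lift
    (hset : IsDiscreteSetting (fun j => (μ : Measure W).real (c ⁻¹' {j})) ν u)
    (hc : Measurable c) : (lift hset hc).cellMass c = ν := by
  have : IsFiniteMeasure (liftHop μ c ν) := isFiniteMeasure_stepMeasure _ hc _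
  funext j p
  obtain ⟨κ, q⟩ := p
  refine (stepMeasure_real_fiber (Measure.pi (Fin.cons (μ : Measure W) (fun _ : Fin (κ : ℕ) =>
    liftHop μ c ν) : Fin (κ + 1 : ℕ) → Measure W)) (measurable_cellOf hc κ) (liftRoute_density_nonneg hset κ) (j, q)).trans ?_
  rw [pi_cons_real_cellOf]
  simp only [liftHop_real_fiber hset hc]
  by_cases h : (μ : Measure W).real (c ⁻¹' {j}) * ∏ l, hopCount ν (q l) = 0
  · rw [h, mul_zero, hset.ν_eq_zero_of_mul_prod_eq_zero (p := ⟨κ, q⟩) h]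
  · rw [div_mul_cancel₀ _ h]

/-- The densities are functions of the cells, so `klDiv_withDensity_comp` gives the entropy exactly
and the lift costs no more than the discrete setting. -/
theorem routeEntropy_lift
    (hset : IsDiscreteSetting (fun j => (μ : Measure W).real (c ⁻¹' {j})) ν u)
    (hc : Measurable c) : (lift hset hc).routeEntropy = ENNReal.ofReal
      (∑ j, ∑ p : RoutePath kmax J, klTerm (ν j p)
        ((μ : Measure W).real (c ⁻¹' {j}) * ∏ i, hopCount ν (p.2 i))) := by
  have : IsFiniteMeasure (liftHop μ c ν) := isFiniteMeasure_stepMeasure _ hc _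
  have hnn : ∀ j (p : RoutePath kmax J), 0 ≤ klTerm (ν j p)
        ((μ : Measure W).real (c ⁻¹' {j}) * ∏ i, hopCount ν (p.2 i)) := fun j p =>
    klTerm_nonneg (hset.ν_nonneg j p) (mul_nonneg measureReal_nonneg
      (Finset.prod_nonneg fun i _ => hopCount_nonneg hset.ν_nonneg _))
      hset.ν_eq_zero_of_mul_prod_eq_zero
  simp only [Fintype.sum_sigma]
  rw [Finset.sum_comm, ENNReal.ofReal_sum_of_nonneg fun κ _ => Finset.sum_nonneg fun j _ =>
    Finset.sum_nonneg fun q _ => hnn j ⟨κ, q⟩, routeEntropy, hopMeasure_lift hset hc]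
  refine Finset.sum_congr rfl fun κ _ => ?_
  refine (klDiv_withDensity_comp (Measure.pi (Fin.cons (μ : Measure W) fun _ : Fin (κ : ℕ) =>
    liftHop μ c ν)) (measurable_cellOf hc κ) (fun y => ν y.1 ⟨κ, y.2⟩ /
      ((μ : Measure W).real (c ⁻¹' {y.1}) * ∏ l, hopCount ν (y.2 l)))
      (liftRoute_density_nonneg hset κ)).trans ?_
  rw [Fintype.sum_prod_type]
  congr 1
  refine Finset.sum_congr rfl fun j _ => Finset.sum_congr rfl fun q _ => ?_
  rw [pi_cons_real_cellOf]
  simp only [liftHop_real_fiber hset hc]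
  by_cases h : (μ : Measure W).real (c ⁻¹' {j}) * ∏ l, hopCount ν (q l) = 0
  · rw [h, mul_zero, hset.ν_eq_zero_of_mul_prod_eq_zero (p := ⟨κ, q⟩) h]
  · rw [div_mul_cancel₀ _ h]

theorem klDiv_liftRelay
    (hset : IsDiscreteSetting (fun j => (μ : Measure W).real (c ⁻¹' {j})) ν u)
    (hc : Measurable c) (hμ : 0 < μ.mass) (m : ℕ) :
    InformationTheory.klDiv (liftRelay μ c u m)
      (ENNReal.ofReal (poissonWeight μ m) • (μ : Measure W)) = ENNReal.ofReal
      (∑ j, klTerm (u j m) (poissonWeight μ m * (μ : Measure W).real (c ⁻¹' {j}))) := by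
  have hμ' : (0 : ℝ) < μ.mass := by exact_mod_cast hμ
  have hpw : 0 < poissonWeight μ m := by
    rw [poissonWeight_eq]; exact poissonTerm_pos (by positivity) m
  have hfin : IsFiniteMeasure (ENNReal.ofReal (poissonWeight μ m) • (μ : Measure W)) :=
    (μ : Measure W).smul_finite ENNReal.ofReal_ne_top
  set ρ := ENNReal.ofReal (poissonWeight μ m) • (μ : Measure W) with hρ
  set r : J → ℝ := fun j => u j m / (μ : Measure W).real (c ⁻¹' {j}) / poissonWeight μ m with hr
  have hr0 : ∀ j, 0 ≤ r j := fun j =>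
    div_nonneg (div_nonneg (hset.u_nonneg j m) measureReal_nonneg) hpw.le
  have h1 : liftRelay μ c u m = ρ.withDensity fun x => ENNReal.ofReal (r (c x)) :=
    (stepMeasure_smul (μ : Measure W) hc hpw _).symm
  rw [h1, klDiv_withDensity_comp ρ hc r hr0]
  congr 1
  refine Finset.sum_congr rfl fun j _ => ?_
  rw [hρ, real_poissonWeight_smul]
  by_cases hj : (μ : Measure W).real (c ⁻¹' {j}) = 0
  · rw [hset.u_eq_zero hj, hj]; simp
  · congr 1
    change u j m / (μ : Measure W).real (c ⁻¹' {j}) / poissonWeight μ m * _ = _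
    rw [div_div, mul_comm ((μ : Measure W).real _), div_mul_cancel₀ _ (mul_ne_zero hpw.ne' hj)]

theorem relayEntropy_lift
    (hset : IsDiscreteSetting (fun j => (μ : Measure W).real (c ⁻¹' {j})) ν u)
    (hc : Measurable c) (hμ : 0 < μ.mass)
    (hs : ∀ j, Summable fun m => klTerm (u j m)
      (poissonWeight μ m * (μ : Measure W).real (c ⁻¹' {j}))) :
    (lift hset hc).relayEntropy = ENNReal.ofReal (∑ j, ∑' m, klTerm (u j m)
      (poissonWeight μ m * (μ : Measure W).real (c ⁻¹' {j}))) := by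
  have hμ' : (0 : ℝ) < μ.mass := by exact_mod_cast hμ
  have hpw : ∀ m, 0 < poissonWeight μ m := fun m => by
    rw [poissonWeight_eq]; exact poissonTerm_pos (by positivity) m
  have hnn : ∀ j m, 0 ≤ klTerm (u j m)
      (poissonWeight μ m * (μ : Measure W).real (c ⁻¹' {j})) := fun j m =>
    klTerm_nonneg (hset.u_nonneg j m) (mul_nonneg (hpw m).le measureReal_nonneg) fun h0 =>
      hset.u_eq_zero ((mul_eq_zero.1 h0).resolve_left (hpw m).ne') m
  rw [← Summable.tsum_finsetSum fun j _ => hs j, ENNReal.ofReal_tsum_of_nonneg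
    (fun m => Finset.sum_nonneg fun j _ => hnn j m) (summable_sum fun j _ => hs j)]
  exact tsum_congr fun m => klDiv_liftRelay hset hc hμ m

/-- The free energy of the lift of a discrete setting. -/
theorem freeEnergy_lift_le
    (hset : IsDiscreteSetting (fun j => (μ : Measure W).real (c ⁻¹' {j})) ν u)
    (hc : Measurable c) (hμ : 0 < μ.mass) (hβ : 0 < β)
    (Φ : J → RoutePath kmax J → ℝ) {ε Cη : ℝ} (hη : ∀ m, Cη ≤ η m)
    (hΦ : ∀ (κ : Fin kmax) (x : Fin (κ + 1 : ℕ) → W),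
      |γ * f κ (μ, x) - Φ (c (x 0)) ⟨κ, fun l => c (x l.succ)⟩| ≤ ε)
    (hf : ∀ κ, Integrable (fun x => f κ (μ, x))
      ((lift hset hc).ν κ : Measure (Fin (κ + 1 : ℕ) → W)))
    (hs : ∀ j, Summable fun m => typeCost (1 / (Real.exp 1 * (μ.mass : ℝ))) (β * Cη)
      (fun m => β * η m) m (u j m)) :
    (lift hset hc).freeEnergy f η γ β ≤
      ((discreteEnergy (1 / (Real.exp 1 * (μ.mass : ℝ))) (β * Cη) Φ (fun m => β * η m)
      (fun j => (μ : Measure W).real (c ⁻¹' {j})) ν u + ε * μ.mass : ℝ) : EReal) := by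
  have hμ' : (0 : ℝ) < μ.mass := by exact_mod_cast hμ
  set θ := 1 / (Real.exp 1 * (μ.mass : ℝ)) with hθdef
  have hθ : 0 < θ := by positivity
  set Ψ := lift hset hc with hΨ
  have hcell : Ψ.cellMass c = ν := cellMass_lift hset hc
  have hrel : ∀ m j, (Ψ.rel m : Measure W).real (c ⁻¹' {j}) = u j m :=
    fun m j => liftRelay_real_fiber hset hc m j
  have hψ : ∀ m, 0 ≤ β * η m - β * Cη := fun m => by nlinarith [hη m]
  have hs2 : ∀ j, Summable fun m => (β * η m - β * Cη) * u j m := fun j =>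
    Summable.of_nonneg_of_le (fun m => mul_nonneg (hψ m) (hset.u_nonneg j m))
      (fun m => mul_le_typeCost (C := β * Cη) (ψ := fun m => β * η m) hθ m (hset.u_nonneg j m))
      (hs j)
  have hs1 : ∀ j, Summable fun m => klTerm (u j m) (poissonTerm θ m) := fun j =>
    ((hs j).sub (hs2 j)).congr fun m => by rw [typeCost_eq_klTerm]; ring
  have hs0 := fun j => (hset.summable_klTerm_iff hθ j).2 (hs1 j)
  have hN := Ψ.tsum_negPart_ne_top hη
  have huniv : ∀ m, ∑ j, u j m = (Ψ.rel m : Measure W).real Set.univ := fun m => by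
    rw [← sum_measureReal_fiber _ hc]
    exact Finset.sum_congr rfl fun j _ => (hrel m j).symm
  have hLsum : ∑ j, (μ : Measure W).real (c ⁻¹' {j}) = μ.mass := sum_measureReal_fiber _ hc
  have htot : HasSum (fun m => (Ψ.rel m : Measure W).real Set.univ) (μ.mass : ℝ) := by
    rw [← hLsum]
    simp only [← huniv]
    exact hasSum_sum fun j _ => hset.rel_eq j
  have hsη : Summable fun m => η m * (Ψ.rel m : Measure W).real Set.univ := by
    have h1 : Summable fun m => (β * η m - β * Cη) * (Ψ.rel m : Measure W).real Set.univ := by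
      simp only [← huniv, Finset.mul_sum]
      exact summable_sum fun j _ => hs2 j
    refine ((h1.mul_left β⁻¹).add (htot.summable.mul_left Cη)).congr fun m => ?_
    field_simp
    ring
  have hP : ∑' m, ENNReal.ofReal (η m) * (Ψ.rel m : Measure W) Set.univ ≠ ⊤ := by
    have h1 := hsη.abs.tsum_ofReal_ne_top
    refine ne_top_of_le_ne_top h1 (ENNReal.tsum_le_tsum fun m => ?_)
    rw [← ofReal_measureReal (μ := (Ψ.rel m : Measure W)), ← ENNReal.ofReal_mul' measureReal_nonneg]
    exact ENNReal.ofReal_le_ofReal (le_abs_self _)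
  have hroute := routeEntropy_lift hset hc
  have hrelay := relayEntropy_lift hset hc hμ hs0
  have hpos1 : 0 ≤ ∑ j, ∑ p : RoutePath kmax J, klTerm (ν j p)
        ((μ : Measure W).real (c ⁻¹' {j}) * ∏ i, hopCount ν (p.2 i)) :=
    Finset.sum_nonneg fun j _ => Finset.sum_nonneg fun p _ =>
    klTerm_nonneg (hset.ν_nonneg j p) (mul_nonneg measureReal_nonneg
      (Finset.prod_nonneg fun i _ => hopCount_nonneg hset.ν_nonneg _))
      hset.ν_eq_zero_of_mul_prod_eq_zero
  have hpos2 : 0 ≤ ∑ j, ∑' m, klTerm (u j m) (poissonTerm θ m * (μ : Measure W).real (c ⁻¹' {j})) :=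
    Finset.sum_nonneg fun j _ => tsum_nonneg fun m => klTerm_nonneg (hset.u_nonneg j m)
      (mul_nonneg (poissonTerm_pos hθ m).le measureReal_nonneg) fun h0 =>
      hset.u_eq_zero ((mul_eq_zero.1 h0).resolve_left (poissonTerm_pos hθ m).ne') m
  have e1 : Ψ.routeEntropy.toReal = _ :=
    (congrArg ENNReal.toReal hroute).trans (ENNReal.toReal_ofReal hpos1)
  have e2 : Ψ.relayEntropy.toReal = ∑ j, ∑' m, klTerm (u j m)
      (poissonTerm θ m * (μ : Measure W).real (c ⁻¹' {j})) :=
    (congrArg ENNReal.toReal hrelay).trans (ENNReal.toReal_ofReal hpos2)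
  have hcong := Ψ.hasSum_congestion hP hN
  have hcong2 : HasSum (fun m => (β * η m - β * Cη) * (Ψ.rel m : Measure W).real Set.univ) _ :=
    ((hcong.sub (htot.mul_left Cη)).mul_left β).congr_fun fun m => by ring
  have hs2sum : ∑ j, ∑' m, (β * η m - β * Cη) * u j m =
      ∑' m, (β * η m - β * Cη) * (Ψ.rel m : Measure W).real Set.univ := by
    rw [← Summable.tsum_finsetSum fun j _ => hs2 j]
    simp only [← Finset.mul_sum, huniv]
  have hhop : ∑ j, hopCount ν j = Ψ.hopMeasure.real Set.univ := by
    rw [← sum_measureReal_fiber Ψ.hopMeasure hc]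
    refine Finset.sum_congr rfl fun j _ => ?_
    rw [← Ψ.hopCount_cellMass hc, hcell]
  have hint := Ψ.abs_interference_sub_le hc Φ hΦ hf
  rw [hcell] at hint
  have hθm : θ * μ.mass = 1 / Real.exp 1 := by rw [hθdef]; field_simp
  rw [Ψ.freeEnergy_eq_coe (by rw [hroute]; exact ENNReal.ofReal_ne_top)
    (by rw [hrelay]; exact ENNReal.ofReal_ne_top) hP hN, EReal.coe_le_coe_iff,
    hset.discreteEnergy_eq hθ Φ hs1 hs2, hs2sum, hcong2.tsum_eq, hLsum, e1, e2, hhop, hθm]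
  have := (abs_le.1 hint).2
  linarith

end AdmissibleSetting

/-! ### Laws of large numbers for the users -/

theorem hasSum_poisson_mean (r : ℝ≥0) :
    HasSum (fun n : ℕ => Real.exp (-r) * r ^ n / (n ! : ℝ) * (n : ℝ)) r := by
  have h := (hasSum_one_poissonMeasure r).mul_left (r : ℝ)
  rw [mul_one] at h
  rw [← hasSum_nat_add_iff' 1]
  simp only [Finset.range_one, Finset.sum_singleton, Nat.cast_zero, mul_zero, sub_zero]
  refine h.congr_fun fun n => ?_
  rw [Nat.factorial_succ]
  have : (n ! : ℝ) ≠ 0 := Nat.cast_ne_zero.2 n.factorial_ne_zero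
  push_cast
  field_simp
  ring

theorem integrable_cast_poissonMeasure (r : ℝ≥0) :
    Integrable (fun n : ℕ => (n : ℝ)) (poissonMeasure r) := by
  rw [integrable_poissonMeasure_iff]
  simpa using (hasSum_poisson_mean r).summable

theorem integral_cast_poissonMeasure (r : ℝ≥0) :
    ∫ n : ℕ, (n : ℝ) ∂(poissonMeasure r) = r :=
  (hasSum_integral_poissonMeasure (integrable_cast_poissonMeasure r)).unique
    (by simpa using hasSum_poisson_mean r)

/-- Monotonicity encloses N t between its values at ⌊t⌋ and ⌊t⌋ + 1, and both ratios to t tend to 1.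
-/
theorem tendsto_div_of_monotone_of_nat {N : ℝ≥0 → ℝ} (hN : Monotone N) {r : ℝ}
    (h : Tendsto (fun n : ℕ => N n / n) atTop (𝓝 r)) :
    Tendsto (fun t : ℝ≥0 => N t / t) atTop (𝓝 r) := by
  have hcoe : Tendsto (fun t : ℝ≥0 => (t : ℝ)) atTop atTop := NNReal.tendsto_coe_atTop.2 tendsto_id
  have hfl : Tendsto (fun t : ℝ≥0 => ⌊(t : ℝ)⌋₊) atTop atTop := tendsto_nat_floor_atTop.comp hcoe
  have h1 : Tendsto (fun t : ℝ≥0 => (⌊(t : ℝ)⌋₊ : ℝ) / t) atTop (𝓝 1) :=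
    (tendsto_nat_floor_div_atTop (R := ℝ)).comp hcoe
  have h2 : Tendsto (fun t : ℝ≥0 => ((⌊(t : ℝ)⌋₊ + 1 : ℕ) : ℝ) / t) atTop (𝓝 1) := by
    have h3 : Tendsto (fun t : ℝ≥0 => 1 / (t : ℝ)) atTop (𝓝 0) :=
      tendsto_const_nhds.div_atTop hcoe
    simpa [add_div] using h1.add h3
  have hlow := (h.comp hfl).mul h1
  have hup := (h.comp ((tendsto_add_atTop_nat 1).comp hfl)).mul h2
  rw [mul_one] at hlow hup
  refine tendsto_of_tendsto_of_tendsto_of_le_of_le' hlow hup ?_ ?_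
  · filter_upwards [eventually_ge_atTop (1 : ℝ≥0)] with t ht
    have ht' : (1 : ℝ) ≤ t := by exact_mod_cast ht
    have hpos : 0 < ⌊(t : ℝ)⌋₊ := Nat.floor_pos.2 ht'
    have hpos' : (0 : ℝ) < ⌊(t : ℝ)⌋₊ := Nat.cast_pos.2 hpos
    have hle : ((⌊(t : ℝ)⌋₊ : ℕ) : ℝ≥0) ≤ t := by
      rw [← NNReal.coe_le_coe]; exact_mod_cast Nat.floor_le t.2
    simp only [Function.comp]
    rw [div_mul_div_cancel₀ hpos'.ne']
    exact div_le_div_of_nonneg_right (hN hle) t.2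
  · filter_upwards [eventually_ge_atTop (1 : ℝ≥0)] with t ht
    have hpos' : (0 : ℝ) < (⌊(t : ℝ)⌋₊ + 1 : ℕ) := Nat.cast_pos.2 (Nat.succ_pos _)
    have hle : t ≤ ((⌊(t : ℝ)⌋₊ + 1 : ℕ) : ℝ≥0) := by
      rw [← NNReal.coe_le_coe]
      push_cast
      exact (Nat.lt_floor_add_one _).le
    simp only [Function.comp]
    rw [div_mul_div_cancel₀ hpos'.ne']
    exact div_le_div_of_nonneg_right (hN hle) t.2

section LawOfLargeNumbers

variable {Ω : Type*} [MeasurableSpace Ω] {P : Measure Ω} [IsProbabilityMeasure P]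

/-- The law of large numbers for a Poisson process. -/
theorem IsPoissonProcess.ae_tendsto_div {N : ℝ≥0 → Ω → ℕ} {r : ℝ≥0}
    (h : IsPoissonProcess N r P) :
    ∀ᵐ ω ∂P, Tendsto (fun t : ℝ≥0 => (N t ω : ℝ) / t) atTop (𝓝 r) := by
  set Y : ℕ → Ω → ℕ := fun k ω => N ((k + 1 : ℕ) : ℝ≥0) ω - N (k : ℝ≥0) ω with hY
  have hYm : ∀ k, Measurable (Y k) := fun k =>
    (h.measurable _).sub (h.measurable _)
  have hind : iIndepFun Y P := h.indep_increments.nat (t := fun k : ℕ => (k : ℝ≥0)) Nat.mono_cast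
  have hlaw : ∀ k, Measure.map (Y k) P = poissonMeasure r := fun k => by
    have h1 := h.law_increments (k : ℝ≥0) ((k + 1 : ℕ) : ℝ≥0) (by exact_mod_cast Nat.le_succ k)
    rw [h1]
    congr 1
    push_cast
    rw [add_tsub_cancel_left, mul_one]
  have hcast : Measurable (fun n : ℕ => (n : ℝ)) := measurable_of_countable _
  have hint : Integrable (fun ω => (Y 0 ω : ℝ)) P := by
    have h1 := integrable_cast_poissonMeasure r
    rw [← hlaw 0] at h1
    exact h1.comp_measurable (hYm 0)
  have hmean : ∫ ω, (Y 0 ω : ℝ) ∂P = r := by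
    rw [← integral_cast_poissonMeasure r, ← hlaw 0,
      integral_map (hYm 0).aemeasurable hcast.aestronglyMeasurable]
  have hslln := strong_law_ae_real (fun k ω => (Y k ω : ℝ)) hint
    (fun i j hij => (hind.indepFun hij).comp hcast hcast)
    (fun i => (IdentDistrib.mk (hYm i).aemeasurable (hYm 0).aemeasurable
      ((hlaw i).trans (hlaw 0).symm)).comp hcast)
  rw [hmean] at hslln
  filter_upwards [hslln, h.zero, h.paths] with ω h1 h2 h3
  refine tendsto_div_of_monotone_of_nat (N := fun t => (N t ω : ℝ))
    (fun s t hst => Nat.cast_le.2 (h3.1 hst)) ?_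
  refine h1.congr fun n => ?_
  -- The increments are differences in ℕ; on nondecreasing paths they are true differences and
  -- telescope.
  have e : ∀ k, (Y k ω : ℝ) = (N ((k + 1 : ℕ) : ℝ≥0) ω : ℝ) - (N (k : ℝ≥0) ω : ℝ) := fun k =>
    Nat.cast_sub (h3.1 (by exact_mod_cast Nat.le_succ k))
  simp only [e]
  rw [Finset.sum_range_sub (fun k : ℕ => (N (k : ℝ≥0) ω : ℝ))]
  simp [h2]

variable {E : Type*} [MeasurableSpace E] {X : ℕ → Ω → E} {ρ : Measure E}

/-- The law of large numbers for the frequencies of a set. -/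
theorem ae_tendsto_frequency (hXm : ∀ i, Measurable (X i)) (hlaw : ∀ i, Measure.map (X i) P = ρ)
    (hind : iIndepFun X P) {A : Set E} (hA : MeasurableSet A) :
    ∀ᵐ ω ∂P, Tendsto (fun n : ℕ => (∑ i ∈ Finset.range n, A.indicator (1 : E → ℝ) (X i ω)) / n)
      atTop (𝓝 (ρ.real A)) := by
  have hm : Measurable (A.indicator (1 : E → ℝ)) := measurable_one.indicator hA
  have hmean : ∫ ω, A.indicator (1 : E → ℝ) (X 0 ω) ∂P = ρ.real A := by
    rw [← integral_map (hXm 0).aemeasurable hm.aestronglyMeasurable, hlaw,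
      integral_indicator_one hA]
  have hint : Integrable (fun ω => A.indicator (1 : E → ℝ) (X 0 ω)) P :=
    ((integrable_const (1 : ℝ)).indicator hA : Integrable (A.indicator fun _ => (1 : ℝ))
      (Measure.map (X 0) P)).comp_measurable (hXm 0)
  rw [← hmean]
  exact strong_law_ae_real (fun k ω => A.indicator (1 : E → ℝ) (X k ω)) hint
    (fun i j hij => (hind.indepFun hij).comp hm hm)
    (fun i => (IdentDistrib.mk (hXm i).aemeasurable (hXm 0).aemeasurable
      ((hlaw i).trans (hlaw 0).symm)).comp hm)

/-- The diagonal is a null set for ρ ⊗ ρ when ρ has no atoms. Injectivity is needed because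
configurations refer to relays by location, not by index. -/
theorem ae_injective_of_iIndepFun [MeasurableEq E] [NullSingletonClass ρ] [MeasurableSingletonClass E]
    (hXm : ∀ i, Measurable (X i)) (hlaw : ∀ i, Measure.map (X i) P = ρ) (hind : iIndepFun X P) :
    ∀ᵐ ω ∂P, Function.Injective fun i => X i ω := by
  have : IsProbabilityMeasure ρ := by
    rw [← hlaw 0]; exact Measure.isProbabilityMeasure_map (hXm 0).aemeasurable
  have h1 : ∀ i j, i ≠ j → ∀ᵐ ω ∂P, X i ω ≠ X j ω := fun i j hij => by
    have h2 := (indepFun_iff_map_prod_eq_prod_map_map (hXm i).aemeasurable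
      (hXm j).aemeasurable).1 (hind.indepFun hij)
    rw [hlaw, hlaw] at h2
    have h3 : (ρ.prod ρ) (Set.diagonal E) = 0 := by
      rw [Measure.measure_prod_null measurableSet_diagonal]
      refine .of_forall fun x => ?_
      have : Prod.mk x ⁻¹' Set.diagonal E = {x} := by
        ext y; simp [eq_comm]
      change ρ (Prod.mk x ⁻¹' Set.diagonal E) = 0
      rw [this, measure_singleton]
    rw [← h2, Measure.map_apply ((hXm i).prodMk (hXm j)) measurableSet_diagonal] at h3
    exact measure_eq_zero_iff_ae_notMem.1 h3
  have h2 : ∀ᵐ ω ∂P, ∀ i j, i ≠ j → X i ω ≠ X j ω := by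
    rw [ae_all_iff]; intro i
    rw [ae_all_iff]; intro j
    by_cases hij : i = j
    · exact .of_forall fun ω h => (h hij).elim
    · filter_upwards [h1 i j hij] with ω hω _ using hω
  filter_upwards [h2] with ω hω i j hij
  by_contra h
  exact hω i j h hij

end LawOfLargeNumbers

theorem nullSingletonClass_of_map_absolutelyContinuous {d : ℕ} (hd : 1 ≤ d)
    {W : Set (EuclideanSpace ℝ (Fin d))} {μ : Measure W}
    (h : Measure.map Subtype.val μ ≪ volume) : NullSingletonClass μ := by
  have : Nonempty (Fin d) := ⟨⟨0, hd⟩⟩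
  refine ⟨fun x => ?_⟩
  have h1 : Measure.map Subtype.val μ {(x : EuclideanSpace ℝ (Fin d))} = 0 := h (measure_singleton _)
  rw [Measure.map_apply measurable_subtype_coe (measurableSet_singleton _)] at h1
  have e : (Subtype.val ⁻¹' {(x : EuclideanSpace ℝ (Fin d))} : Set W) = {x} := by
    ext y; simp [Subtype.ext_iff]
  rwa [e] at h1

/-! ### Fine partitions, weak convergence and uniform continuity -/

section Mesh

variable {E : Type*} [MetricSpace E] [CompactSpace E] [MeasurableSpace E] [BorelSpace E]

/-- A compact space has a finite measurable partition into cells of small diameter. -/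
theorem exists_mesh [Nonempty E] {δ : ℝ} (hδ : 0 < δ) :
    ∃ (m : ℕ) (c : E → Fin m) (e : Fin m → E), Measurable c ∧ ∀ x, dist (e (c x)) x < δ := by
  set e := TopologicalSpace.denseSeq E with he
  have hcov : (Set.univ : Set E) ⊆ ⋃ k, Metric.ball (e k) δ := fun x _ => by
    obtain ⟨k, hk⟩ := (TopologicalSpace.denseRange_denseSeq E).exists_dist_lt x hδ
    exact Set.mem_iUnion.2 ⟨k, hk⟩
  obtain ⟨s, hs⟩ := isCompact_univ.elim_finite_subcover _ (fun k => Metric.isOpen_ball) hcov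
  set K := s.sup id with hK
  have hle : ∀ x, SimpleFunc.nearestPtInd e K x < K + 1 := fun x =>
    Nat.lt_succ_of_le (SimpleFunc.nearestPtInd_le e K x)
  refine ⟨K + 1, fun x => ⟨SimpleFunc.nearestPtInd e K x, hle x⟩, fun j => e j, ?_, fun x => ?_⟩
  · refine measurable_to_countable' fun j => ?_
    have : (fun x => (⟨SimpleFunc.nearestPtInd e K x, hle x⟩ : Fin (K + 1))) ⁻¹' {j} =
        SimpleFunc.nearestPtInd e K ⁻¹' {(j : ℕ)} := by
      ext x; simp [Fin.ext_iff]
    rw [this]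
    exact (SimpleFunc.nearestPtInd e K).measurable (measurableSet_singleton _)
  · obtain ⟨k, hk, hx⟩ := Set.mem_iUnion₂.1 (hs (Set.mem_univ x))
    have h1 := SimpleFunc.edist_nearestPt_le e x (Finset.le_sup (f := id) hk : k ≤ K)
    have h2 : dist (SimpleFunc.nearestPt e K x) x ≤ dist (e k) x := by
      rw [edist_dist, edist_dist] at h1
      exact (ENNReal.ofReal_le_ofReal_iff dist_nonneg).1 h1
    exact h2.trans_lt (by rw [dist_comm]; exact hx)

/-- Convergence of the masses of the cells of arbitrarily fine partitions implies weak
convergence. -/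
theorem tendsto_finiteMeasure_of_mesh {ι : Type*} {l : Filter ι} {ms : ι → FiniteMeasure E}
    {μ : FiniteMeasure E}
    (h : ∀ δ : ℝ, 0 < δ → ∃ (m : ℕ) (c : E → Fin m) (e : Fin m → E), Measurable c ∧
      (∀ x, dist (e (c x)) x < δ) ∧ ∀ j, Tendsto (fun i => (ms i : Measure E).real (c ⁻¹' {j})) l
        (𝓝 ((μ : Measure E).real (c ⁻¹' {j})))) :
    Tendsto ms l (𝓝 μ) := by
  rw [FiniteMeasure.tendsto_iff_forall_integral_tendsto]
  intro g
  rw [Metric.tendsto_nhds]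
  intro ε hε
  set B := (μ : Measure E).real Set.univ with hB
  have hB0 : 0 ≤ B := measureReal_nonneg
  -- The errors are ε'(B + 1) for `ms i`, ε' B for μ and ε' for the step sums, with total below ε.
  set ε' := ε / (2 * B + 2 + 1) with hε'
  have hε'0 : 0 < ε' := by positivity
  obtain ⟨δ, hδ, hg⟩ := Metric.uniformContinuous_iff.1
    (CompactSpace.uniformContinuous_of_continuous g.continuous) ε' hε'0
  obtain ⟨m, c, e, hc, hce, hm⟩ := h δ hδ
  have hstep : ∀ ρ : FiniteMeasure E, |∫ x, g x ∂(ρ : Measure E) -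
      ∑ j, (ρ : Measure E).real (c ⁻¹' {j}) * g (e j)| ≤
      ε' * ∑ j, (ρ : Measure E).real (c ⁻¹' {j}) := by
    intro ρ
    have h1 := sum_measureReal_fiber_mul (ρ : Measure E) hc fun _ => (1 : ℝ)
    simp only [mul_one, integral_const, smul_eq_mul] at h1
    have hi : Integrable (fun x => g (e (c x))) (ρ : Measure E) :=
      (Integrable.of_finite : Integrable (fun j => g (e j))
        (Measure.map c (ρ : Measure E))).comp_measurable hc
    rw [h1, sum_measureReal_fiber_mul (ρ : Measure E) hc fun j => g (e j),
      ← integral_sub (g.integrable _) hi, ← Real.norm_eq_abs]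
    refine norm_integral_le_of_norm_le_const (.of_forall fun x => ?_)
    rw [← dist_eq_norm, dist_comm]
    exact (hg (hce x)).le
  have hsum1 := tendsto_finsetSum Finset.univ fun j _ => (hm j).mul_const (g (e j))
  have hsum2 := tendsto_finsetSum Finset.univ fun j _ => hm j
  have hBsum : ∑ j, (μ : Measure E).real (c ⁻¹' {j}) = B := by
    have := sum_measureReal_fiber_mul (μ : Measure E) hc fun _ => (1 : ℝ)
    simp only [mul_one, integral_const, smul_eq_mul] at this
    exact this
  rw [hBsum] at hsum2
  filter_upwards [(Metric.tendsto_nhds.1 hsum1) ε' hε'0,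
    hsum2.eventually_lt_const (lt_add_one B)] with i h1 h2
  have h3 := hstep (ms i)
  have h4 := hstep μ
  rw [hBsum] at h4
  rw [Real.dist_eq] at h1 ⊢
  have h5 : ε' * ∑ j, (ms i : Measure E).real (c ⁻¹' {j}) ≤ ε' * (B + 1) :=
    mul_le_mul_of_nonneg_left h2.le hε'0.le
  have h6 : ε' * (2 * B + 2 + 1) = ε := by rw [hε']; field_simp
  rw [abs_lt] at h1 ⊢
  rw [abs_le] at h3 h4
  constructor <;> linarith [h1.1, h1.2, h3.1, h3.2, h4.1, h4.2]

/-- A continuous function of two variables, the second one in a compact space, is continuous in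
the first one uniformly in the second one. -/
theorem eventually_forall_abs_sub_lt {F K ι : Type*} [TopologicalSpace F] [TopologicalSpace K]
    [CompactSpace K] {f : F × K → ℝ} (hf : Continuous f) {l : Filter ι} {a : ι → F} {b : F}
    (h : Tendsto a l (𝓝 b)) {ε : ℝ} (hε : 0 < ε) :
    ∀ᶠ i in l, ∀ y, |f (a i, y) - f (b, y)| < ε := by
  -- Currying gives a continuous map into C(K, ℝ), where, K being compact, convergence is uniform.
  have h1 := ((ContinuousMap.curry ⟨f, hf⟩).continuous.tendsto b).comp h
  rw [ContinuousMap.tendsto_iff_tendstoUniformly, Metric.tendstoUniformly_iff] at h1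
  filter_upwards [h1 ε hε] with i hi y
  rw [← Real.dist_eq, dist_comm]
  exact hi y

end Mesh

/-! ### Reduction of the partition function to cells -/

section Sums

theorem abs_log_sum_sub_log_sum_le {σ : Type*} [Fintype σ] [Nonempty σ] {v w : σ → ℝ} {a : ℝ}
    (hw : ∀ s, 0 < w s) (h1 : ∀ s, v s ≤ Real.exp a * w s) (h2 : ∀ s, Real.exp (-a) * w s ≤ v s) :
    |Real.log (∑ s, v s) - Real.log (∑ s, w s)| ≤ a := by
  have hW : 0 < ∑ s, w s := Finset.sum_pos (fun s _ => hw s) Finset.univ_nonempty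
  have hv : ∀ s, 0 < v s := fun s => (mul_pos (Real.exp_pos _) (hw s)).trans_le (h2 s)
  have hV : 0 < ∑ s, v s := Finset.sum_pos (fun s _ => hv s) Finset.univ_nonempty
  have e1 : ∑ s, v s ≤ Real.exp a * ∑ s, w s := by
    rw [Finset.mul_sum]; exact Finset.sum_le_sum fun s _ => h1 s
  have e2 : Real.exp (-a) * ∑ s, w s ≤ ∑ s, v s := by
    rw [Finset.mul_sum]; exact Finset.sum_le_sum fun s _ => h2 s
  have l1 := Real.log_le_log hV e1
  have l2 := Real.log_le_log (by positivity) e2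
  rw [Real.log_mul (Real.exp_pos _).ne' hW.ne', Real.log_exp] at l1 l2
  rw [abs_le]
  constructor <;> linarith

end Sums

section Sandwich

variable {d : ℕ} {W : Set (EuclideanSpace ℝ (Fin d))} {kmax n : ℕ} {X : ℕ → W}

/-- The users, as the elements of the set of their locations. -/
def userEquiv (n : ℕ) (hX : Function.Injective X) : Fin n ≃ userSet n X :=
  Equiv.ofBijective (fun i => ⟨X i, Finset.mem_image.2 ⟨i, Finset.mem_range.2 i.2, rfl⟩⟩)
    ⟨fun i j h => Fin.ext (hX (Subtype.ext_iff.1 h)), fun y => by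
      obtain ⟨i, hi, hy⟩ := Finset.mem_image.1 y.2
      exact ⟨⟨i, Finset.mem_range.1 hi⟩, Subtype.ext hy⟩⟩

/-- Configurations, in terms of the indices of the users. -/
def configurationEquiv (kmax n : ℕ) (hX : Function.Injective X) :
    (Fin n → RoutePath kmax (Fin n)) ≃ Configuration kmax n X :=
  Equiv.piCongrRight fun _ => Equiv.sigmaCongrRight fun _ => Equiv.piCongrRight fun _ =>
    userEquiv n hX

/-- For distinct locations, equality of locations is equality of indices. -/
theorem incoming_configurationEquiv (hX : Function.Injective X)
    (s : Fin n → RoutePath kmax (Fin n)) (i : Fin n) :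
    (configurationEquiv kmax n hX s).incoming i = load s i := by
  unfold Configuration.incoming load
  refine Finset.sum_congr rfl fun j _ => ?_
  rw [RoutePath.count, Finset.card_filter]
  refine Finset.sum_congr rfl fun l _ => ?_
  have h : (((configurationEquiv kmax n hX s j).2 l : W) = X i) ↔ (s j).2 l = i := by
    change X ((s j).2 l : Fin n) = X i ↔ _
    rw [hX.eq_iff, Fin.ext_iff]
  by_cases h' : (s j).2 l = i
  · rw [if_pos (h.2 h')]; exact (if_pos h').symm
  · rw [if_neg (mt h.1 h')]; exact (if_neg h').symm

/-- Replacing γ f by Φ changes the exponent of each configuration by at most ε per user, hence the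
logarithm of the sum by at most ε n. -/
theorem abs_log_partitionFunction_sub_le {J : Type*} [Fintype J] [DecidableEq J]
    (hk : 0 < kmax) (hn : 0 < n) (hX : Function.Injective X)
    (f : (κ : Fin kmax) → FiniteMeasure W × (Fin (κ + 1 : ℕ) → W) → ℝ)
    (η : ℕ → ℝ) {γ β : ℝ} (t : ℝ≥0) (c : W → J) (Φ : J → RoutePath kmax J → ℝ) {ε : ℝ}
    (hΦ : ∀ (κ : Fin kmax) (x : Fin (κ + 1 : ℕ) → W),
      |γ * f κ (empiricalMeasure t n X, x) - Φ (c (x 0)) ⟨κ, fun l => c (x l.succ)⟩| ≤ ε) :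
    |Real.log (partitionFunction kmax f η γ β t n X) -
      Real.log (∑ s, configWeight (fun i : Fin n => c (X i)) (hopWeight n Φ)
        (fun m => Real.exp (-(β * η m))) s)| ≤ ε * n := by
  have : Nonempty (Fin n → RoutePath kmax (Fin n)) :=
    ⟨fun _ => ⟨⟨0, hk⟩, fun l => (Nat.not_lt_zero _ l.2).elim⟩⟩
  rw [partitionFunction, ← Equiv.sum_comp (configurationEquiv kmax n hX)]
  have hn' : (0 : ℝ) < n := Nat.cast_pos.2 hn
  obtain ⟨F, hF⟩ : ∃ F : (Fin n → RoutePath kmax (Fin n)) → Fin n → ℝ, F = fun s i =>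
      f (configurationEquiv kmax n hX s i).1
        (empiricalMeasure t n X, (configurationEquiv kmax n hX s).path i) := ⟨_, rfl⟩
  set D : (Fin n → RoutePath kmax (Fin n)) → ℝ := fun s => ∑ i,
    (γ * F s i - Φ (c (X i)) ((s i).map fun i : Fin n => c (X i))) with hD
  have hDle : ∀ s, |D s| ≤ ε * n := fun s => by
    refine (Finset.abs_sum_le_sum_abs _ _).trans
      ((Finset.sum_le_card_nsmul _ _ ε fun i _ => by rw [hF]; exact hΦ (s i).1 _).trans_eq ?_)
    rw [Finset.card_univ, Fintype.card_fin, nsmul_eq_mul, mul_comm]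
  have hw : ∀ s : Fin n → RoutePath kmax (Fin n),
      (configurationEquiv kmax n hX s).weight * Real.exp
        (-γ * (configurationEquiv kmax n hX s).interference f t -
          β * (configurationEquiv kmax n hX s).congestion η) =
      Real.exp (-D s) * configWeight (fun i : Fin n => c (X i)) (hopWeight n Φ)
        (fun m => Real.exp (-(β * η m))) s := fun s => by
    have e1 : (configurationEquiv kmax n hX s).weight =
        ∏ i, (1 / (n : ℝ)) ^ ((s i).1 : ℕ) := by
      refine Finset.prod_congr rfl fun i _ => ?_
      rw [one_div_pow]
      rfl
    have e2 : (configurationEquiv kmax n hX s).congestion η = ∑ i, η (load s i) :=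
      Finset.sum_congr rfl fun i _ => by rw [incoming_configurationEquiv]
    have e3 : (configurationEquiv kmax n hX s).interference f t =
      ∑ i, F s i := by rw [hF]; rfl
    unfold configWeight hopWeight
    rw [e1, e2, e3, Finset.prod_mul_distrib, ← Real.exp_sum, ← Real.exp_sum, mul_assoc,
      mul_left_comm (Real.exp _), ← Real.exp_add, ← Real.exp_add]
    congr 2
    simp only [hD]
    rw [Finset.sum_sub_distrib, Finset.sum_neg_distrib, Finset.sum_neg_distrib,
      ← Finset.mul_sum, ← Finset.mul_sum]
    ring
  have hpos : ∀ s, 0 < configWeight (fun i : Fin n => c (X i)) (hopWeight n Φ)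
        (fun m => Real.exp (-(β * η m))) s := fun s =>
    mul_pos (Finset.prod_pos fun i _ => hopWeight_pos hn Φ _ _)
      (Finset.prod_pos fun i _ => Real.exp_pos _)
  refine abs_log_sum_sub_log_sum_le hpos (fun s => ?_) fun s => ?_
  · rw [hw]
    exact mul_le_mul_of_nonneg_right (Real.exp_le_exp.2 (by linarith [(abs_le.1 (hDle s)).1]))
      (hpos s).le
  · rw [hw]
    exact mul_le_mul_of_nonneg_right (Real.exp_le_exp.2 (by linarith [(abs_le.1 (hDle s)).2]))
      (hpos s).le

theorem empiricalMeasure_real (t : ℝ≥0) (n : ℕ) (X : ℕ → W) {A : Set W} (hA : MeasurableSet A) :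
    (empiricalMeasure t n X : Measure W).real A =
      (∑ i ∈ Finset.range n, A.indicator (1 : W → ℝ) (X i)) / t := by
  have h1 : ∀ s : Finset ℕ, ((∑ i ∈ s, unitMass (X i) : FiniteMeasure W) : Measure W).real A =
      ∑ i ∈ s, A.indicator (1 : W → ℝ) (X i) := fun s => by
    rw [FiniteMeasure.toMeasure_sum, measureReal_def, Measure.finsetSum_apply,
      ENNReal.toReal_sum fun _ _ => measure_ne_top _ _]
    refine Finset.sum_congr rfl fun i _ => ?_
    change (Measure.dirac (X i) A).toReal = _
    rw [Measure.dirac_apply' _ hA]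
    by_cases h : X i ∈ A <;> simp [h]
  rw [empiricalMeasure, FiniteMeasure.toMeasure_smul, measureReal_nnreal_smul_apply, h1,
    NNReal.coe_inv, inv_mul_eq_div]

end Sandwich

/-! ### The limit along a sequence of users, and the theorem -/

section Limit

variable {d : ℕ} {W : Set (EuclideanSpace ℝ (Fin d))} {kmax : ℕ}

/-- Φ evaluates γ f(μ, ·) at the representatives of the cells; uniform continuity provides one δ
valid for all partitions of that fineness. -/
theorem exists_discretization [CompactSpace W] (μ : FiniteMeasure W)
    {f : (κ : Fin kmax) → FiniteMeasure W × (Fin (κ + 1 : ℕ) → W) → ℝ}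
    (hfc : ∀ κ, Continuous (f κ)) (γ : ℝ) {ε : ℝ} (hε : 0 < ε) :
    ∃ δ : ℝ, 0 < δ ∧ ∀ {J : Type} (c : W → J) (e : J → W), (∀ x, dist (e (c x)) x < δ) →
      ∃ Φ : J → RoutePath kmax J → ℝ, ∀ (κ : Fin kmax) (x : Fin (κ + 1 : ℕ) → W),
        |γ * f κ (μ, x) - Φ (c (x 0)) ⟨κ, fun l => c (x l.succ)⟩| ≤ ε := by
  have h1 : ∀ κ : Fin kmax, ∀ᶠ δ : ℝ in 𝓝[>] 0, ∀ x y : Fin (κ + 1 : ℕ) → W, dist x y < δ →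
      |γ * f κ (μ, x) - γ * f κ (μ, y)| < ε := fun κ => by
    have hc : Continuous fun x : Fin (κ + 1 : ℕ) → W => γ * f κ (μ, x) :=
      ((hfc κ).comp (Continuous.prodMk_right μ)).const_mul γ
    obtain ⟨δ, hδ, h⟩ := Metric.uniformContinuous_iff.1
      (CompactSpace.uniformContinuous_of_continuous hc) ε hε
    filter_upwards [Ioo_mem_nhdsGT hδ] with δ' hδ' x y hxy
    exact h (hxy.trans hδ'.2)
  obtain ⟨δ, h2, hδ⟩ := ((eventually_all.2 h1).and self_mem_nhdsWithin).exists
  refine ⟨δ, hδ, fun {J} c e he => ⟨fun j p => γ * f p.1 (μ, Fin.cons (e j) (e ∘ p.2)),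
    fun κ x => (h2 κ _ _ ?_).le⟩⟩
  rw [dist_pi_lt_iff hδ, Fin.forall_fin_succ]
  exact ⟨by rw [dist_comm]; exact he _, fun l => by rw [dist_comm]; exact he _⟩

theorem card_filter_eq_sum_indicator {J : Type*} [DecidableEq J] (n : ℕ) (X : ℕ → W) (c : W → J)
    (j : J) : (Finset.card {i : Fin n | c (X i) = j} : ℝ) =
      ∑ i ∈ Finset.range n, (c ⁻¹' {j}).indicator (1 : W → ℝ) (X i) := by
  rw [Finset.card_filter, Finset.sum_range]
  push_cast
  refine Finset.sum_congr rfl fun i _ => ?_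
  by_cases h : c (X i) = j
  · rw [if_pos h, Set.indicator_of_mem (s := c ⁻¹' {j}) h]; rfl
  · rw [if_neg h, Set.indicator_of_notMem (s := c ⁻¹' {j}) h]

/-- The limit of the partition function along a fixed sequence of users. -/
theorem tendsto_log_partitionFunction [CompactSpace W] {μ : FiniteMeasure W} (hμ : 0 < μ.mass)
    {n : ℝ≥0 → ℕ} {X : ℕ → W} (hX : Function.Injective X)
    (hn : Tendsto (fun t : ℝ≥0 => (n t : ℝ) / t) atTop (𝓝 (μ.mass : ℝ)))
    (hmesh : ∀ δ : ℝ, 0 < δ → ∃ (m : ℕ) (c : W → Fin m) (e : Fin m → W), Measurable c ∧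
      (∀ x, dist (e (c x)) x < δ) ∧ ∀ j, Tendsto (fun k : ℕ =>
        (∑ i ∈ Finset.range k, (c ⁻¹' {j}).indicator (1 : W → ℝ) (X i)) / k) atTop
        (𝓝 ((μ : Measure W).real (c ⁻¹' {j}) / μ.mass)))
    (hk : 0 < kmax)
    {f : (κ : Fin kmax) → FiniteMeasure W × (Fin (κ + 1 : ℕ) → W) → ℝ}
    (hfc : ∀ κ, Continuous (f κ)) {η : ℕ → ℝ} {Cη : ℝ} (hηb : ∀ m, Cη ≤ η m)
    (hη : Tendsto (fun m : ℕ => η m / (m : ℝ)) atTop atTop)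
    {γ β : ℝ} (hγ : 0 < γ) (hβ : 0 < β) :
    Tendsto (fun t : ℝ≥0 => ((1 / (t : ℝ) *
      Real.log (partitionFunction kmax f η γ β t (n t) X) : ℝ) : EReal)) atTop
      (𝓝 (-(⨅ Ψ : AdmissibleSetting μ kmax, Ψ.freeEnergy f η γ β))) := by
  have hμ' : (0 : ℝ) < μ.mass := by exact_mod_cast hμ
  set B : ℝ := (μ.mass : ℝ) with hB
  have hcoe : Tendsto (fun t : ℝ≥0 => (t : ℝ)) atTop atTop := NNReal.tendsto_coe_atTop.2 tendsto_id
  have hnR : Tendsto (fun t : ℝ≥0 => (n t : ℝ)) atTop atTop := by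
    have h1 := hn.pos_mul_atTop hμ' hcoe
    refine h1.congr' ?_
    filter_upwards [eventually_gt_atTop (0 : ℝ≥0)] with t ht
    have ht' : (t : ℝ) ≠ 0 := by exact_mod_cast ht.ne'
    exact div_mul_cancel₀ _ ht'
  have hnt : Tendsto n atTop atTop := tendsto_natCast_atTop_iff.1 hnR
  have hfreq : ∀ {m : ℕ} {c : W → Fin m} (j : Fin m), Tendsto (fun k : ℕ =>
        (∑ i ∈ Finset.range k, (c ⁻¹' {j}).indicator (1 : W → ℝ) (X i)) / k) atTop
        (𝓝 ((μ : Measure W).real (c ⁻¹' {j}) / B)) →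
      Tendsto (fun t : ℝ≥0 => (∑ i ∈ Finset.range (n t),
        (c ⁻¹' {j}).indicator (1 : W → ℝ) (X i)) / (t : ℝ)) atTop
        (𝓝 ((μ : Measure W).real (c ⁻¹' {j}))) := fun {m c} j h => by
    have h1 := (h.comp hnt).mul hn
    rw [div_mul_cancel₀ _ hμ'.ne'] at h1
    refine h1.congr' ?_
    filter_upwards [hnR.eventually_gt_atTop 0] with t ht
    exact div_mul_div_cancel₀ ht.ne'
  have hweak : Tendsto (fun t : ℝ≥0 => empiricalMeasure t (n t) X) atTop (𝓝 μ) := by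
    refine tendsto_finiteMeasure_of_mesh fun δ hδ => ?_
    obtain ⟨m, c, e, hc, he, hj⟩ := hmesh δ hδ
    refine ⟨m, c, e, hc, he, fun j => ?_⟩
    simp only [empiricalMeasure_real _ _ _ (hc (measurableSet_singleton j))]
    exact hfreq j (hj j)
  set θ := 1 / (Real.exp 1 * B) with hθ
  have hθ0 : 0 < θ := by positivity
  -- This equation is the origin of the parameter 1/(e μ(W)) of the weights c_m.
  have hθB : 1 + Real.log B + Real.log θ = 0 := by
    rw [hθ, Real.log_div one_ne_zero (by positivity), Real.log_mul (by positivity) hμ'.ne',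
      Real.log_exp, Real.log_one]
    ring
  have hC : ∀ m, β * Cη ≤ β * η m := fun m => mul_le_mul_of_nonneg_left (hηb m) hβ.le
  have hψ : Tendsto (fun m : ℕ => β * η m / m) atTop atTop :=
    (hη.const_mul_atTop hβ).congr fun m => (mul_div_assoc _ _ _).symm
  have hint : ∀ (κ : Fin kmax) (ρ : FiniteMeasure (Fin (κ + 1 : ℕ) → W)),
      Integrable (fun x => f κ (μ, x)) (ρ : Measure (Fin (κ + 1 : ℕ) → W)) := fun κ ρ =>
    ((hfc κ).comp (Continuous.prodMk_right μ)).integrable_of_hasCompactSupport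
      (HasCompactSupport.of_compactSpace _)
  have key : ∀ ε : ℝ, 0 < ε → ∃ (m : ℕ) (c : W → Fin m) (Φ : Fin m → RoutePath kmax (Fin m) → ℝ),
      Measurable c ∧ (∀ j, Tendsto (fun t : ℝ≥0 =>
        (Finset.card {i : Fin (n t) | c (X i) = j} : ℝ) / (t : ℝ)) atTop
        (𝓝 ((μ : Measure W).real (c ⁻¹' {j})))) ∧
      ∑ j, (μ : Measure W).real (c ⁻¹' {j}) = B ∧
      (∀ (κ : Fin kmax) (x : Fin (κ + 1 : ℕ) → W),
        |γ * f κ (μ, x) - Φ (c (x 0)) ⟨κ, fun l => c (x l.succ)⟩| ≤ ε) ∧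
      ∀ᶠ t : ℝ≥0 in atTop, |Real.log (partitionFunction kmax f η γ β t (n t) X) / t -
        Real.log (∑ s, configWeight (fun i : Fin (n t) => c (X i)) (hopWeight (n t) Φ)
        (fun m => Real.exp (-(β * η m))) s) / t| ≤ 2 * ε * (B + 1) := by
    intro ε hε
    obtain ⟨δ, hδ, hdisc⟩ := exists_discretization μ hfc γ hε
    obtain ⟨m, c, e, hc, he, hj⟩ := hmesh δ hδ
    obtain ⟨Φ, hΦ⟩ := hdisc c e he
    refine ⟨m, c, Φ, hc, fun j => ?_, AdmissibleSetting.sum_measureReal_fiber _ hc, hΦ, ?_⟩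
    · simp only [card_filter_eq_sum_indicator]
      exact hfreq j (hj j)
    · have hunif := eventually_all.2 fun κ =>
        eventually_forall_abs_sub_lt (hfc κ) hweak (div_pos hε hγ)
      filter_upwards [hunif, hnt.eventually_gt_atTop 0, hn.eventually_lt_const (lt_add_one B),
        eventually_gt_atTop (0 : ℝ≥0)] with t h1 h2 h3 h4
      have ht : (0 : ℝ) < t := by exact_mod_cast h4
      have h5 := abs_log_partitionFunction_sub_le hk h2 hX f η (γ := γ) (β := β) t c Φ
        (ε := 2 * ε) fun κ x => by
          have e1 := h1 κ x
          have e2 : |γ * f κ (empiricalMeasure t (n t) X, x) - γ * f κ (μ, x)| ≤ ε := by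
            rw [← mul_sub, abs_mul, abs_of_pos hγ]
            rw [lt_div_iff₀ hγ, mul_comm] at e1
            exact e1.le
          have e3 := abs_sub_le (γ * f κ (empiricalMeasure t (n t) X, x)) (γ * f κ (μ, x))
            (Φ (c (x 0)) ⟨κ, fun l => c (x l.succ)⟩)
          linarith [hΦ κ x]
      rw [← sub_div, abs_div, abs_of_pos ht, div_le_iff₀ ht]
      rw [div_lt_iff₀ ht] at h3
      refine h5.trans ?_
      rw [mul_assoc (2 * ε)]
      exact mul_le_mul_of_nonneg_left h3.le (by positivity)
  set V := ⨅ Ψ : AdmissibleSetting μ kmax, Ψ.freeEnergy f η γ β with hV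
  have hupper : ∀ b : ℝ, (b : EReal) < V → ∀ᶠ t : ℝ≥0 in atTop,
      1 / (t : ℝ) * Real.log (partitionFunction kmax f η γ β t (n t) X) ≤ -b := by
    intro b hb
    obtain ⟨b', hbb', hb'V⟩ := EReal.lt_iff_exists_real_btwn.1 hb
    rw [EReal.coe_lt_coe_iff] at hbb'
    -- The gap is spent on ε B for the lift, ε for a strict inequality, and 2ε(B + 1) for the
    -- replacement of f by Φ.
    set ε := (b' - b) / (B + 1 + 2 * (B + 1)) with hε
    have hε0 : 0 < ε := div_pos (sub_pos.2 hbb') (by positivity)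
    have hεb : ε * (B + 1 + 2 * (B + 1)) = b' - b := by rw [hε]; field_simp
    obtain ⟨m, c, Φ, hc, hL, hsum, hΦ, hclose⟩ := key ε hε0
    have h1 := eventually_log_partition_div_le hk hθ0 hC hψ Φ hcoe
      (fun t (i : Fin (n t)) => c (X i)) hL (by rw [hsum]; exact hμ') (by rw [hsum]; exact hθB)
      (b := b' - ε * B) (b' := b' - ε * B - ε) (fun ν u hset hs => by
        -- The lift is a competitor in the infimum, so every discrete setting has energy above b' -
        -- ε B.
        have h2 := (iInf_le _ (AdmissibleSetting.lift hset hc)).trans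
          (AdmissibleSetting.freeEnergy_lift_le hset hc hμ hβ Φ hηb hΦ (fun κ => hint κ _) hs)
        have h3 := hb'V.trans_le h2
        rw [EReal.coe_lt_coe_iff] at h3
        linarith) (by linarith)
    filter_upwards [h1, hclose] with t h4 h5
    rw [one_div_mul_eq_div]
    have := (abs_le.1 h5).2
    linarith
  have hlower : ∀ b : ℝ, V < (b : EReal) → ∀ᶠ t : ℝ≥0 in atTop,
      -b ≤ 1 / (t : ℝ) * Real.log (partitionFunction kmax f η γ β t (n t) X) := by
    intro b hb
    obtain ⟨Ψ, hΨ⟩ := iInf_lt_iff.1 hb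
    obtain ⟨b', hb'Ψ, hbb'⟩ := EReal.lt_iff_exists_real_btwn.1 hΨ
    rw [EReal.coe_lt_coe_iff] at hbb'
    set ε := (b - b') / (B + 2 * (B + 1)) with hε
    have hε0 : 0 < ε := div_pos (sub_pos.2 hbb') (by positivity)
    have hεb : ε * (B + 2 * (B + 1)) = b - b' := by rw [hε]; field_simp
    obtain ⟨m, c, Φ, hc, hL, hsum, hΦ, hclose⟩ := key ε hε0
    obtain ⟨hs, hle⟩ := Ψ.discreteEnergy_cellMass_le hc hμ hβ Φ hηb hΦ (fun κ => hint κ _)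
      (ne_top_of_lt hΨ)
    have h3 := hle.trans_lt hb'Ψ
    rw [EReal.coe_lt_coe_iff] at h3
    have h1 := eventually_le_log_partition_div_of_lt hk hθ0 hC Φ hcoe
      (fun t (i : Fin (n t)) => c (X i)) hL (by rw [hsum]; exact hμ') (by rw [hsum]; exact hθB)
      (Ψ.isDiscreteSetting_cellMass hc) hs (b := b' + ε * B) (by linarith)
    filter_upwards [h1, hclose] with t h4 h5
    rw [one_div_mul_eq_div]
    have := (abs_le.1 h5).1
    linarith
  -- Convergence in `EReal` is tested against real bounds, so finiteness of the infimum need not be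
  -- known.
  rw [tendsto_order]
  refine ⟨fun a ha => ?_, fun a ha => ?_⟩
  · obtain ⟨r, har, hr⟩ := EReal.lt_iff_exists_real_btwn.1 ha
    have h1 : V < ((-r : ℝ) : EReal) := by
      rw [EReal.coe_neg]
      exact EReal.lt_neg_comm.1 hr
    filter_upwards [hlower (-r) h1] with t ht
    rw [neg_neg] at ht
    exact har.trans_le (EReal.coe_le_coe_iff.2 ht)
  · obtain ⟨r, hr, har⟩ := EReal.lt_iff_exists_real_btwn.1 ha
    have h1 : ((-r : ℝ) : EReal) < V := by
      rw [EReal.coe_neg]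
      exact EReal.neg_lt_comm.1 hr
    filter_upwards [hupper (-r) h1] with t ht
    rw [neg_neg] at ht
    exact (EReal.coe_le_coe_iff.2 ht).trans_lt har

/-- Almost surely, the frequencies of the users in the cells of arbitrarily fine partitions
converge. -/
theorem ae_mesh_frequency [CompactSpace W] [Nonempty W] {Ω : Type*} [MeasurableSpace Ω]
    {P : Measure Ω} [IsProbabilityMeasure P] {X : ℕ → Ω → W} {ρ : Measure W}
    (hXm : ∀ i, Measurable (X i)) (hlaw : ∀ i, Measure.map (X i) P = ρ) (hind : iIndepFun X P) :
    ∀ᵐ ω ∂P, ∀ δ : ℝ, 0 < δ → ∃ (m : ℕ) (c : W → Fin m) (e : Fin m → W), Measurable c ∧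
      (∀ x, dist (e (c x)) x < δ) ∧ ∀ j, Tendsto (fun k : ℕ =>
        (∑ i ∈ Finset.range k, (c ⁻¹' {j}).indicator (1 : W → ℝ) (X i ω)) / k) atTop
        (𝓝 (ρ.real (c ⁻¹' {j}))) := by
  -- One partition per mesh size 1/(k + 1), fixed before sampling, so countably many null sets
  -- suffice. The strong law holds for every measurable cell; no condition on boundaries is needed.
  choose m c e hc he using fun k : ℕ => exists_mesh (E := W) (Nat.one_div_pos_of_nat (n := k))
  have h1 : ∀ᵐ ω ∂P, ∀ q j, Tendsto (fun k : ℕ =>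
        (∑ i ∈ Finset.range k, (c q ⁻¹' {j}).indicator (1 : W → ℝ) (X i ω)) / k) atTop
        (𝓝 (ρ.real (c q ⁻¹' {j}))) := by
    rw [ae_all_iff]; intro q
    rw [ae_all_iff]; intro j
    exact ae_tendsto_frequency hXm hlaw hind (hc q (measurableSet_singleton j))
  filter_upwards [h1] with ω hω δ hδ
  obtain ⟨q, hq⟩ := exists_nat_one_div_lt hδ
  exact ⟨m q, c q, e q, hc q, fun x => (he q x).trans hq, hω q⟩

end Limit

end MessageRouteing

end

theorem theorem1p2 {d : ℕ} (hd : 1 ≤ d)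
    (W : Set (EuclideanSpace ℝ (Fin d))) (hW : IsCompact W) (h0 : 0 ∈ W)
    (μ : FiniteMeasure W)
    (hμ : Measure.map Subtype.val (μ : Measure W) ≪ volume) (hμ0 : 0 < μ.mass)
    {Ω : Type*} [MeasurableSpace Ω] (P : Measure Ω) [IsProbabilityMeasure P]
    (N : ℝ≥0 → Ω → ℕ) (X : ℕ → Ω → W) (hX : MessageRouteing.IsUserProcess P μ N X)
    (kmax : ℕ) (hk : 1 ≤ kmax)
    (f : (κ : Fin kmax) → FiniteMeasure W × (Fin (κ + 1 : ℕ) → W) → ℝ)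
    (hfc : ∀ κ, Continuous (f κ)) (hfb : ∀ κ, ∃ C : ℝ, ∀ p, C ≤ f κ p)
    (η : ℕ → ℝ) (hηb : ∃ C : ℝ, ∀ m, C ≤ η m)
    (hη : Tendsto (fun m : ℕ => η m / (m : ℝ)) atTop atTop)
    (γ β : ℝ) (hγ : 0 < γ) (hβ : 0 < β) :
    ∀ᵐ ω ∂P,
      Tendsto
        (fun t : ℝ≥0 =>
          (((1 / (t : ℝ)) *
            Real.log (MessageRouteing.partitionFunction kmax f η γ β t (N t ω) (fun i => X i ω)) : ℝ) : EReal))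
        atTop
        (𝓝 (-(⨅ Ψ : MessageRouteing.AdmissibleSetting μ kmax, Ψ.freeEnergy f η γ β))) := by
  have : CompactSpace W := isCompact_iff_compactSpace.1 hW
  have : Nonempty W := ⟨⟨0, h0⟩⟩
  have : NullSingletonClass (μ : Measure W) :=
    MessageRouteing.nullSingletonClass_of_map_absolutelyContinuous hd hμ
  have hnull : NullSingletonClass (((μ : Measure W) Set.univ)⁻¹ • (μ : Measure W)) :=
    ⟨fun x => by rw [Measure.smul_apply, measure_singleton, smul_zero]⟩
  obtain ⟨Cη, hCη⟩ := hηb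
  filter_upwards [hX.poisson.ae_tendsto_div,
    MessageRouteing.ae_injective_of_iIndepFun hX.measurable hX.law hX.iIndep,
    MessageRouteing.ae_mesh_frequency hX.measurable hX.law hX.iIndep] with ω h1 h2 h3
  refine MessageRouteing.tendsto_log_partitionFunction hμ0 h2 h1 (fun δ hδ => ?_) hk hfc hCη hη
    hγ hβ
  obtain ⟨m, c, e, hc, he, hj⟩ := h3 δ hδ
  refine ⟨m, c, e, hc, he, fun j => ?_⟩
  have h4 := hj j
  rw [measureReal_ennreal_smul_apply, ENNReal.toReal_inv, inv_mul_eq_div] at h4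
  exact h4
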